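/- Let $\kappa\in\mathbb R$. Let $\rho_0$ be a finite nonnegative Borel measure on $\mathbb R$ and let $u_0:\mathbb R\to\mathbb R$ be piecewise continuous (finitely many discontinuities on each bounded interval, finite one-sided limits everywhere) and such that $m_0=u_0\rho_0$ is a finite signed measure, i.e. $\int|u_0|\,d\rho_0<\infty$. Put $$E_0(s)=\tfrac12\big(\rho_0((-\infty,s))+\rho_0((-\infty,s])\big),\qquad Q_{x,t}(s)=s+t\,u_0(s)+\tfrac12\kappa E_0(s)t^2-x .$$ For a function $f$ and $y\in[-\infty,\infty]$ let $\int_0^{y+}f\,d\rho_0$ and $\int_0^{y-}f\,d\rho_0$ be the oriented integrals from $0+$ up to $y$ with the point $y$ included, respectively excluded; thus $\int_0^{y+}f\,d\rho_0=\int_{(0,y]}f\,d\rho_0$ for $y\ge0$ and $-\int_{(y,0]}f\,d\rho_0$ for $y<0$, while $\int_0^{y-}f\,d\rho_0=\int_{(0,y)}f\,d\rho_0$ for $y>0$ and $-\int_{[y,0]}f\,d\rho_0$ for $y\le 0$. For $x\in\mathbb R$, $t\ge0$ let $F_{x,t}(y)=\int_0^{y+}Q_{x,t}\,d\rho_0$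 for $y\in\mathbb R$. Call $y\in[-\infty,\infty]$ a minimizer of $F_{x,t}$ if $y=\lim z_n$ for some real sequence with $F_{x,t}(z_n)\to\inf F_{x,t}$ (for finite $y$: one of $F_{x,t}(y-)$, $F_{x,t}(y+)$ equals the infimum), and let $y(x,t)\in[-\infty,\infty]$ be the supremum of the minimizers. Define $$\mathcal M(x,t)=\int_0^{y(x,t)\pm}d\rho_0,\qquad \mathcal P(x,t)=\int_0^{y(x,t)\pm}\big(u_0(s)+\kappa E_0(s)t\big)\,d\rho_0(s),$$ with the sign $+$ if $Q_{x,t}(y(x,t))\le0$ and the sign $-$ if $Q_{x,t}(y(x,t))>0$ (for $y(x,t)=\pm\infty$ the two integrals coincide). Then $(\rho,\rho u)=(\partial_x\mathcal M,\partial_x\mathcal P)$ is a weak solution of the pressureless Euler–Poisson system $$\rho_t+(\rho u)_x=0,\qquad(\rho u)_t+(\rho u^2)_x=\kappa\rho E,\qquad E_x=\rho,\ E(-\infty,t)=0,$$ with initial density $\rho_0$ and initial momentum $m_0$. That is: there are nonnegative measures $\rho(\cdot,t)$ on $\mathbb R$, finite for every $t\ge 0$ and depending measurably on $t$, and a Borel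 function $u(x,t)$ such that for every $t\ge0$, in the sense of distributions on $\mathbb R$, $\partial_x\mathcal M(\cdot,t)=\rho(\cdot,t)$ and $\partial_x\mathcal P(\cdot,t)=u(\cdot,t)\rho(\cdot,t)$ (with $\mathcal M(\cdot,t)$, $\mathcal P(\cdot,t)$ and the density $u(\cdot,t)$ locally integrable); for all $T,R>0$, $\int_0^T\rho(\mathbb R,t)\,dt<\infty$ and $\int_0^T\int_{[-R,R]}u^2\,d\rho(\cdot,t)\,dt<\infty$; and for all $\varphi\in C_c^\infty(\mathbb R\times[0,\infty))$ (restrictions of functions in $C_c^\infty(\mathbb R^2)$), $$\int_0^\infty\!\!\int\big(\varphi_t+u\varphi_x\big)\,d\rho(\cdot,t)\,dt+\int\varphi(x,0)\,d\rho_0(x)=0,$$ $$\int_0^\infty\!\!\int\big(u\varphi_t+u^2\varphi_x+\kappa E\varphi\big)\,d\rho(\cdot,t)\,dt+\int\varphi(x,0)u_0(x)\,d\rho_0(x)=0,$$ where $E(x,t)=\tfrac12\big(\rho((-\infty,x),t)+\rho((-\infty,x],t)\big)$. -/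

import Mathlib

open Set Filter Topology MeasureTheory ProbabilityTheory
open scoped ContDiff

namespace EulerPoisson

noncomputable section

/-- Piecewise continuity on the line: finitely many discontinuities on every bounded interval, and
finite one-sided limits at every point. -/
def PiecewiseContinuous (f : ℝ → ℝ) : Prop :=
  (∀ a b : ℝ, {x | x ∈ Icc a b ∧ ¬ ContinuousAt f x}.Finite) ∧
    ∀ x : ℝ, (∃ l : ℝ, Tendsto f (𝓝[<] x) (𝓝 l)) ∧ ∃ r : ℝ, Tendsto f (𝓝[>] x) (𝓝 r)

/-- The electric field of a measure, by the average rule: half the sum of the masses of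
`(-∞, s)` and of `(-∞, s]`. -/
def field (μ : Measure ℝ) (s : ℝ) : ℝ :=
  (μ.real (Iio s) + μ.real (Iic s)) / 2

/-- The oriented integral of `f` from `0` up to `y+` (an atom at `y` is included). The lower end
point `0` is read as `0+`, here and in `integralLeft`. -/
def integralRight (μ : Measure ℝ) (f : ℝ → ℝ) (y : EReal) : ℝ :=
  (∫ s in {s : ℝ | 0 < s ∧ (s : EReal) ≤ y}, f s ∂μ) -
    ∫ s in {s : ℝ | y < (s : EReal) ∧ s ≤ 0}, f s ∂μ

/-- The oriented integral of `f` from `0` up to `y-` (an atom at `y` is excluded). -/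
def integralLeft (μ : Measure ℝ) (f : ℝ → ℝ) (y : EReal) : ℝ :=
  (∫ s in {s : ℝ | 0 < s ∧ (s : EReal) < y}, f s ∂μ) -
    ∫ s in {s : ℝ | y ≤ (s : EReal) ∧ s ≤ 0}, f s ∂μ

/-- `Q_{x,t}(s) = s + t u₀(s) + κ E₀(s) t² / 2 - x`. -/
def Q (κ : ℝ) (ρ₀ : Measure ℝ) (u₀ : ℝ → ℝ) (x t s : ℝ) : ℝ :=
  s + t * u₀ s + 1 / 2 * κ * field ρ₀ s * t ^ 2 - x

/-- The function of `y` to be minimized. -/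
def potential (κ : ℝ) (ρ₀ : Measure ℝ) (u₀ : ℝ → ℝ) (x t y : ℝ) : ℝ :=
  integralRight ρ₀ (Q κ ρ₀ u₀ x t) (y : EReal)

/-- `y ∈ [-∞, ∞]` is a point at which the infimum of `F` is reached: the limit of a minimizing
sequence. If `F` has one-sided limits, this means for a finite `y` that one of `F (y-)`, `F y`,
`F (y+)` is the infimum of `F`. -/
def IsArgInf (F : ℝ → ℝ) (y : EReal) : Prop :=
  ∃ z : ℕ → ℝ, Tendsto (fun n => (z n : EReal)) atTop (𝓝 y) ∧
    Tendsto (fun n => (F (z n) : EReal)) atTop (𝓝 (⨅ s : ℝ, (F s : EReal)))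

/-- The largest minimizer `y(x,t)`, an extended real. -/
def largestMinimizer (κ : ℝ) (ρ₀ : Measure ℝ) (u₀ : ℝ → ℝ) (x t : ℝ) : EReal :=
  sSup {y : EReal | IsArgInf (potential κ ρ₀ u₀ x t) y}

open Classical in
/-- The integral of `f` against `ρ₀` from `0` up to `y(x,t)+` if `Q_{x,t}(y(x,t)) ≤ 0` and up to
`y(x,t)-` otherwise. For `y(x,t) = ±∞` the two branches agree, so that the value of `toReal` there
plays no role. -/
def integralToMinimizer (κ : ℝ) (ρ₀ : Measure ℝ) (u₀ : ℝ → ℝ) (f : ℝ → ℝ) (x t : ℝ) : ℝ :=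
  if Q κ ρ₀ u₀ x t (largestMinimizer κ ρ₀ u₀ x t).toReal ≤ 0 then
    integralRight ρ₀ f (largestMinimizer κ ρ₀ u₀ x t)
  else
    integralLeft ρ₀ f (largestMinimizer κ ρ₀ u₀ x t)

/-- The mass `M(x,t)`. -/
def mass (κ : ℝ) (ρ₀ : Measure ℝ) (u₀ : ℝ → ℝ) (x t : ℝ) : ℝ :=
  integralToMinimizer κ ρ₀ u₀ (fun _ => 1) x t

/-- The momentum `P(x,t)`. -/
def momentum (κ : ℝ) (ρ₀ : Measure ℝ) (u₀ : ℝ → ℝ) (x t : ℝ) : ℝ :=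
  integralToMinimizer κ ρ₀ u₀ (fun s => u₀ s + κ * field ρ₀ s * t) x t

/-- The distributional derivative of `f` on the line is the (locally finite, signed) measure with
density `g` with respect to `ν`. -/
def HasDistribDeriv (f : ℝ → ℝ) (ν : Measure ℝ) (g : ℝ → ℝ) : Prop :=
  LocallyIntegrable f volume ∧ LocallyIntegrable g ν ∧
    ∀ φ : ℝ → ℝ, ContDiff ℝ ∞ φ → HasCompactSupport φ →
      ∫ x, f x * deriv φ x = - ∫ x, φ x * g x ∂ν

/-- Weak (measure) solutions of the pressureless Euler-Poisson system
`ρ_t + (ρu)_x = 0`, `(ρu)_t + (ρu²)_x = κ ρ E`, `E_x = ρ`, `E(-∞,t) = 0` on `ℝ × [0,∞)` with initial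
density `ρ₀` and initial momentum `ρ₀ u₀`. The density at time `t` is the measure `ρ t`, the
momentum is `u(·,t) ρ t`, and `E(·,t)` is the field of `ρ t`. Test functions are smooth with compact
support in `ℝ × [0,∞)`, as restrictions of functions of `(x,t)` in the plane; they need not vanish
at `t = 0`. -/
structure IsWeakSolution (κ : ℝ) (ρ₀ : Measure ℝ) (u₀ : ℝ → ℝ)
    (ρ : Kernel ℝ ℝ) (u : ℝ → ℝ → ℝ) : Prop where
  finite : ∀ t : ℝ, 0 ≤ t → IsFiniteMeasure (ρ t)
  measurable : Measurable (fun p : ℝ × ℝ => u p.1 p.2)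
  mass_lt_top : ∀ T : ℝ, ∫⁻ t in Icc 0 T, ρ t univ < ⊤
  energy_lt_top : ∀ T R : ℝ,
    ∫⁻ t in Icc 0 T, ∫⁻ x in Icc (-R) R, ENNReal.ofReal (u x t ^ 2) ∂(ρ t) < ⊤
  mass_eq : ∀ φ : ℝ × ℝ → ℝ, ContDiff ℝ ∞ φ → HasCompactSupport φ →
    (∫ t in Ioi (0 : ℝ), ∫ x,
        (deriv (fun τ => φ (x, τ)) t + u x t * deriv (fun ξ => φ (ξ, t)) x) ∂(ρ t)) +
      ∫ x, φ (x, 0) ∂ρ₀ = 0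
  momentum_eq : ∀ φ : ℝ × ℝ → ℝ, ContDiff ℝ ∞ φ → HasCompactSupport φ →
    (∫ t in Ioi (0 : ℝ), ∫ x,
        (u x t * deriv (fun τ => φ (x, τ)) t + u x t ^ 2 * deriv (fun ξ => φ (ξ, t)) x +
          κ * field (ρ t) x * φ (x, t)) ∂(ρ t)) +
      ∫ x, φ (x, 0) * u₀ x ∂ρ₀ = 0

end

end EulerPoisson

/-! Label particles by mass: for m in (0, L), L = ρ₀(ℝ), let X₀(m) be the quantile of ρ₀ and put v =
u₀ ∘ X₀, e = E₀ ∘ X₀. Up to its sign and a term independent of y, F_{x,t}(y) is the form x m − t∫₀ᵐ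
v − ½κt²∫₀ᵐ e minus a first moment, where m = ρ₀((−∞, y]). The supremum ψ(x,t) of these forms is
convex in x. A contact slope at (x,t) is an m whose form touches ψ there and lies below ψ at all
other (x',t'). Limits of masses along minimizing sequences are contact slopes
(`mem_contactSet_of_tendsto`), and by Fubini ∫₀ᵐ e = m²/2 at them. At fixed t the contact slope is
unique for all but countably many x, so the variational formula selects the right mass and momentum
almost everywhere.

The particle m sits at X(t,m), the generalized inverse of the largest contact slope. The density is
the image of Lebesgue measure on (0, L) under X(t,·). The velocity U is the free velocity v + κte
averaged over each cluster of particles at a common position, a conditional expectation given the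
position.

Trajectories: let θ(t,·) be the Legendre transform of ψ(·,t). Interpolating the supporting forms at
the two ends of a cluster (`support_pos`) gives θ(t',m) − θ(t,m) ≤ (t'−t)∫₀ᵐ U(t,·) + O((t'−t)²). A
one-sided bound of this kind at every t already makes ∫₀ᵐ U the time derivative of θ, while X is its
mass derivative. Comparing mixed differences, X(T,m) − X(0,m) = ∫₀ᵀ U(t,m) dt for almost every m
(`ae_pos_eq_path`). Conservation of mass is then the chain rule and Fubini.

Momentum: the free velocity is affine in time, so the product rule along one particle is exact.
Replacing it by U in an integral over m₁ ≤ m ≤ m₂ costs only the derivative of φ along the two end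
particles times the defect ∫₀^{mᵢ}(free velocity − U). As u₀ is only in L¹(ρ₀), no bound on U² is
available beforehand. But the defect is monotone in t up to a small linear drift, and time integrals
of the derivative of φ along a particle are at most 2 sup|φ|. Hence the error is controlled by the
defects at times 0 and T and by the drift (`abs_integral_transport_mul_defect_le`), and vanishes as
m₁ → 0 and m₂ → L. The test function arctan x yields the local energy bound (`integrable_energy`),
after which compactly supported φ pass to the limit. Finally e may be replaced by the midpoint of
the cluster, the field of ρ(·,t), because both have primitive m²/2 at the cluster ends
(`integral_mul_e_eq`). -/

namespace EulerPoisson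

noncomputable section

/-! ### One-sided quadratic bounds, a second mean value estimate, and the chain rule along
absolutely continuous curves. -/

section RealAnalysis

/-- Adding the inequalities for (t, t') and (t', t) cancels f; division by t' − t leaves the claim.
-/
theorem antitoneOn_of_quadratic_supergradient {f g : ℝ → ℝ} {s : Set ℝ} {C : ℝ}
    (h : ∀ t ∈ s, ∀ t' ∈ s, f t' - f t ≤ g t * (t' - t) + C * (t' - t) ^ 2) :
    AntitoneOn (fun t => g t - 2 * C * t) s := by
  intro t ht t' ht' htt'
  rcases htt'.eq_or_lt with rfl | hlt
  · exact le_rfl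
  have h1 := h t ht t' ht'
  have h2 := h t' ht' t ht
  have h3 : 0 ≤ (t' - t) * ((g t - 2 * C * t) - (g t' - 2 * C * t')) := by nlinarith
  have := nonneg_of_mul_nonneg_right h3 (sub_pos.2 hlt)
  simpa using this

theorem intervalIntegrable_of_quadratic_supergradient {f g : ℝ → ℝ} {a b C : ℝ} (hab : a ≤ b)
    (h : ∀ t ∈ Icc a b, ∀ t' ∈ Icc a b, f t' - f t ≤ g t * (t' - t) + C * (t' - t) ^ 2) :
    IntervalIntegrable g volume a b := by
  have h1 : IntervalIntegrable (fun t => g t - 2 * C * t) volume a b := by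
    apply AntitoneOn.intervalIntegrable
    rw [uIcc_of_le hab]
    exact antitoneOn_of_quadratic_supergradient h
  have h2 : IntervalIntegrable (fun t => 2 * C * t) volume a b :=
    (Continuous.intervalIntegrable (by fun_prop) _ _)
  simpa using h1.add h2

/-- A function with one-sided quadratic control by `g` on `[a, b]` is a primitive of `g`. -/
theorem integral_eq_sub_of_quadratic_supergradient {f g : ℝ → ℝ} {a b C : ℝ} (hab : a ≤ b)
    (h : ∀ t ∈ Icc a b, ∀ t' ∈ Icc a b, f t' - f t ≤ g t * (t' - t) + C * (t' - t) ^ 2) :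
    ∫ t in a..b, g t = f b - f a := by
  have hanti := antitoneOn_of_quadratic_supergradient h
  have hgb : ∃ K, ∀ t ∈ Icc a b, |g t| ≤ K := by
    refine ⟨|g a - 2 * C * a| + |g b - 2 * C * b| + 2 * |C| * (|a| + |b|), fun t ht => ?_⟩
    have h1 := hanti (left_mem_Icc.2 hab) ht ht.1
    have h2 := hanti ht (right_mem_Icc.2 hab) ht.2
    simp only at h1 h2
    have h3 : |2 * C * t| ≤ 2 * |C| * (|a| + |b|) := by
      rw [abs_mul, abs_mul, abs_two]
      gcongr
      exact (abs_le_max_abs_abs ht.1 ht.2).trans (max_le (by simp) (by simp))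
    have h4 := abs_le.1 h3
    have := neg_abs_le (g b - 2 * C * b)
    have := le_abs_self (g a - 2 * C * a)
    have := abs_nonneg (g b - 2 * C * b)
    have := abs_nonneg (g a - 2 * C * a)
    rw [abs_le]
    constructor <;> linarith
  obtain ⟨K, hK⟩ := hgb
  have hlow : ∀ t ∈ Icc a b, ∀ t' ∈ Icc a b,
      g t' * (t' - t) - C * (t' - t) ^ 2 ≤ f t' - f t := by
    intro t ht t' ht'
    have := h t' ht' t ht
    nlinarith
  have hcont : ContinuousOn f (Icc a b) := by
    intro t ht
    have hz : Tendsto (fun t' => f t' - f t) (𝓝[Icc a b] t) (𝓝 0) := by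
      have hb : Tendsto (fun t' => K * |t' - t| + |C| * (t' - t) ^ 2) (𝓝[Icc a b] t) (𝓝 0) := by
        have : Continuous (fun t' => K * |t' - t| + |C| * (t' - t) ^ 2) := by fun_prop
        have := this.tendsto t
        simp only [sub_self, abs_zero, mul_zero, ne_eq, OfNat.ofNat_ne_zero, not_false_eq_true,
          zero_pow, add_zero] at this
        exact this.mono_left nhdsWithin_le_nhds
      refine squeeze_zero_norm' ?_ hb
      filter_upwards [self_mem_nhdsWithin] with t' ht'
      have h1 := h t ht t' ht'
      have h2 := hlow t ht t' ht'
      have h3 : |g t * (t' - t)| ≤ K * |t' - t| := by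
        rw [abs_mul]; gcongr; exact hK t ht
      have h4 : |g t' * (t' - t)| ≤ K * |t' - t| := by
        rw [abs_mul]; gcongr; exact hK t' ht'
      have h5 : C * (t' - t) ^ 2 ≤ |C| * (t' - t) ^ 2 := by gcongr; exact le_abs_self C
      rw [Real.norm_eq_abs, abs_le]
      constructor
      · linarith [neg_abs_le (g t' * (t' - t))]
      · linarith [le_abs_self (g t * (t' - t))]
    have := hz.add_const (f t)
    simpa [ContinuousWithinAt] using this
  -- The function g − 2Ct is antitone, hence continuous off a countable set; at its continuity
  -- points the two-sided squeeze gives the derivative g.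
  refine integral_eq_of_hasDerivAt_off_countable_of_le f g hab
    (hanti.countable_not_continuousWithinAt) hcont ?_
    (intervalIntegrable_of_quadratic_supergradient hab h)
  rintro t ⟨ht, htc⟩
  have htI : t ∈ Icc a b := Ioo_subset_Icc_self ht
  have hgc : ContinuousAt g t := by
    have h1 : ContinuousWithinAt (fun t => g t - 2 * C * t) (Icc a b) t := by
      by_contra hc
      exact htc ⟨htI, hc⟩
    have h2 := h1.continuousAt (Icc_mem_nhds ht.1 ht.2)
    have h3 : ContinuousAt (fun t => 2 * C * t) t := by fun_prop
    exact (h2.add h3).congr (Eventually.of_forall fun t => by simp)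
  rw [hasDerivAt_iff_tendsto_slope]
  have hz : Tendsto (fun t' => slope f t t' - g t) (𝓝[≠] t) (𝓝 0) := by
    have hb : Tendsto (fun t' => |g t' - g t| + |C| * |t' - t|) (𝓝[≠] t) (𝓝 0) := by
      have : ContinuousAt (fun t' => |g t' - g t| + |C| * |t' - t|) t := by fun_prop
      have := this.tendsto
      simp only [sub_self, abs_zero, mul_zero, add_zero] at this
      exact this.mono_left nhdsWithin_le_nhds
    refine squeeze_zero_norm' ?_ hb
    filter_upwards [self_mem_nhdsWithin, nhdsWithin_le_nhds (Icc_mem_nhds ht.1 ht.2)]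
      with t' hne ht'
    have hne : t' - t ≠ 0 := sub_ne_zero.2 hne
    have h1 := h t htI t' ht'
    have h2 := hlow t htI t' ht'
    have hs : slope f t t' - g t = (f t' - f t - g t * (t' - t)) / (t' - t) := by
      rw [slope_def_field]; field_simp
    rw [hs, Real.norm_eq_abs, abs_div, div_le_iff₀ (abs_pos.2 hne)]
    have h3 : |(g t' - g t) * (t' - t)| = |g t' - g t| * |t' - t| := abs_mul _ _
    have h5 : |C * (t' - t) ^ 2| = |C| * |t' - t| * |t' - t| := by
      rw [abs_mul, abs_pow]; ring
    have e1 := neg_abs_le ((g t' - g t) * (t' - t))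
    have e2 := le_abs_self (C * (t' - t) ^ 2)
    have e3 := mul_nonneg (abs_nonneg (g t' - g t)) (abs_nonneg (t' - t))
    rw [abs_le]
    constructor <;> nlinarith
  simpa using hz.add_const (g t)

/-- Bound for the integral of `f' g` with `g` monotone, in terms of the size of a primitive
of `f'`. -/
theorem abs_integral_mul_le_of_monotoneOn {f' g : ℝ → ℝ} {T K : ℝ} (hT : 0 ≤ T)
    (hf' : IntervalIntegrable f' volume 0 T) (hK : ∀ t ∈ Icc 0 T, |∫ s in t..T, f' s| ≤ K)
    (hg : MonotoneOn g (Icc 0 T)) :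
    |∫ t in 0..T, f' t * g t| ≤ K * (2 * |g 0| + |g T|) := by
  have h0 : (0 : ℝ) ∈ Icc 0 T := left_mem_Icc.2 hT
  have hTm : T ∈ Icc 0 T := right_mem_Icc.2 hT
  have hK0 : 0 ≤ K := (abs_nonneg _).trans (hK 0 h0)
  set G := g T - g 0 with hG
  have hG0 : 0 ≤ G := sub_nonneg.2 (hg h0 hTm hT)
  let μ : Measure ℝ := volume.restrict (Ioc 0 T)
  let ν : Measure ℝ := volume.restrict (Ioc 0 G)
  have hf'μ : Integrable f' μ := (intervalIntegrable_iff_integrableOn_Ioc_of_le hT).1 hf'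
  have hgm : AEMeasurable g μ :=
    aemeasurable_restrict_of_monotoneOn measurableSet_Ioc (hg.mono Ioc_subset_Icc_self)
  have hgm' : AEStronglyMeasurable (fun p : ℝ × ℝ =>
      ({p : ℝ × ℝ | p.2 ≤ g p.1 - g 0}.indicator (fun p => f' p.1) p)) (μ.prod ν) := by
    have h1 : NullMeasurableSet {p : ℝ × ℝ | p.2 ≤ g p.1 - g 0} (μ.prod ν) := by
      apply nullMeasurableSet_le
      · exact measurable_snd.aemeasurable
      · exact (hgm.comp_quasiMeasurePreserving Measure.quasiMeasurePreserving_fst).sub_const _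
    exact (hf'μ.1.comp_quasiMeasurePreserving Measure.quasiMeasurePreserving_fst).indicator₀ h1
  have hint : Integrable (fun p : ℝ × ℝ =>
      ({p : ℝ × ℝ | p.2 ≤ g p.1 - g 0}.indicator (fun p => f' p.1) p)) (μ.prod ν) := by
    refine (hf'μ.comp_fst ν).mono hgm' (Eventually.of_forall fun p => ?_)
    exact norm_indicator_le_norm_self _ _
  -- Layer cake: g t − g 0 is the measure of the levels l in (0, g t − g 0]. After Fubini, each
  -- level contributes the integral of f' over a superlevel set of g, which up to one point is an
  -- interval (c, T], so that `hK` applies.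
  have hswap := integral_integral_swap (f := fun t l =>
    ({p : ℝ × ℝ | p.2 ≤ g p.1 - g 0}.indicator (fun p => f' p.1) (t, l))) hint
  have hleft : ∫ t, ∫ l, ({p : ℝ × ℝ | p.2 ≤ g p.1 - g 0}.indicator (fun p => f' p.1) (t, l)) ∂ν ∂μ
      = ∫ t in 0..T, f' t * (g t - g 0) := by
    rw [intervalIntegral.integral_of_le hT]
    refine setIntegral_congr_fun measurableSet_Ioc fun t ht => ?_
    have htI : t ∈ Icc 0 T := Ioc_subset_Icc_self ht
    have e1 : 0 ≤ g t - g 0 := sub_nonneg.2 (hg h0 htI ht.1.le)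
    have e2 : g t - g 0 ≤ G := by simpa [hG] using hg htI hTm ht.2
    have : ∀ l, ({p : ℝ × ℝ | p.2 ≤ g p.1 - g 0}.indicator (fun p => f' p.1) (t, l))
        = (Iic (g t - g 0)).indicator (fun _ => f' t) l := by
      intro l
      by_cases hl : l ≤ g t - g 0 <;> simp [indicator, hl]
    simp only [this]
    rw [integral_indicator measurableSet_Iic, Measure.restrict_restrict measurableSet_Iic,
      integral_const]
    have : Iic (g t - g 0) ∩ Ioc 0 G = Ioc 0 (g t - g 0) := by
      ext l; simp only [mem_inter_iff, mem_Iic, mem_Ioc]; constructor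
      · rintro ⟨p, q, r⟩; exact ⟨q, p⟩
      · rintro ⟨p, q⟩; exact ⟨q, p, q.trans e2⟩
    rw [this]
    simp [Measure.real, e1, mul_comm]
  have hright : |∫ l, ∫ t, ({p : ℝ × ℝ | p.2 ≤ g p.1 - g 0}.indicator
      (fun p => f' p.1) (t, l)) ∂μ ∂ν| ≤ K * G := by
    have hb : ∀ l ∈ Ioc 0 G, ‖∫ t, ({p : ℝ × ℝ | p.2 ≤ g p.1 - g 0}.indicator
      (fun p => f' p.1) (t, l)) ∂μ‖ ≤ K := by
      intro l hl
      have hin : ∀ t, ({p : ℝ × ℝ | p.2 ≤ g p.1 - g 0}.indicator (fun p => f' p.1) (t, l))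
          = {t | l ≤ g t - g 0}.indicator f' t := by
        intro t
        by_cases hl : l ≤ g t - g 0 <;> simp [indicator, hl]
      simp only [hin]
      set A := {t | t ∈ Icc 0 T ∧ l ≤ g t - g 0} with hA
      have hAne : A.Nonempty := ⟨T, hTm, hl.2⟩
      have hAb : BddBelow A := ⟨0, fun t ht => ht.1.1⟩
      set c := sInf A with hc
      have hcI : c ∈ Icc 0 T :=
        ⟨le_csInf hAne fun t ht => ht.1.1, csInf_le hAb ⟨hTm, hl.2⟩⟩
      have hae : {t | l ≤ g t - g 0}.indicator f' =ᵐ[μ] (Ioc c T).indicator f' := by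
        have hne : ∀ᵐ t ∂μ, t ≠ c := by
          apply ae_restrict_of_ae
          simp [ae_iff, measure_singleton]
        filter_upwards [ae_restrict_mem measurableSet_Ioc, hne] with t ht htc
        by_cases htA : l ≤ g t - g 0
        · have : t ∈ Ioc c T :=
            ⟨lt_of_le_of_ne (csInf_le hAb ⟨Ioc_subset_Icc_self ht, htA⟩) (Ne.symm htc), ht.2⟩
          rw [indicator_of_mem this, indicator_of_mem (by exact htA)]
        · have : t ∉ Ioc c T := by
            rintro ⟨h1, -⟩
            obtain ⟨r, hr, hrt⟩ := exists_lt_of_csInf_lt hAne h1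
            have := hg hr.1 (Ioc_subset_Icc_self ht) hrt.le
            exact htA (by linarith [hr.2])
          rw [indicator_of_notMem this, indicator_of_notMem (by exact htA)]
      rw [integral_congr_ae hae, integral_indicator measurableSet_Ioc,
        Measure.restrict_restrict measurableSet_Ioc,
        inter_eq_self_of_subset_left (Ioc_subset_Ioc_left hcI.1),
        ← intervalIntegral.integral_of_le hcI.2]
      exact hK c hcI
    have := norm_setIntegral_le_of_norm_le_const (μ := volume) (by simp) hb
    simpa [Measure.real, hG0] using this
  rw [← hswap, hleft] at hright
  have hmain : ∫ t in 0..T, f' t * g t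
      = (∫ t in 0..T, f' t * (g t - g 0)) + (∫ t in 0..T, f' t) * g 0 := by
    rw [← intervalIntegral.integral_mul_const, ← intervalIntegral.integral_add]
    · congr 1; ext t; ring
    · rw [intervalIntegrable_iff_integrableOn_Ioc_of_le hT]
      refine Integrable.mul_bdd (c := G) hf'μ ?_ ?_
      · exact (hgm.sub_const _).aestronglyMeasurable
      · filter_upwards [ae_restrict_mem measurableSet_Ioc] with t ht
        have htI : t ∈ Icc 0 T := Ioc_subset_Icc_self ht
        rw [Real.norm_eq_abs, abs_of_nonneg (sub_nonneg.2 (hg h0 htI ht.1.le)), hG]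
        linarith [hg htI hTm ht.2]
    · exact hf'.mul_const _
  rw [hmain]
  have h2 : |(∫ t in 0..T, f' t) * g 0| ≤ K * |g 0| := by
    rw [abs_mul]; gcongr; exact hK 0 h0
  have h3 : G ≤ |g T| + |g 0| := by
    linarith [le_abs_self (g T), neg_abs_le (g 0)]
  calc _ ≤ K * G + K * |g 0| := (abs_add_le _ _).trans (add_le_add hright h2)
    _ ≤ K * (|g T| + |g 0|) + K * |g 0| := by gcongr
    _ = _ := by ring

/-- Fundamental theorem of calculus along an absolutely continuous curve. -/
theorem integral_fderiv_along_primitive {φ : ℝ × ℝ → ℝ} (hφ : ContDiff ℝ 1 φ) {w : ℝ → ℝ}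
    {c T : ℝ} (hT : 0 ≤ T) (hw : IntervalIntegrable w volume 0 T) :
    ∫ t in 0..T, (fderiv ℝ φ (c + ∫ s in 0..t, w s, t) (0, 1)
        + fderiv ℝ φ (c + ∫ s in 0..t, w s, t) (1, 0) * w t)
      = φ (c + ∫ s in 0..T, w s, T) - φ (c, 0) := by
  set Y : ℝ → ℝ := fun t => c + ∫ s in 0..t, w s with hY
  have hYac : AbsolutelyContinuousOnInterval (fun t => ∫ s in 0..t, w s) 0 T :=
    hw.absolutelyContinuousOnInterval_intervalIntegral left_mem_uIcc
  obtain ⟨B, hB⟩ := hYac.exists_bound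
  obtain ⟨K, hK⟩ := (hφ.contDiffOn (s := Icc (c - B) (c + B) ×ˢ Icc 0 T)).exists_lipschitzOnWith
    one_ne_zero ((convex_Icc _ _).prod (convex_Icc _ _)) (isCompact_Icc.prod isCompact_Icc)
  have hmem : ∀ t ∈ uIcc 0 T, (Y t, t) ∈ Icc (c - B) (c + B) ×ˢ Icc 0 T := by
    intro t ht
    have := hB t ht
    rw [Real.norm_eq_abs, abs_le] at this
    rw [uIcc_of_le hT] at ht
    refine ⟨⟨?_, ?_⟩, ht⟩ <;> simp only [hY] <;> linarith
  have hid : AbsolutelyContinuousOnInterval (fun t : ℝ => t) 0 T :=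
    (LipschitzWith.id.lipschitzOnWith (s := uIcc 0 T)).absolutelyContinuousOnInterval
  -- On the box containing the curve φ is K-Lipschitz, so the variation sums of the composite are at
  -- most K times those of the two components.
  have hac : AbsolutelyContinuousOnInterval (fun t => φ (Y t, t)) 0 T := by
    have hlim : Tendsto (fun E : ℕ × (ℕ → ℝ × ℝ) => (K : ℝ) *
        ((∑ i ∈ Finset.range E.1, dist (∫ s in 0..(E.2 i).1, w s) (∫ s in 0..(E.2 i).2, w s))
          + ∑ i ∈ Finset.range E.1, dist (E.2 i).1 (E.2 i).2))
        (AbsolutelyContinuousOnInterval.totalLengthFilter ⊓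
          𝓟 (AbsolutelyContinuousOnInterval.disjWithin 0 T)) (𝓝 0) := by
      have := (Tendsto.add hYac hid).const_mul (K : ℝ)
      simpa using this
    refine squeeze_zero' (Eventually.of_forall fun E => Finset.sum_nonneg fun i _ => dist_nonneg)
      ?_ hlim
    filter_upwards [mem_inf_of_right (mem_principal_self _)] with E hE
    rw [← Finset.sum_add_distrib, Finset.mul_sum]
    refine Finset.sum_le_sum fun i hi => ?_
    have h1 := hK.dist_le_mul _ (hmem _ (hE.1 i hi).1) _ (hmem _ (hE.1 i hi).2)
    refine h1.trans ?_
    gcongr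
    rw [Prod.dist_eq]
    simp only [hY, dist_add_left]
    exact max_le (le_add_of_nonneg_right dist_nonneg) (le_add_of_nonneg_left dist_nonneg)
  have hY0 : Y 0 = c := by simp [hY]
  have := hac.integral_deriv_eq_sub
  rw [hY0] at this
  rw [← this]
  refine intervalIntegral.integral_congr_ae ?_
  filter_upwards [hw.ae_hasDerivAt_integral] with t ht htI
  have hd : HasDerivAt Y (w t) t :=
    (ht (uIoc_subset_uIcc htI) 0 left_mem_uIcc).const_add c
  have h1 : HasDerivAt (fun t => (Y t, t)) (w t, 1) t := hd.prodMk (hasDerivAt_id t)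
  have h2 := HasFDerivAt.comp_hasDerivAt (f := fun t => (Y t, t)) t
    ((hφ.differentiable one_ne_zero) (Y t, t)).hasFDerivAt h1
  change _ = deriv (fun t => φ (Y t, t)) t
  rw [show deriv (fun t => φ (Y t, t)) t = fderiv ℝ φ (Y t, t) (w t, 1) from h2.deriv]
  have : ((w t, 1) : ℝ × ℝ) = (0, 1) + w t • (1, 0) := by simp
  rw [this, map_add, map_smul, smul_eq_mul, mul_comm]

end RealAnalysis

/-! ### The space-time potential, its contact slopes and the particle positions. -/

/-- Slopes `m` at which the potential `ψ` has, at `(x, t)`, the supporting function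
`m x' - t' ∫₀ᵐ v - κ t'² m² / 4`. -/
def contactSet (κ L : ℝ) (v e : ℝ → ℝ) (ψ : ℝ → ℝ → ℝ) (x t : ℝ) : Set ℝ :=
  {m | m ∈ Icc 0 L ∧ ∫ s in 0..m, e s = m ^ 2 / 2 ∧ ∀ x' t' : ℝ,
    ψ x t + m * (x' - x) - ((t' - t) * (∫ s in 0..m, v s) + κ / 2 * (t' ^ 2 - t ^ 2) * (m ^ 2 / 2))
      ≤ ψ x' t'}

/-- A potential `ψ` in space-time, touched from below at each point by the functions belonging to
initial velocities `v` and fields `e` given in the mass coordinate. -/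
structure MassFlow where
  κ : ℝ
  L : ℝ
  v : ℝ → ℝ
  e : ℝ → ℝ
  ψ : ℝ → ℝ → ℝ
  L_pos : 0 < L
  measurable_v : Measurable v
  integrable_v : Integrable v volume
  bdd_v : ∀ a ∈ Ioo 0 L, ∀ b ∈ Ioo 0 L, ∃ K, ∀ m ∈ Icc a b, |v m| ≤ K
  measurable_e : Measurable e
  e_nonneg : ∀ m, 0 ≤ e m
  e_le : ∀ m, e m ≤ L
  nonempty_contactSet : ∀ x t, (contactSet κ L v e ψ x t).Nonempty
  growth_right : ∀ t, ∀ m < L, ∃ m' > m, ∃ c, ∀ x, x * m' - c ≤ ψ x t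
  growth_left : ∀ t, ∀ m > 0, ∃ m' < m, ∃ c, ∀ x, x * m' - c ≤ ψ x t

namespace MassFlow

variable (D : MassFlow)

def contact (x t : ℝ) : Set ℝ := contactSet D.κ D.L D.v D.e D.ψ x t

/-- This will be the mass of (−∞, x] at time t, and `lower` that of (−∞, x); the masses strictly
between them form the cluster at x. -/
def upper (x t : ℝ) : ℝ := sSup (D.contact x t)

def lower (x t : ℝ) : ℝ := sInf (D.contact x t)

open Classical in
/-- The position at time `t` of the particle with mass coordinate `m`. -/
def pos (t m : ℝ) : ℝ := if m ∈ Ioo 0 D.L then sInf {x | m ≤ D.upper x t} else 0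

/-- The free velocity of the particle with mass coordinate `m`. -/
def freeVel (t m : ℝ) : ℝ := D.v m + D.κ * t * D.e m

/-- The primitive of the free velocity. -/
def freeMom (t m : ℝ) : ℝ := ∫ s in 0..m, D.freeVel t s

/-- The velocity field: the average of the free velocity over the cluster at `x`. -/
def velocity (x t : ℝ) : ℝ :=
  if D.lower x t < D.upper x t then
    (D.freeMom t (D.upper x t) - D.freeMom t (D.lower x t)) / (D.upper x t - D.lower x t)
  else D.freeVel t (D.lower x t)

/-- The velocity of the particle with mass coordinate `m`. -/
def vel (t m : ℝ) : ℝ := D.velocity (D.pos t m) t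

theorem intervalIntegrable_v (a b : ℝ) : IntervalIntegrable D.v volume a b :=
  D.integrable_v.intervalIntegrable

theorem intervalIntegrable_e (a b : ℝ) : IntervalIntegrable D.e volume a b := by
  refine (intervalIntegrable_const (c := D.L)).mono_fun D.measurable_e.aestronglyMeasurable
    (Eventually.of_forall fun m => ?_)
  simp only [Real.norm_eq_abs, abs_of_nonneg (D.e_nonneg m), abs_of_pos D.L_pos]
  exact D.e_le m

theorem continuous_primitive_v : Continuous fun m => ∫ s in 0..m, D.v s :=
  intervalIntegral.continuous_primitive D.intervalIntegrable_v 0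

theorem continuous_primitive_e : Continuous fun m => ∫ s in 0..m, D.e s :=
  intervalIntegral.continuous_primitive D.intervalIntegrable_e 0

theorem measurable_freeVel : Measurable fun p : ℝ × ℝ => D.freeVel p.1 p.2 := by
  unfold freeVel
  exact (D.measurable_v.comp measurable_snd).add
    ((measurable_fst.const_mul _).mul (D.measurable_e.comp measurable_snd))

theorem intervalIntegrable_freeVel (t a b : ℝ) : IntervalIntegrable (D.freeVel t) volume a b :=
  (D.intervalIntegrable_v a b).add ((D.intervalIntegrable_e a b).const_mul _)

theorem freeMom_eq (t m : ℝ) :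
    D.freeMom t m = (∫ s in 0..m, D.v s) + D.κ * t * ∫ s in 0..m, D.e s := by
  unfold freeMom freeVel
  rw [intervalIntegral.integral_add (D.intervalIntegrable_v _ _)
    ((D.intervalIntegrable_e _ _).const_mul _), intervalIntegral.integral_const_mul]

theorem continuous_freeMom : Continuous fun p : ℝ × ℝ => D.freeMom p.1 p.2 := by
  simp only [freeMom_eq]
  exact (D.continuous_primitive_v.comp continuous_snd).add
    ((continuous_const.mul continuous_fst).mul (D.continuous_primitive_e.comp continuous_snd))

variable {D}

theorem abs_primitive_v_le (m : ℝ) : |∫ s in 0..m, D.v s| ≤ ∫ s, |D.v s| := by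
  have h := intervalIntegral.norm_integral_le_integral_norm_uIoc (f := D.v) (a := 0) (b := m)
    (μ := volume)
  refine h.trans (setIntegral_le_integral D.integrable_v.norm ?_)
  exact Eventually.of_forall fun _ => norm_nonneg _

/-- The supporting function has coefficients bounded independently of m. Using it at both of two
points gives the continuity of ψ. -/
theorem sub_le_of_mem_contact {x t m : ℝ} (hm : m ∈ D.contact x t) (x' t' : ℝ) :
    D.ψ x t - D.ψ x' t' ≤ D.L * |x' - x| + |t' - t| * (∫ s, |D.v s|)
      + |D.κ| / 2 * |t' ^ 2 - t ^ 2| * (D.L ^ 2 / 2) := by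
  obtain ⟨⟨h0, hL⟩, -, h⟩ := hm
  have h1 := h x' t'
  have h2 : |m * (x' - x)| ≤ D.L * |x' - x| := by
    rw [abs_mul, abs_of_nonneg h0]; gcongr
  have h3 : |(t' - t) * ∫ s in 0..m, D.v s| ≤ |t' - t| * (∫ s, |D.v s|) := by
    rw [abs_mul]; gcongr; exact abs_primitive_v_le m
  have h4 : |D.κ / 2 * (t' ^ 2 - t ^ 2) * (m ^ 2 / 2)|
      ≤ |D.κ| / 2 * |t' ^ 2 - t ^ 2| * (D.L ^ 2 / 2) := by
    rw [abs_mul, abs_mul, abs_div, abs_two, abs_of_nonneg (show 0 ≤ m ^ 2 / 2 by positivity)]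
    gcongr
  linarith [neg_abs_le (m * (x' - x)), le_abs_self ((t' - t) * ∫ s in 0..m, D.v s),
    le_abs_self (D.κ / 2 * (t' ^ 2 - t ^ 2) * (m ^ 2 / 2))]

variable (D) in
theorem continuous_ψ : Continuous fun p : ℝ × ℝ => D.ψ p.1 p.2 := by
  rw [continuous_iff_continuousAt]
  rintro ⟨x, t⟩
  have hz : Tendsto (fun p : ℝ × ℝ => D.ψ p.1 p.2 - D.ψ x t) (𝓝 (x, t)) (𝓝 0) := by
    have hb : Tendsto (fun p : ℝ × ℝ => D.L * |p.1 - x| + |p.2 - t| * (∫ s, |D.v s|)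
      + |D.κ| / 2 * |p.2 ^ 2 - t ^ 2| * (D.L ^ 2 / 2)) (𝓝 (x, t)) (𝓝 0) := by
      have : Continuous (fun p : ℝ × ℝ => D.L * |p.1 - x| + |p.2 - t| * (∫ s, |D.v s|)
        + |D.κ| / 2 * |p.2 ^ 2 - t ^ 2| * (D.L ^ 2 / 2)) := by fun_prop
      simpa using this.tendsto (x, t)
    refine squeeze_zero_norm' (Eventually.of_forall fun p => ?_) hb
    obtain ⟨m, hm⟩ := D.nonempty_contactSet x t
    obtain ⟨m', hm'⟩ := D.nonempty_contactSet p.1 p.2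
    have h1 := sub_le_of_mem_contact hm p.1 p.2
    have h2 := sub_le_of_mem_contact hm' x t
    rw [abs_sub_comm x, abs_sub_comm t, abs_sub_comm (t ^ 2)] at h2
    rw [Real.norm_eq_abs, abs_le]
    constructor <;> linarith
  have := hz.add_const (D.ψ x t)
  simpa [ContinuousAt] using this

variable (D) in
-- Contact is a family of closed conditions, ψ and the primitives being continuous. The
-- semicontinuity of `upper` and `lower`, and with it measurability in (x, t), comes from here.
theorem isClosed_graph_contact :
    IsClosed {q : (ℝ × ℝ) × ℝ | q.2 ∈ D.contact q.1.1 q.1.2} := by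
  have h1 : Continuous fun q : (ℝ × ℝ) × ℝ => D.ψ q.1.1 q.1.2 := D.continuous_ψ.comp continuous_fst
  have h2 : Continuous fun q : (ℝ × ℝ) × ℝ => ∫ s in 0..q.2, D.v s :=
    D.continuous_primitive_v.comp continuous_snd
  have h3 : Continuous fun q : (ℝ × ℝ) × ℝ => ∫ s in 0..q.2, D.e s :=
    D.continuous_primitive_e.comp continuous_snd
  have : {q : (ℝ × ℝ) × ℝ | q.2 ∈ D.contact q.1.1 q.1.2} = {q : (ℝ × ℝ) × ℝ | q.2 ∈ Icc 0 D.L} ∩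
      ({q : (ℝ × ℝ) × ℝ | ∫ s in 0..q.2, D.e s = q.2 ^ 2 / 2} ∩ ⋂ x' : ℝ, ⋂ t' : ℝ,
        {q : (ℝ × ℝ) × ℝ | D.ψ q.1.1 q.1.2 + q.2 * (x' - q.1.1) - ((t' - q.1.2) *
          (∫ s in 0..q.2, D.v s) + D.κ / 2 * (t' ^ 2 - q.1.2 ^ 2) * (q.2 ^ 2 / 2)) ≤
            D.ψ x' t'}) := by
    ext q
    simp [contact, contactSet]
  rw [this]
  refine (isClosed_Icc.preimage continuous_snd).inter ((isClosed_eq h3 (by fun_prop)).inter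
    (isClosed_iInter fun x' => isClosed_iInter fun t' => isClosed_le ?_ continuous_const))
  fun_prop

theorem contact_subset (x t : ℝ) : D.contact x t ⊆ Icc 0 D.L := fun _ hm => hm.1

theorem isClosed_contact (x t : ℝ) : IsClosed (D.contact x t) :=
  D.isClosed_graph_contact.preimage (f := fun m => ((x, t), m)) (by fun_prop)

theorem bddAbove_contact (x t : ℝ) : BddAbove (D.contact x t) :=
  bddAbove_Icc.mono (contact_subset x t)

theorem bddBelow_contact (x t : ℝ) : BddBelow (D.contact x t) :=
  bddBelow_Icc.mono (contact_subset x t)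

variable (D) in
theorem upper_mem (x t : ℝ) : D.upper x t ∈ D.contact x t :=
  (isClosed_contact x t).csSup_mem (D.nonempty_contactSet x t) (bddAbove_contact x t)

variable (D) in
theorem lower_mem (x t : ℝ) : D.lower x t ∈ D.contact x t :=
  (isClosed_contact x t).csInf_mem (D.nonempty_contactSet x t) (bddBelow_contact x t)

theorem le_upper {x t m : ℝ} (hm : m ∈ D.contact x t) : m ≤ D.upper x t :=
  le_csSup (bddAbove_contact x t) hm

theorem lower_le {x t m : ℝ} (hm : m ∈ D.contact x t) : D.lower x t ≤ m :=
  csInf_le (bddBelow_contact x t) hm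

variable (D) in
theorem lower_le_upper (x t : ℝ) : D.lower x t ≤ D.upper x t := lower_le (D.upper_mem x t)

variable (D) in
theorem lower_nonneg (x t : ℝ) : 0 ≤ D.lower x t := (D.lower_mem x t).1.1

variable (D) in
theorem upper_le (x t : ℝ) : D.upper x t ≤ D.L := (D.upper_mem x t).1.2

/-- Monotonicity of subgradients: add the supporting inequalities of the two points at the same
time. -/
theorem contact_mono {x x' t m m' : ℝ} (hx : x < x') (hm : m ∈ D.contact x t)
    (hm' : m' ∈ D.contact x' t) : m ≤ m' := by
  have h1 := hm.2.2 x' t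
  have h2 := hm'.2.2 x t
  have h3 : 0 ≤ (x' - x) * (m' - m) := by nlinarith
  linarith [nonneg_of_mul_nonneg_right h3 (sub_pos.2 hx)]

theorem upper_le_lower {x x' : ℝ} (t : ℝ) (hx : x < x') : D.upper x t ≤ D.lower x' t :=
  contact_mono hx (D.upper_mem x t) (D.lower_mem x' t)

variable (D) in
theorem monotone_upper (t : ℝ) : Monotone fun x => D.upper x t := by
  intro x x' h
  rcases h.eq_or_lt with rfl | h
  · exact le_rfl
  · exact (upper_le_lower t h).trans (D.lower_le_upper x' t)

/-- Limit points of contact slopes are contact slopes. -/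
theorem exists_mem_contact_of_tendsto {p : ℕ → ℝ × ℝ} {x t : ℝ} {m : ℕ → ℝ}
    (hp : Tendsto p atTop (𝓝 (x, t))) (hm : ∀ n, m n ∈ D.contact (p n).1 (p n).2) :
    ∃ m₀ ∈ D.contact x t, ∃ φ : ℕ → ℕ, StrictMono φ ∧ Tendsto (m ∘ φ) atTop (𝓝 m₀) := by
  obtain ⟨m₀, -, φ, hφ, hlim⟩ := isCompact_Icc.tendsto_subseq (fun n => (hm n).1)
  refine ⟨m₀, ?_, φ, hφ, hlim⟩
  have h1 : Tendsto (fun n => (p (φ n), m (φ n))) atTop (𝓝 ((x, t), m₀)) :=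
    (hp.comp hφ.tendsto_atTop).prodMk_nhds hlim
  exact D.isClosed_graph_contact.mem_of_tendsto h1 (Eventually.of_forall fun n => hm (φ n))

variable (D) in
theorem isClosed_le_upper (c : ℝ) : IsClosed {p : ℝ × ℝ | c ≤ D.upper p.1 p.2} := by
  refine IsSeqClosed.isClosed fun p q hp hpq => ?_
  obtain ⟨m₀, hm₀, φ, -, hlim⟩ := exists_mem_contact_of_tendsto (x := q.1) (t := q.2) hpq
    fun n => D.upper_mem (p n).1 (p n).2
  exact (ge_of_tendsto' hlim fun n => hp (φ n)).trans (le_upper hm₀)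

variable (D) in
theorem isClosed_lower_le (c : ℝ) : IsClosed {p : ℝ × ℝ | D.lower p.1 p.2 ≤ c} := by
  refine IsSeqClosed.isClosed fun p q hp hpq => ?_
  obtain ⟨m₀, hm₀, φ, -, hlim⟩ := exists_mem_contact_of_tendsto (x := q.1) (t := q.2) hpq
    fun n => D.lower_mem (p n).1 (p n).2
  exact (lower_le hm₀).trans (le_of_tendsto' hlim fun n => hp (φ n))

variable (D) in
theorem measurable_upper : Measurable fun p : ℝ × ℝ => D.upper p.1 p.2 :=
  measurable_of_Ici fun c => (D.isClosed_le_upper c).measurableSet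

variable (D) in
theorem measurable_lower : Measurable fun p : ℝ × ℝ => D.lower p.1 p.2 :=
  measurable_of_Iic fun c => (D.isClosed_lower_le c).measurableSet

variable (D) in
theorem measurable_velocity : Measurable fun p : ℝ × ℝ => D.velocity p.1 p.2 := by
  have hu := D.measurable_upper
  have hl := D.measurable_lower
  have h1 : Measurable fun p : ℝ × ℝ => D.freeMom p.2 (D.upper p.1 p.2) :=
    D.continuous_freeMom.measurable.comp (measurable_snd.prodMk hu)
  have h2 : Measurable fun p : ℝ × ℝ => D.freeMom p.2 (D.lower p.1 p.2) :=
    D.continuous_freeMom.measurable.comp (measurable_snd.prodMk hl)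
  exact Measurable.ite (measurableSet_lt hl hu) ((h1.sub h2).div (hu.sub hl))
    (D.measurable_freeVel.comp (measurable_snd.prodMk hl))

/-- If all slopes stayed below m, then ψ(·, t) would grow at most like x m for x → +∞, against
`growth_right`, which puts a line of larger slope under ψ. -/
theorem exists_le_upper (t : ℝ) {m : ℝ} (hm : m < D.L) : ∃ x, m ≤ D.upper x t := by
  obtain ⟨m', hm', c, hc⟩ := D.growth_right t m hm
  by_contra! h
  set x := max 0 ((D.ψ 0 t + c) / (m' - m)) + 1
  have hx : 0 < x := by positivity
  have h1 := (D.upper_mem x t).2.2 0 t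
  have h2 := hc x
  have h3 : x * D.upper x t ≤ x * m := by gcongr; exact (h x).le
  have h4 : (D.ψ 0 t + c) / (m' - m) < x := (le_max_right _ _).trans_lt (lt_add_one _)
  rw [div_lt_iff₀ (sub_pos.2 hm')] at h4
  nlinarith

theorem exists_upper_lt (t : ℝ) {m : ℝ} (hm : 0 < m) : ∃ x, D.upper x t < m := by
  obtain ⟨m', hm', c, hc⟩ := D.growth_left t m hm
  by_contra! h
  set y := max 0 ((D.ψ 0 t + c) / (m - m')) + 1
  have hx : 0 < y := by positivity
  have h1 := (D.upper_mem (-y) t).2.2 0 t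
  have h2 := hc (-y)
  have h3 : y * m ≤ y * D.upper (-y) t := by gcongr; exact (h (-y))
  have h4 : (D.ψ 0 t + c) / (m - m') < y := (le_max_right _ _).trans_lt (lt_add_one _)
  rw [div_lt_iff₀ (sub_pos.2 hm')] at h4
  nlinarith

/-- The function `upper` is monotone in x with closed superlevel sets, so the infimum in `pos` is
attained and the two are in Galois connection. -/
theorem pos_le_iff {t m : ℝ} (hm : m ∈ Ioo 0 D.L) (x : ℝ) :
    D.pos t m ≤ x ↔ m ≤ D.upper x t := by
  have hne : {x | m ≤ D.upper x t}.Nonempty := exists_le_upper t hm.2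
  have hbdd : BddBelow {x | m ≤ D.upper x t} := by
    obtain ⟨x₀, hx₀⟩ := exists_upper_lt t hm.1
    refine ⟨x₀, fun x hx => ?_⟩
    by_contra! hlt
    exact absurd (hx.trans (D.monotone_upper t hlt.le)) (not_le.2 hx₀)
  have hcl : IsClosed {x | m ≤ D.upper x t} :=
    (D.isClosed_le_upper m).preimage (f := fun x => (x, t)) (by fun_prop)
  rw [pos, if_pos hm]
  constructor
  · intro h
    exact le_trans (hcl.csInf_mem hne hbdd) (D.monotone_upper t h)
  · exact fun h => csInf_le hbdd h

theorem le_upper_pos {t m : ℝ} (hm : m ∈ Ioo 0 D.L) : m ≤ D.upper (D.pos t m) t :=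
  (pos_le_iff hm _).1 le_rfl

/-- To the left of the position all slopes are below m; they accumulate at a contact slope of the
position itself. -/
theorem lower_pos_le {t m : ℝ} (hm : m ∈ Ioo 0 D.L) : D.lower (D.pos t m) t ≤ m := by
  set x := D.pos t m with hx
  have hp : Tendsto (fun n : ℕ => ((x - 1 / ((n : ℝ) + 1), t) : ℝ × ℝ)) atTop (𝓝 (x, t)) := by
    refine Tendsto.prodMk_nhds ?_ tendsto_const_nhds
    simpa using (tendsto_const_nhds (x := x)).sub (tendsto_one_div_add_atTop_nhds_zero_nat (𝕜 := ℝ))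
  obtain ⟨m₀, hm₀, φ, -, hlim⟩ := exists_mem_contact_of_tendsto hp
    fun n => D.upper_mem (x - 1 / ((n : ℝ) + 1)) t
  refine (lower_le hm₀).trans (le_of_tendsto' hlim fun n => ?_)
  have h1 : ¬ D.pos t m ≤ x - 1 / ((φ n : ℝ) + 1) := by
    rw [← hx, not_le]
    have : (0 : ℝ) < 1 / ((φ n : ℝ) + 1) := by positivity
    linarith
  rw [pos_le_iff hm] at h1
  exact (not_le.1 h1).le

theorem le_lower_of_pos_lt {t m x : ℝ} (hm : m ∈ Ioo 0 D.L) (h : D.pos t m < x) :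
    m ≤ D.lower x t :=
  (le_upper_pos hm).trans (upper_le_lower t h)

theorem pos_lt_of_lt_lower {t m x : ℝ} (hm : m ∈ Ioo 0 D.L) (h : m < D.lower x t) :
    D.pos t m < x := by
  by_contra! hx
  rcases hx.eq_or_lt with rfl | hlt
  · exact absurd (lower_pos_le hm) (not_le.2 h)
  · have : D.pos t m ≤ x := (pos_le_iff hm x).2 (h.le.trans (D.lower_le_upper x t))
    exact absurd this (not_le.2 hlt)

theorem pos_mono {t m m' : ℝ} (hm : m ∈ Ioo 0 D.L) (hm' : m' ∈ Ioo 0 D.L) (h : m ≤ m') :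
    D.pos t m ≤ D.pos t m' :=
  (pos_le_iff hm _).2 (h.trans (le_upper_pos hm'))

variable (D) in
theorem measurable_pos : Measurable fun p : ℝ × ℝ => D.pos p.1 p.2 := by
  refine measurable_of_Iic fun x => ?_
  have h1 : MeasurableSet {p : ℝ × ℝ | p.2 ∈ Ioo 0 D.L} := measurable_snd measurableSet_Ioo
  have h2 : MeasurableSet {p : ℝ × ℝ | p.2 ≤ D.upper x p.1} :=
    measurableSet_le measurable_snd
      (D.measurable_upper.comp (measurable_const.prodMk measurable_fst))
  have : (fun p : ℝ × ℝ => D.pos p.1 p.2) ⁻¹' Iic x =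
      ({p : ℝ × ℝ | p.2 ∈ Ioo 0 D.L} ∩ {p : ℝ × ℝ | p.2 ≤ D.upper x p.1}) ∪
        ({p : ℝ × ℝ | p.2 ∈ Ioo 0 D.L}ᶜ ∩ {_p : ℝ × ℝ | 0 ≤ x}) := by
    ext p
    by_cases hp : p.2 ∈ Ioo 0 D.L
    · simp only [mem_preimage, mem_Iic, pos_le_iff hp, mem_union, mem_inter_iff, mem_ofPred_eq, hp,
        true_and, mem_compl_iff, not_true_eq_false, false_and, or_false]
    · have h0 : D.pos p.1 p.2 = 0 := if_neg hp
      simp only [mem_preimage, mem_Iic, h0, mem_union, mem_inter_iff, mem_ofPred_eq, hp,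
        false_and, mem_compl_iff, not_false_eq_true, true_and, false_or]
  rw [this]
  exact (h1.inter h2).union (h1.compl.inter (MeasurableSet.const _))

theorem measurable_pos_right (t : ℝ) : Measurable (D.pos t) :=
  Measurable.comp (g := fun p : ℝ × ℝ => D.pos p.1 p.2) D.measurable_pos measurable_prodMk_left

variable (D) in
theorem measurable_vel : Measurable fun p : ℝ × ℝ => D.vel p.1 p.2 := by
  have h : Measurable fun p : ℝ × ℝ => (D.pos p.1 p.2, p.1) :=
    D.measurable_pos.prodMk measurable_fst
  have h' := D.measurable_velocity.comp h
  exact h'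

theorem measurable_vel_right (t : ℝ) : Measurable (D.vel t) := by
  have h := D.measurable_vel.comp (measurable_prodMk_left (x := t))
  exact h

theorem freeMom_of_mem_contact {x t m : ℝ} (hm : m ∈ D.contact x t) (r : ℝ) :
    D.freeMom r m = (∫ s in 0..m, D.v s) + D.κ * r * (m ^ 2 / 2) := by
  rw [freeMom_eq, hm.2.1]

/-- The supporting function at the position of a particle. -/
theorem support_pos {t m : ℝ} (hm : m ∈ Ioo 0 D.L) (x' t' : ℝ) :
    D.ψ (D.pos t m) t + m * (x' - D.pos t m) - ((t' - t) * (D.freeMom t (D.lower (D.pos t m) t)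
      + (m - D.lower (D.pos t m) t) * D.vel t m) + D.κ / 4 * (t' - t) ^ 2 *
      (m ^ 2 + (m - D.lower (D.pos t m) t) * (D.upper (D.pos t m) t - m))) ≤ D.ψ x' t' := by
  unfold vel
  have hlm := lower_pos_le (t := t) hm
  have hmu := le_upper_pos (t := t) hm
  set x := D.pos t m
  have hl := (D.lower_mem x t).2.2 x' t'
  have hu := (D.upper_mem x t).2.2 x' t'
  have hlM := freeMom_of_mem_contact (D.lower_mem x t) t
  have huM := freeMom_of_mem_contact (D.upper_mem x t) t
  unfold velocity
  set l := D.lower x t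
  set u := D.upper x t
  -- Recentring at t: expressed by the free momentum at time t, the force term has (t' − t)² instead
  -- of t'² − t².
  rw [show (∫ s in 0..l, D.v s) = D.freeMom t l - D.κ * t * (l ^ 2 / 2) by linarith] at hl
  rw [show (∫ s in 0..u, D.v s) = D.freeMom t u - D.κ * t * (u ^ 2 / 2) by linarith] at hu
  split_ifs with h
  · have hd : 0 < u - l := sub_pos.2 h
    -- The convex combination with weights u − m and m − l, multiplied out by u − l. It replaces m²
    -- by its chord between l and u, whose value at m is m² + (m − l)(u − m).
    have e1 := mul_le_mul_of_nonneg_left hl (sub_nonneg.2 hmu)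
    have e2 := mul_le_mul_of_nonneg_left hu (sub_nonneg.2 hlm)
    have : (u - l) * (D.ψ x t + m * (x' - x) - ((t' - t) * (D.freeMom t l
      + (m - l) * ((D.freeMom t u - D.freeMom t l) / (u - l))) + D.κ / 4 * (t' - t) ^ 2 *
      (m ^ 2 + (m - l) * (u - m)))) ≤ (u - l) * D.ψ x' t' := by
      have e3 : (u - l) * (D.ψ x t + m * (x' - x) - ((t' - t) * (D.freeMom t l
        + (m - l) * ((D.freeMom t u - D.freeMom t l) / (u - l))) + D.κ / 4 * (t' - t) ^ 2 *
        (m ^ 2 + (m - l) * (u - m)))) = (u - l) * (D.ψ x t + m * (x' - x)) - ((t' - t) *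
          ((u - l) * D.freeMom t l + (m - l) * (D.freeMom t u - D.freeMom t l))
          + (u - l) * (D.κ / 4 * (t' - t) ^ 2 * (m ^ 2 + (m - l) * (u - m)))) := by
        field_simp
      rw [e3]
      linarith
    exact le_of_mul_le_mul_left this hd
  · have e1 : l = m := by linarith
    have e2 : u = m := by linarith
    rw [e1] at hl ⊢
    rw [e2]
    linarith

end MassFlow

/-! ### Clusters: countability, averaging, and the defect between free and actual momentum. -/

namespace MassFlow

variable {D : MassFlow}

theorem ae_eq_Ioc_of_subset {A : Set ℝ} {a b : ℝ} (h1 : Ioo a b ⊆ A) (h2 : A ⊆ Icc a b) :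
    A =ᵐ[volume] Ioc a b := by
  have e1 : A ≤ᵐ[volume] Ioc a b := h2.eventuallyLE.trans Ioc_ae_eq_Icc.symm.le
  have e2 : Ioc a b ≤ᵐ[volume] A := Ioo_ae_eq_Ioc.symm.le.trans h1.eventuallyLE
  exact e1.antisymm e2

theorem le_pos_of_lower_lt {t m x : ℝ} (hm : m ∈ Ioo 0 D.L) (h : D.lower x t < m) :
    x ≤ D.pos t m := by
  by_contra! hlt
  exact absurd (le_lower_of_pos_lt hm hlt) (not_le.2 h)

theorem pos_eq_of_mem_Ioo {t m x : ℝ} (h : m ∈ Ioo (D.lower x t) (D.upper x t)) :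
    m ∈ Ioo 0 D.L ∧ D.pos t m = x := by
  have hm : m ∈ Ioo 0 D.L :=
    ⟨(D.lower_nonneg x t).trans_lt h.1, h.2.trans_le (D.upper_le x t)⟩
  exact ⟨hm, le_antisymm ((pos_le_iff hm x).2 h.2.le) (le_pos_of_lower_lt hm h.1)⟩

variable (D) in
theorem fiber_ae_eq (x t : ℝ) : (Ioo 0 D.L ∩ D.pos t ⁻¹' {x} : Set ℝ) =ᵐ[volume]
    Ioc (D.lower x t) (D.upper x t) := by
  refine ae_eq_Ioc_of_subset (fun m hm => pos_eq_of_mem_Ioo hm) ?_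
  rintro m ⟨hm, rfl⟩
  exact ⟨lower_pos_le hm, le_upper_pos hm⟩

variable (D) in
theorem preimage_Iic_ae_eq (x t : ℝ) : (Ioo 0 D.L ∩ D.pos t ⁻¹' Iic x : Set ℝ) =ᵐ[volume]
    Ioc 0 (D.upper x t) := by
  refine ae_eq_Ioc_of_subset (fun m hm => ?_) ?_
  · have hmI : m ∈ Ioo 0 D.L := ⟨hm.1, hm.2.trans_le (D.upper_le x t)⟩
    exact ⟨hmI, (pos_le_iff hmI x).2 hm.2.le⟩
  · rintro m ⟨hm, hx⟩
    exact ⟨hm.1.le, (pos_le_iff hm x).1 hx⟩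

variable (D) in
theorem preimage_Iio_ae_eq (x t : ℝ) : (Ioo 0 D.L ∩ D.pos t ⁻¹' Iio x : Set ℝ) =ᵐ[volume]
    Ioc 0 (D.lower x t) := by
  refine ae_eq_Ioc_of_subset (fun m hm => ?_) ?_
  · have hmI : m ∈ Ioo 0 D.L :=
      ⟨hm.1, hm.2.trans_le ((D.lower_le_upper x t).trans (D.upper_le x t))⟩
    exact ⟨hmI, pos_lt_of_lt_lower hmI hm.2⟩
  · rintro m ⟨hm, hx⟩
    exact ⟨hm.1.le, le_lower_of_pos_lt hm hx⟩

theorem preimage_Ioo_ae_eq (x x' t : ℝ) : (Ioo 0 D.L ∩ D.pos t ⁻¹' Ioo x x' : Set ℝ) =ᵐ[volume]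
    Ioc (D.upper x t) (D.lower x' t) := by
  refine ae_eq_Ioc_of_subset (fun m hm => ?_) ?_
  · have hmI : m ∈ Ioo 0 D.L :=
      ⟨((D.lower_nonneg x t).trans (D.lower_le_upper x t)).trans_lt hm.1,
        hm.2.trans_le ((D.lower_le_upper x' t).trans (D.upper_le x' t))⟩
    refine ⟨hmI, ?_, pos_lt_of_lt_lower hmI hm.2⟩
    by_contra! h
    exact absurd ((pos_le_iff hmI x).1 h) (not_le.2 hm.1)
  · rintro m ⟨hm, hx⟩
    refine ⟨?_, le_lower_of_pos_lt hm hx.2⟩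
    by_contra! h
    exact absurd ((pos_le_iff hm x).2 h.le) (not_le.2 hx.1)

variable (D) in
-- Different positions have disjoint nonempty open mass intervals, and such a family is countable.
theorem countable_clusters (t : ℝ) : {x | D.lower x t < D.upper x t}.Countable := by
  have hinj : InjOn (fun x => D.lower x t) {x | D.lower x t < D.upper x t} := by
    intro x hx x' hx' h
    simp only at h
    rcases lt_trichotomy x x' with hlt | rfl | hlt
    · have := upper_le_lower (D := D) t hlt
      exact absurd (h ▸ this) (not_le.2 hx)
    · rfl
    · have := upper_le_lower (D := D) t hlt
      exact absurd (h ▸ this) (not_le.2 hx')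
  have hU : ∀ l ∈ (fun x => D.lower x t) '' {x | D.lower x t < D.upper x t},
      ∃ x, D.lower x t = l ∧ D.lower x t < D.upper x t := by
    rintro l ⟨x, hx, rfl⟩; exact ⟨x, rfl, hx⟩
  choose! g hg1 hg2 using hU
  refine (mapsTo_image _ _).countable_of_injOn hinj ?_
  refine Set.PairwiseDisjoint.countable_of_Ioo (y := fun l => D.upper (g l) t) ?_ ?_
  · intro l hl l' hl' hne
    simp only [Function.onFun]
    rw [disjoint_left]
    intro m hm hm'
    have e1 := pos_eq_of_mem_Ioo (D := D) (t := t) (x := g l) (m := m) (by rwa [hg1 l hl])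
    have e2 := pos_eq_of_mem_Ioo (D := D) (t := t) (x := g l') (m := m) (by rwa [hg1 l' hl'])
    apply hne
    rw [← hg1 l hl, ← hg1 l' hl', ← e1.2, ← e2.2]
  · intro l hl
    have := hg2 l hl
    rwa [hg1 l hl] at this

/-- A function with vanishing mean over each cluster is orthogonal to the functions of the
position. -/
theorem setIntegral_mul_eq_zero_of_clusters {t : ℝ} {d k : ℝ → ℝ} {B : Set ℝ}
    (hB : MeasurableSet B)
    (hoff : ∀ m ∈ Ioo 0 D.L, D.lower (D.pos t m) t = D.upper (D.pos t m) t → d m = 0)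
    (hon : ∀ x, D.lower x t < D.upper x t → ∫ m in D.lower x t..D.upper x t, d m = 0)
    (hint : IntegrableOn (fun m => k (D.pos t m) * d m) (Ioo 0 D.L ∩ D.pos t ⁻¹' B)) :
    ∫ m in Ioo 0 D.L ∩ D.pos t ⁻¹' B, k (D.pos t m) * d m = 0 := by
  set Z : Set ℝ := B ∩ {x | D.lower x t < D.upper x t} with hZ
  have hZc : Z.Countable := (D.countable_clusters t).mono inter_subset_right
  have : Countable Z := hZc.to_subtype
  have hsub : Ioo 0 D.L ∩ D.pos t ⁻¹' Z ⊆ Ioo 0 D.L ∩ D.pos t ⁻¹' B :=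
    inter_subset_inter_right _ (preimage_mono inter_subset_left)
  -- Particles outside clusters contribute nothing by `hoff`. The rest is a countable union of
  -- fibres, on each of which k is constant.
  rw [setIntegral_eq_of_subset_of_forall_sdiff_eq_zero
    (measurableSet_Ioo.inter (measurable_pos_right t hB)) hsub]
  · have hU : Ioo 0 D.L ∩ D.pos t ⁻¹' Z = ⋃ x : Z, (Ioo 0 D.L ∩ D.pos t ⁻¹' {(x : ℝ)}) := by
      ext m; simp
    rw [hU, integral_iUnion]
    · refine (tsum_congr fun x => ?_).trans tsum_zero
      have h1 : ∫ m in Ioo 0 D.L ∩ D.pos t ⁻¹' {(x : ℝ)}, k (D.pos t m) * d m =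
          ∫ m in Ioo 0 D.L ∩ D.pos t ⁻¹' {(x : ℝ)}, k x * d m := by
        refine setIntegral_congr_fun
          (measurableSet_Ioo.inter (measurable_pos_right t (measurableSet_singleton _))) ?_
        rintro m ⟨-, hm⟩
        simp only [mem_preimage, mem_singleton_iff] at hm
        simp only [hm]
      rw [h1, integral_const_mul, setIntegral_congr_set (D.fiber_ae_eq x t),
        ← intervalIntegral.integral_of_le (D.lower_le_upper x t), hon x x.2.2, mul_zero]
    · exact fun x => measurableSet_Ioo.inter (measurable_pos_right t (measurableSet_singleton _))
    · intro x y hxy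
      simp only [Function.onFun]
      rw [disjoint_left]
      rintro m ⟨-, hm⟩ ⟨-, hm'⟩
      exact hxy (Subtype.ext (hm.symm.trans hm'))
    · rw [← hU]; exact hint.mono_set hsub
  · rintro m ⟨⟨hm, hmB⟩, hmZ⟩
    have : D.lower (D.pos t m) t = D.upper (D.pos t m) t := by
      refine (D.lower_le_upper _ _).antisymm (not_lt.1 fun h => hmZ ⟨hm, hmB, h⟩)
    simp only [hoff m hm this, mul_zero]

theorem setLIntegral_le_of_clusters {t : ℝ} {f g : ℝ → ENNReal}
    (hoff : ∀ m ∈ Ioo 0 D.L, D.lower (D.pos t m) t = D.upper (D.pos t m) t → f m ≤ g m)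
    (hon : ∀ x, D.lower x t < D.upper x t → ∫⁻ m in Ioo 0 D.L ∩ D.pos t ⁻¹' {x}, f m ≤
      ∫⁻ m in Ioo 0 D.L ∩ D.pos t ⁻¹' {x}, g m) :
    ∫⁻ m in Ioo 0 D.L, f m ≤ ∫⁻ m in Ioo 0 D.L, g m := by
  set Z : Set ℝ := {x | D.lower x t < D.upper x t} with hZ
  have hZc : Z.Countable := D.countable_clusters t
  have hZm : MeasurableSet (D.pos t ⁻¹' Z) := measurable_pos_right t hZc.measurableSet
  have : Countable Z := hZc.to_subtype
  have hU : Ioo 0 D.L ∩ D.pos t ⁻¹' Z = ⋃ x : Z, (Ioo 0 D.L ∩ D.pos t ⁻¹' {(x : ℝ)}) := by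
    ext m; simp
  have hms : ∀ x : Z, MeasurableSet (Ioo 0 D.L ∩ D.pos t ⁻¹' {(x : ℝ)}) :=
    fun x => measurableSet_Ioo.inter (measurable_pos_right t (measurableSet_singleton _))
  have hdis : Pairwise (Function.onFun Disjoint
      fun x : Z => Ioo 0 D.L ∩ D.pos t ⁻¹' {(x : ℝ)}) := by
    intro x y hxy
    simp only [Function.onFun]
    rw [disjoint_left]
    rintro m ⟨-, hm⟩ ⟨-, hm'⟩
    exact hxy (Subtype.ext (hm.symm.trans hm'))
  rw [← lintegral_inter_add_sdiff f (Ioo 0 D.L) hZm, ← lintegral_inter_add_sdiff g (Ioo 0 D.L) hZm]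
  refine add_le_add ?_ ?_
  · rw [hU, lintegral_iUnion hms hdis, lintegral_iUnion hms hdis]
    exact ENNReal.tsum_le_tsum fun x => hon x x.2
  · refine setLIntegral_mono' (measurableSet_Ioo.diff hZm) ?_
    rintro m ⟨hm, hmZ⟩
    exact hoff m hm ((D.lower_le_upper _ _).antisymm (not_lt.1 hmZ))

theorem vel_eq_freeVel {t m : ℝ} (hm : m ∈ Ioo 0 D.L)
    (h : D.lower (D.pos t m) t = D.upper (D.pos t m) t) : D.vel t m = D.freeVel t m := by
  have h1 := lower_pos_le (t := t) hm
  have h2 := le_upper_pos (t := t) hm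
  have h3 : D.lower (D.pos t m) t = m := by linarith
  rw [vel, velocity, if_neg (by rw [h]; exact lt_irrefl _), h3]

theorem freeMom_sub (t a b : ℝ) : D.freeMom t b - D.freeMom t a = ∫ m in a..b, D.freeVel t m :=
  intervalIntegral.integral_interval_sub_left (D.intervalIntegrable_freeVel t _ _)
    (D.intervalIntegrable_freeVel t _ _)

theorem velocity_mul {x t : ℝ} (h : D.lower x t < D.upper x t) :
    D.velocity x t * (D.upper x t - D.lower x t) =
      ∫ m in D.lower x t..D.upper x t, D.freeVel t m := by
  rw [velocity, if_pos h, div_mul_cancel₀ _ (sub_pos.2 h).ne', freeMom_sub]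

/-- Averaging over clusters is a contraction in L¹. This is the only a priori bound on the velocity,
and needs no more than integrable initial momentum. -/
theorem setLIntegral_vel_le (t : ℝ) :
    ∫⁻ m in Ioo 0 D.L, ‖D.vel t m‖ₑ ≤ ∫⁻ m in Ioo 0 D.L, ‖D.freeVel t m‖ₑ := by
  refine setLIntegral_le_of_clusters (t := t) (fun m hm h => by rw [vel_eq_freeVel hm h])
    fun x hx => ?_
  have h1 : ∫⁻ m in Ioo 0 D.L ∩ D.pos t ⁻¹' {x}, ‖D.vel t m‖ₑ =
      ∫⁻ m in Ioo 0 D.L ∩ D.pos t ⁻¹' {x}, ‖D.velocity x t‖ₑ := by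
    refine setLIntegral_congr_fun
      (measurableSet_Ioo.inter (measurable_pos_right t (measurableSet_singleton _))) ?_
    rintro m ⟨-, hm⟩
    simp only [mem_preimage, mem_singleton_iff] at hm
    simp only [vel, hm]
  rw [h1, Measure.restrict_congr_set (D.fiber_ae_eq x t), lintegral_const,
    Measure.restrict_apply_univ, Real.volume_Ioc,
    ← Real.enorm_of_nonneg (sub_nonneg.2 hx.le), ← enorm_mul, velocity_mul hx,
    intervalIntegral.integral_of_le hx.le]
  exact enorm_integral_le_lintegral_enorm _

variable (D) in
/-- A bound for the total absolute momentum on the time interval `[-T, T]`. -/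
def momBound (T : ℝ) : ENNReal :=
  (∫⁻ m, ‖D.v m‖ₑ) + ENNReal.ofReal (|D.κ| * T * D.L) * ENNReal.ofReal D.L

theorem momBound_lt_top (T : ℝ) : D.momBound T < ⊤ :=
  ENNReal.add_lt_top.2 ⟨D.integrable_v.2, ENNReal.mul_lt_top ENNReal.ofReal_lt_top
    ENNReal.ofReal_lt_top⟩

theorem setLIntegral_freeVel_le {t T : ℝ} (ht : |t| ≤ T) :
    ∫⁻ m in Ioo 0 D.L, ‖D.freeVel t m‖ₑ ≤ D.momBound T := by
  have h1 : ∀ m, ‖D.freeVel t m‖ₑ ≤ ‖D.v m‖ₑ + ENNReal.ofReal (|D.κ| * T * D.L) := by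
    intro m
    refine (enorm_add_le _ _).trans (add_le_add le_rfl ?_)
    rw [← ofReal_norm, Real.norm_eq_abs, abs_mul, abs_mul, abs_of_nonneg (D.e_nonneg m)]
    gcongr
    · exact D.e_nonneg m
    · exact mul_nonneg (abs_nonneg _) ((abs_nonneg t).trans ht)
    · exact D.e_le m
  calc _ ≤ ∫⁻ m in Ioo 0 D.L, (‖D.v m‖ₑ + ENNReal.ofReal (|D.κ| * T * D.L)) :=
        lintegral_mono h1
    _ = (∫⁻ m in Ioo 0 D.L, ‖D.v m‖ₑ) + ENNReal.ofReal (|D.κ| * T * D.L) * ENNReal.ofReal D.L := by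
        rw [lintegral_add_right _ measurable_const, lintegral_const, Measure.restrict_apply_univ,
          Real.volume_Ioo, sub_zero]
    _ ≤ _ := add_le_add (setLIntegral_le_lintegral _ _) le_rfl

theorem integrableOn_freeVel (t : ℝ) : IntegrableOn (D.freeVel t) (Ioo 0 D.L) :=
  ⟨(D.measurable_freeVel.comp measurable_prodMk_left).aestronglyMeasurable,
    (setLIntegral_freeVel_le le_rfl).trans_lt (momBound_lt_top _)⟩

theorem integrableOn_vel (t : ℝ) : IntegrableOn (D.vel t) (Ioo 0 D.L) :=
  ⟨(measurable_vel_right t).aestronglyMeasurable,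
    (setLIntegral_vel_le t).trans_lt
      ((setLIntegral_freeVel_le le_rfl).trans_lt (momBound_lt_top _))⟩

variable (D) in
theorem integrable_vel_prod (T : ℝ) : Integrable (fun p : ℝ × ℝ => D.vel p.1 p.2)
    ((volume.restrict (Ioc 0 T)).prod (volume.restrict (Ioo 0 D.L))) := by
  refine ⟨D.measurable_vel.aestronglyMeasurable, ?_⟩
  rw [HasFiniteIntegral, lintegral_prod _ D.measurable_vel.enorm.aemeasurable]
  calc _ ≤ ∫⁻ _ in Ioc 0 T, D.momBound T := by
        refine setLIntegral_mono' measurableSet_Ioc fun t ht => (setLIntegral_vel_le t).trans ?_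
        exact setLIntegral_freeVel_le (by rw [abs_of_pos ht.1]; exact ht.2)
    _ < ⊤ := by
        rw [lintegral_const, Measure.restrict_apply_univ, Real.volume_Ioc]
        exact ENNReal.mul_lt_top (momBound_lt_top T) ENNReal.ofReal_lt_top

theorem intervalIntegrable_of_Ioo {f : ℝ → ℝ} {L : ℝ} (hf : IntegrableOn f (Ioo 0 L)) {a b : ℝ}
    (ha : a ∈ Icc 0 L) (hb : b ∈ Icc 0 L) : IntervalIntegrable f volume a b := by
  have h : IntegrableOn f (Icc 0 L) := (integrableOn_Icc_iff_integrableOn_Ioo).2 hf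
  rw [intervalIntegrable_iff]
  exact h.mono_set (uIoc_subset_uIcc.trans (uIcc_subset_Icc ha hb))

variable (D) in
/-- The primitive of the velocity in the mass coordinate. -/
def mom (t m : ℝ) : ℝ := ∫ s in 0..m, D.vel t s

variable (D) in
/-- The difference of the primitives of the free and the actual velocity. -/
def defect (t m : ℝ) : ℝ := D.freeMom t m - D.mom t m

theorem intervalIntegrable_vel (t : ℝ) {a b : ℝ} (ha : a ∈ Icc 0 D.L) (hb : b ∈ Icc 0 D.L) :
    IntervalIntegrable (D.vel t) volume a b :=
  intervalIntegrable_of_Ioo (integrableOn_vel t) ha hb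

theorem mom_sub {t a b : ℝ} (ha : a ∈ Icc 0 D.L) (hb : b ∈ Icc 0 D.L) :
    D.mom t b - D.mom t a = ∫ m in a..b, D.vel t m :=
  intervalIntegral.integral_interval_sub_left
    (intervalIntegrable_vel t (left_mem_Icc.2 D.L_pos.le) hb)
    (intervalIntegrable_vel t (left_mem_Icc.2 D.L_pos.le) ha)

theorem defect_sub {t a b : ℝ} (ha : a ∈ Icc 0 D.L) (hb : b ∈ Icc 0 D.L) :
    D.defect t b - D.defect t a = ∫ m in a..b, (D.freeVel t m - D.vel t m) := by
  rw [intervalIntegral.integral_sub (D.intervalIntegrable_freeVel t _ _)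
    (intervalIntegrable_vel t ha hb), ← freeMom_sub, ← mom_sub ha hb]
  unfold defect; ring

theorem lower_mem_Icc (x t : ℝ) : D.lower x t ∈ Icc 0 D.L := (D.lower_mem x t).1

theorem upper_mem_Icc (x t : ℝ) : D.upper x t ∈ Icc 0 D.L := (D.upper_mem x t).1

theorem integral_vel_of_subset {t x a b : ℝ} (hab : a ≤ b) (ha : D.lower x t ≤ a)
    (hb : b ≤ D.upper x t) (f : ℝ → ℝ → ℝ) :
    ∫ m in a..b, f (D.pos t m) m = ∫ m in a..b, f x m := by
  rw [intervalIntegral.integral_of_le hab, intervalIntegral.integral_of_le hab,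
    integral_Ioc_eq_integral_Ioo, integral_Ioc_eq_integral_Ioo]
  refine setIntegral_congr_fun measurableSet_Ioo fun m hm => ?_
  simp only [(pos_eq_of_mem_Ioo (D := D) (t := t) (x := x) (m := m)
    ⟨ha.trans_lt hm.1, hm.2.trans_le hb⟩).2]

theorem integral_cluster_eq_zero {x t : ℝ} (hx : D.lower x t < D.upper x t) :
    ∫ m in D.lower x t..D.upper x t, (D.freeVel t m - D.vel t m) = 0 := by
  rw [intervalIntegral.integral_sub (D.intervalIntegrable_freeVel t _ _)
    (intervalIntegrable_vel t (lower_mem_Icc x t) (upper_mem_Icc x t)), ← velocity_mul hx]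
  have := integral_vel_of_subset (D := D) (t := t) (x := x) hx.le le_rfl le_rfl
    (fun x _ => D.velocity x t)
  change _ - ∫ m in D.lower x t..D.upper x t, D.velocity (D.pos t m) t = 0
  rw [this, intervalIntegral.integral_const, smul_eq_mul]
  ring

/-- In probabilistic terms `vel` is the conditional expectation of `freeVel` given the position;
this is the orthogonality it satisfies. -/
theorem setIntegral_mul_sub_eq_zero {t : ℝ} {k : ℝ → ℝ} {B : Set ℝ} (hB : MeasurableSet B)
    (hint : IntegrableOn (fun m => k (D.pos t m) * (D.freeVel t m - D.vel t m))
      (Ioo 0 D.L ∩ D.pos t ⁻¹' B)) :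
    ∫ m in Ioo 0 D.L ∩ D.pos t ⁻¹' B, k (D.pos t m) * (D.freeVel t m - D.vel t m) = 0 :=
  setIntegral_mul_eq_zero_of_clusters hB
    (fun m hm h => by rw [vel_eq_freeVel hm h, sub_self]) (fun x hx => integral_cluster_eq_zero hx)
    hint

theorem integrableOn_sub (t : ℝ) :
    IntegrableOn (fun m => D.freeVel t m - D.vel t m) (Ioo 0 D.L) :=
  (integrableOn_freeVel t).sub (integrableOn_vel t)

theorem defect_zero (t : ℝ) : D.defect t 0 = 0 := by simp [defect, freeMom, mom]

/-- The particles at or to the left of x form whole clusters, over which free and actual momentum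
agree. -/
theorem defect_upper (x t : ℝ) : D.defect t (D.upper x t) = 0 := by
  have h := setIntegral_mul_sub_eq_zero (D := D) (t := t) (k := fun _ => 1)
    (measurableSet_Iic (a := x)) (by
      simp only [one_mul]; exact (integrableOn_sub t).mono_set inter_subset_left)
  rw [setIntegral_congr_set (D.preimage_Iic_ae_eq x t),
    ← intervalIntegral.integral_of_le (upper_mem_Icc x t).1] at h
  simp only [one_mul] at h
  rw [← defect_sub (left_mem_Icc.2 D.L_pos.le) (upper_mem_Icc x t), defect_zero, sub_zero] at h
  exact h

theorem defect_lower (x t : ℝ) : D.defect t (D.lower x t) = 0 := by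
  have h := setIntegral_mul_sub_eq_zero (D := D) (t := t) (k := fun _ => 1)
    (measurableSet_Iio (a := x)) (by
      simp only [one_mul]; exact (integrableOn_sub t).mono_set inter_subset_left)
  rw [setIntegral_congr_set (D.preimage_Iio_ae_eq x t),
    ← intervalIntegral.integral_of_le (lower_mem_Icc x t).1] at h
  simp only [one_mul] at h
  rw [← defect_sub (left_mem_Icc.2 D.L_pos.le) (lower_mem_Icc x t), defect_zero, sub_zero] at h
  exact h

/-- Not a case of `defect_upper`, since the mass L need not be reached at any finite x. -/
theorem defect_L (t : ℝ) : D.defect t D.L = 0 := by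
  have h := setIntegral_mul_sub_eq_zero (D := D) (t := t) (k := fun _ => 1)
    MeasurableSet.univ (by
      simp only [one_mul]; exact (integrableOn_sub t).mono_set inter_subset_left)
  simp only [one_mul, preimage_univ, inter_univ] at h
  rw [← integral_Ioc_eq_integral_Ioo, ← intervalIntegral.integral_of_le D.L_pos.le,
    ← defect_sub (left_mem_Icc.2 D.L_pos.le) (right_mem_Icc.2 D.L_pos.le), defect_zero,
    sub_zero] at h
  exact h

theorem mem_Icc_of_mem_Ioo {m : ℝ} (hm : m ∈ Ioo 0 D.L) : m ∈ Icc 0 D.L := Ioo_subset_Icc_self hm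

/-- Up to the start of the cluster the defect vanishes, and inside it `vel` is constant. The right
side is the coefficient of t' − t in `support_pos`. -/
theorem mom_eq {t m : ℝ} (hm : m ∈ Ioo 0 D.L) :
    D.mom t m = D.freeMom t (D.lower (D.pos t m) t)
      + (m - D.lower (D.pos t m) t) * D.vel t m := by
  have h1 := defect_lower (D := D) (D.pos t m) t
  have h2 := mom_sub (D := D) (t := t) (lower_mem_Icc (D.pos t m) t) (mem_Icc_of_mem_Ioo hm)
  have h3 := integral_vel_of_subset (D := D) (t := t) (lower_pos_le hm) le_rfl (le_upper_pos hm)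
    (fun x _ => D.velocity x t)
  change ∫ s in _..m, D.vel t s = _ at h3
  rw [intervalIntegral.integral_const, smul_eq_mul] at h3
  unfold defect at h1
  unfold vel
  linarith

/-- Whole clusters between m₁ and m₂ cancel. Only the clusters cut by m₁ or by m₂ remain; there k is
constant, and the defect vanishes at the other end of the piece. -/
theorem integral_mul_sub_eq_defect {t m₁ m₂ : ℝ} {k : ℝ → ℝ} (h1 : m₁ ∈ Ioo 0 D.L)
    (h2 : m₂ ∈ Ioo 0 D.L) (h12 : m₁ ≤ m₂)
    (hint : IntervalIntegrable (fun m => k (D.pos t m) * (D.freeVel t m - D.vel t m))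
      volume m₁ m₂) :
    ∫ m in m₁..m₂, k (D.pos t m) * (D.freeVel t m - D.vel t m) =
      k (D.pos t m₂) * D.defect t m₂ - k (D.pos t m₁) * D.defect t m₁ := by
  have hpiece : ∀ {x a b : ℝ}, a ≤ b → D.lower x t ≤ a → b ≤ D.upper x t →
      ∫ m in a..b, k (D.pos t m) * (D.freeVel t m - D.vel t m) =
        k x * (D.defect t b - D.defect t a) := by
    intro x a b hab ha hb
    have haI : a ∈ Icc 0 D.L := ⟨(D.lower_nonneg x t).trans ha, hab.trans (hb.trans (D.upper_le x t))⟩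
    have hbI : b ∈ Icc 0 D.L := ⟨haI.1.trans hab, hb.trans (D.upper_le x t)⟩
    rw [integral_vel_of_subset hab ha hb (fun x m => k x * (D.freeVel t m - D.vel t m)),
      intervalIntegral.integral_const_mul, ← defect_sub haI hbI]
  rcases (pos_mono (t := t) h1 h2 h12).eq_or_lt with heq | hlt
  · rw [hpiece h12 (lower_pos_le h1) (heq ▸ le_upper_pos h2), ← heq]
    ring
  · have e1 := le_upper_pos (t := t) h1
    have e2 := upper_le_lower (D := D) t hlt
    have e3 := lower_pos_le (t := t) h2
    have hsub : ∀ {a b}, m₁ ≤ a → a ≤ b → b ≤ m₂ → IntervalIntegrable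
        (fun m => k (D.pos t m) * (D.freeVel t m - D.vel t m)) volume a b := by
      intro a b ha hab hb
      refine hint.mono_set ?_
      rw [uIcc_of_le hab, uIcc_of_le h12]
      exact Icc_subset_Icc ha hb
    rw [← intervalIntegral.integral_add_adjacent_intervals (hsub le_rfl e1 (e2.trans e3))
      (hsub e1 (e2.trans e3) le_rfl),
      ← intervalIntegral.integral_add_adjacent_intervals (hsub e1 e2 e3)
      (hsub (e1.trans e2) e3 le_rfl), hpiece e1 (lower_pos_le h1) le_rfl,
      hpiece e3 le_rfl (le_upper_pos h2), defect_lower, defect_upper]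
    have hmid : ∫ m in D.upper (D.pos t m₁) t..D.lower (D.pos t m₂) t,
        k (D.pos t m) * (D.freeVel t m - D.vel t m) = 0 := by
      rw [intervalIntegral.integral_of_le e2, ← setIntegral_congr_set (preimage_Ioo_ae_eq _ _ t)]
      refine setIntegral_mul_sub_eq_zero measurableSet_Ioo ?_
      rw [integrableOn_congr_set_ae (preimage_Ioo_ae_eq _ _ t)]
      exact (intervalIntegrable_iff_integrableOn_Ioc_of_le e2).1 (hsub e1 e2 e3)
    rw [hmid]
    ring

end MassFlow

/-- Lebesgue differentiation on an exhaustion of (0, L) by compact intervals, as f need not be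
integrable up to the ends. -/
theorem ae_eq_zero_of_forall_integral_eq_zero {f : ℝ → ℝ} {L : ℝ}
    (hf : ∀ a ∈ Ioo 0 L, ∀ b ∈ Ioo 0 L, a ≤ b →
      IntervalIntegrable f volume a b ∧ ∫ m in a..b, f m = 0) :
    ∀ᵐ m ∂(volume.restrict (Ioo 0 L)), f m = 0 := by
  rcases le_or_gt L 0 with hL | hL
  · simp [Ioo_eq_empty_of_le hL]
  have key : ∀ n : ℕ, ∀ᵐ m : ℝ, m ∈ Ioo (L / (n + 3)) (L - L / (n + 3)) → f m = 0 := by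
    intro n
    have hpos : 0 < L / ((n : ℝ) + 3) := by positivity
    have hlt : L / ((n : ℝ) + 3) ≤ L / 3 := by gcongr; linarith [(Nat.cast_nonneg n : (0 : ℝ) ≤ n)]
    set a := L / ((n : ℝ) + 3)
    have haI : a ∈ Ioo 0 L := ⟨hpos, by linarith⟩
    have hbI : L - a ∈ Ioo 0 L := ⟨by linarith, by linarith⟩
    have hab : a ≤ L - a := by linarith
    filter_upwards [(hf a haI _ hbI hab).1.ae_hasDerivAt_integral] with m hm hmI
    have hd := hm (by rw [uIcc_of_le hab]; exact Ioo_subset_Icc_self hmI) a left_mem_uIcc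
    have h0 : HasDerivAt (fun x => ∫ t in a..x, f t) 0 m := by
      refine (hasDerivAt_const m (0 : ℝ)).congr_of_eventuallyEq ?_
      filter_upwards [Ioo_mem_nhds hmI.1 hmI.2] with x hx
      exact (hf a haI x ⟨haI.1.trans hx.1, hx.2.trans hbI.2⟩ hx.1.le).2
    exact hd.unique h0
  rw [ae_restrict_iff' measurableSet_Ioo]
  filter_upwards [ae_all_iff.2 key] with m hm hmI
  obtain ⟨n, hn⟩ := exists_nat_gt (L / min m (L - m))
  have hmin : 0 < min m (L - m) := lt_min hmI.1 (sub_pos.2 hmI.2)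
  have h2 : L / ((n : ℝ) + 3) < min m (L - m) := by
    rw [div_lt_iff₀ (by positivity)]
    rw [div_lt_iff₀ hmin] at hn
    nlinarith
  exact hm n ⟨h2.trans_le (min_le_left _ _), by linarith [h2.trans_le (min_le_right _ _)]⟩

/-! ### The Legendre transform of the potential and the trajectories of the particles. -/

namespace MassFlow

variable {D : MassFlow}

variable (D) in
/-- The partial Legendre transform of the potential. -/
def theta (t m : ℝ) : ℝ := D.pos t m * m - D.ψ (D.pos t m) t

/-- This is `support_pos` at t' = t: the supremum in the Legendre transform of ψ(·, t) is attained
at the position of m. -/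
theorem sub_le_theta {m : ℝ} (hm : m ∈ Ioo 0 D.L) (t x : ℝ) :
    x * m - D.ψ x t ≤ D.theta t m := by
  have := support_pos (t := t) hm x t
  unfold theta
  simp only [sub_self, zero_mul, ne_eq, OfNat.ofNat_ne_zero, not_false_eq_true, zero_pow, mul_zero,
    add_zero, sub_zero] at this
  linarith

variable (D) in
/-- The interpolation at `m` of the function `m²` between the ends of the cluster. -/
def sqInterp (t m : ℝ) : ℝ :=
  m ^ 2 + (m - D.lower (D.pos t m) t) * (D.upper (D.pos t m) t - m)

/-- The supporting function of the particle at time t is evaluated at the position of the same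
particle at time t'. -/
theorem theta_sub_le {m : ℝ} (hm : m ∈ Ioo 0 D.L) (t t' : ℝ) :
    D.theta t' m - D.theta t m ≤
      D.mom t m * (t' - t) + D.κ / 4 * (t' - t) ^ 2 * D.sqInterp t m := by
  have := support_pos (t := t) hm (D.pos t' m) t'
  rw [← mom_eq hm] at this
  unfold theta sqInterp
  linarith

/-- Both quantities agree at the two ends of the cluster, and both increase between them with slope
in [0, L]. So the difference is at most L(m − l) ≤ Lm, and from the other end at most L(u − m) ≤ L(L
− m). -/
theorem abs_sqInterp_sub_le {m : ℝ} (hm : m ∈ Ioo 0 D.L) (t : ℝ) :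
    |D.sqInterp t m / 2 - ∫ s in 0..m, D.e s| ≤ D.L * min m (D.L - m) := by
  have hl0 := D.lower_nonneg (D.pos t m) t
  have hlm := lower_pos_le (t := t) hm
  have hmu := le_upper_pos (t := t) hm
  have huL := D.upper_le (D.pos t m) t
  have hle := (D.lower_mem (D.pos t m) t).2.1
  have hue := (D.upper_mem (D.pos t m) t).2.1
  have hint : ∀ a b, a ≤ b → 0 ≤ ∫ s in a..b, D.e s ∧ ∫ s in a..b, D.e s ≤ D.L * (b - a) := by
    intro a b hab
    refine ⟨intervalIntegral.integral_nonneg hab fun s _ => D.e_nonneg s, ?_⟩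
    have := intervalIntegral.integral_mono_on hab (D.intervalIntegrable_e a b)
      (intervalIntegrable_const (c := D.L)) (fun s _ => D.e_le s)
    rw [intervalIntegral.integral_const, smul_eq_mul] at this
    linarith
  have e1 := intervalIntegral.integral_add_adjacent_intervals
    (D.intervalIntegrable_e 0 (D.lower (D.pos t m) t)) (D.intervalIntegrable_e _ m)
  have e2 := intervalIntegral.integral_add_adjacent_intervals
    (D.intervalIntegrable_e 0 m) (D.intervalIntegrable_e _ (D.upper (D.pos t m) t))
  have i1 := hint _ _ hlm
  have i2 := hint _ _ hmu
  unfold sqInterp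
  set l := D.lower (D.pos t m) t
  set u := D.upper (D.pos t m) t
  have hL := D.L_pos
  have j1 : 0 ≤ (m - l) * (l + u) ∧ (m - l) * (l + u) ≤ (m - l) * (2 * D.L) :=
    ⟨mul_nonneg (by linarith) (by linarith),
      mul_le_mul_of_nonneg_left (by linarith) (by linarith)⟩
  have j2 : 0 ≤ (u - m) * (l + u) ∧ (u - m) * (l + u) ≤ (u - m) * (2 * D.L) :=
    ⟨mul_nonneg (by linarith) (by linarith),
      mul_le_mul_of_nonneg_left (by linarith) (by linarith)⟩
  have k1 : D.L * (m - l) ≤ D.L * m := by gcongr; linarith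
  have k2 : D.L * (u - m) ≤ D.L * (D.L - m) := by gcongr
  rw [mul_min_of_nonneg _ _ hL.le]
  refine le_min ?_ ?_ <;> rw [abs_le] <;> constructor <;> nlinarith

theorem theta_sub_le' {m : ℝ} (hm : m ∈ Ioo 0 D.L) (t t' : ℝ) :
    D.theta t' m - D.theta t m ≤ D.mom t m * (t' - t) + |D.κ| * D.L ^ 2 * (t' - t) ^ 2 := by
  refine (theta_sub_le hm t t').trans (add_le_add le_rfl ?_)
  have hL := D.L_pos
  have h1 : 0 ≤ D.sqInterp t m := by
    have := mul_nonneg (sub_nonneg.2 (lower_pos_le (t := t) hm))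
      (sub_nonneg.2 (le_upper_pos (t := t) hm))
    unfold sqInterp; positivity
  have h2 : D.sqInterp t m ≤ 2 * D.L ^ 2 := by
    have h3 : m - D.lower (D.pos t m) t ≤ D.L := by linarith [D.lower_nonneg (D.pos t m) t, hm.2]
    have h4 : D.upper (D.pos t m) t - m ≤ D.L := by linarith [D.upper_le (D.pos t m) t, hm.1]
    have h5 := mul_le_mul h3 h4 (sub_nonneg.2 (le_upper_pos (t := t) hm)) hL.le
    have h6 : m ^ 2 ≤ D.L ^ 2 := by gcongr; exacts [hm.1.le, hm.2.le]
    unfold sqInterp; nlinarith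
  calc D.κ / 4 * (t' - t) ^ 2 * D.sqInterp t m
      ≤ |D.κ| / 4 * (t' - t) ^ 2 * (2 * D.L ^ 2) := by gcongr; exact le_abs_self _
    _ ≤ _ := by
      have : 0 ≤ |D.κ| * D.L ^ 2 * (t' - t) ^ 2 := by positivity
      linarith

/-- The position is a subgradient of the convex function θ(t, ·), which is therefore its primitive
in m (`integral_pos`). -/
theorem theta_sub_ge {m m' : ℝ} (hm' : m' ∈ Ioo 0 D.L) (t : ℝ) :
    D.pos t m * (m' - m) ≤ D.theta t m' - D.theta t m := by
  have := sub_le_theta hm' t (D.pos t m)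
  unfold theta at *
  linarith

theorem intervalIntegrable_mom {m : ℝ} (hm : m ∈ Ioo 0 D.L) {a b : ℝ} (hab : a ≤ b) :
    IntervalIntegrable (fun t => D.mom t m) volume a b :=
  intervalIntegrable_of_quadratic_supergradient (f := fun t => D.theta t m) hab
    fun t _ t' _ => theta_sub_le' hm t t'

theorem integral_mom {m : ℝ} (hm : m ∈ Ioo 0 D.L) {a b : ℝ} (hab : a ≤ b) :
    ∫ t in a..b, D.mom t m = D.theta b m - D.theta a m :=
  integral_eq_sub_of_quadratic_supergradient (f := fun t => D.theta t m) hab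
    fun t _ t' _ => theta_sub_le' hm t t'

theorem theta_neg_sub_le {a b : ℝ} (ha : a ∈ Ioo 0 D.L) (hb : b ∈ Ioo 0 D.L) (t : ℝ) :
    ∀ m ∈ Icc a b, ∀ m' ∈ Icc a b, -D.theta t m' - -D.theta t m ≤
      -D.pos t m * (m' - m) + 0 * (m' - m) ^ 2 := by
  intro m _ m' hm'
  have := theta_sub_ge (D := D) (m := m) (m' := m')
    ⟨ha.1.trans_le hm'.1, hm'.2.trans_lt hb.2⟩ t
  linarith

theorem intervalIntegrable_pos {a b : ℝ} (ha : a ∈ Ioo 0 D.L) (hb : b ∈ Ioo 0 D.L)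
    (hab : a ≤ b) (t : ℝ) : IntervalIntegrable (D.pos t) volume a b := by
  have := (intervalIntegrable_of_quadratic_supergradient hab (theta_neg_sub_le ha hb t)).neg
  have h : (-fun m => -D.pos t m) = D.pos t := by ext; simp
  rwa [h] at this

theorem integral_pos {a b : ℝ} (ha : a ∈ Ioo 0 D.L) (hb : b ∈ Ioo 0 D.L)
    (hab : a ≤ b) (t : ℝ) : ∫ m in a..b, D.pos t m = D.theta t b - D.theta t a := by
  have := integral_eq_sub_of_quadratic_supergradient hab (theta_neg_sub_le ha hb t)
  rw [intervalIntegral.integral_neg] at this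
  linarith

theorem integrable_vel_prod_Ioc {a b : ℝ} (ha : a ∈ Icc 0 D.L) (hb : b ∈ Icc 0 D.L) (T : ℝ) :
    Integrable (fun p : ℝ × ℝ => D.vel p.1 p.2)
      ((volume.restrict (Ioc 0 T)).prod (volume.restrict (Ioc a b))) := by
  have h := D.integrable_vel_prod T
  rw [Measure.restrict_congr_set Ioo_ae_eq_Ioc] at h
  rw [Measure.prod_restrict] at h ⊢
  exact h.mono_measure (Measure.restrict_mono
    (prod_mono le_rfl (Ioc_subset_Ioc ha.1 hb.2)) le_rfl)

variable (D) in
/-- The trajectory with velocity `vel`, starting at the initial position. -/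
def path (t m : ℝ) : ℝ := D.pos 0 m + ∫ s in 0..t, D.vel s m

/-- The particles follow the velocity field. -/
theorem ae_pos_eq_path {T : ℝ} (hT : 0 ≤ T) :
    ∀ᵐ m ∂(volume.restrict (Ioo 0 D.L)), D.pos T m = D.path T m := by
  have h0 : ∀ᵐ m ∂(volume.restrict (Ioo 0 D.L)),
      D.pos T m - D.pos 0 m - (∫ s in 0..T, D.vel s m) = 0 := by
    refine ae_eq_zero_of_forall_integral_eq_zero fun a ha b hb hab => ?_
    have haI := mem_Icc_of_mem_Ioo ha
    have hbI := mem_Icc_of_mem_Ioo hb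
    have hprod := integrable_vel_prod_Ioc haI hbI T
    have hI : IntervalIntegrable (fun m => ∫ s in 0..T, D.vel s m) volume a b := by
      rw [intervalIntegrable_iff_integrableOn_Ioc_of_le hab]
      simp only [intervalIntegral.integral_of_le hT]
      exact hprod.integral_prod_right
    have hp := intervalIntegrable_pos ha hb hab
    refine ⟨((hp T).sub (hp 0)).sub hI, ?_⟩
    rw [intervalIntegral.integral_sub ((hp T).sub (hp 0)) hI,
      intervalIntegral.integral_sub (hp T) (hp 0), integral_pos ha hb hab, integral_pos ha hb hab]
    -- Integrated over [a, b], the displacement and the time integral of the velocity are the same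
    -- mixed second difference of `theta`.
    have hswap : ∫ m in a..b, ∫ s in 0..T, D.vel s m = ∫ s in 0..T, ∫ m in a..b, D.vel s m := by
      simp only [intervalIntegral.integral_of_le hT, intervalIntegral.integral_of_le hab]
      exact (integral_integral_swap (f := fun s m => D.vel s m) hprod).symm
    rw [hswap]
    simp only [← mom_sub haI hbI]
    rw [intervalIntegral.integral_sub (intervalIntegrable_mom hb hT) (intervalIntegrable_mom ha hT),
      integral_mom hb hT, integral_mom ha hT]
    ring
  filter_upwards [h0] with m hm
  unfold path
  linarith

theorem measurable_path : Measurable fun p : ℝ × ℝ => D.pos 0 p.2 + ∫ s in Ioc 0 p.1, D.vel s p.2 := by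
  have h1 : Measurable fun p : ℝ × ℝ => D.pos 0 p.2 := (measurable_pos_right 0).comp measurable_snd
  refine h1.add ?_
  have h2 : StronglyMeasurable fun q : (ℝ × ℝ) × ℝ =>
      {q : (ℝ × ℝ) × ℝ | q.2 ∈ Ioc 0 q.1.1}.indicator (fun q => D.vel q.2 q.1.2) q := by
    refine StronglyMeasurable.indicator ?_ ?_
    · have h3 : Measurable fun q : (ℝ × ℝ) × ℝ => (q.2, q.1.2) := by fun_prop
      have h4 := D.measurable_vel.comp h3
      exact h4.stronglyMeasurable
    · exact (measurableSet_lt measurable_const measurable_snd).inter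
        (measurableSet_le measurable_snd (measurable_fst.comp measurable_fst))
  have h5 := (h2.integral_prod_right' (ν := volume)).measurable
  convert h5 using 2 with p
  rw [← integral_indicator measurableSet_Ioc]
  congr 1

/-- Almost every particle follows its trajectory at almost all times. -/
theorem ae_ae_pos_eq_path (T : ℝ) : ∀ᵐ m ∂(volume.restrict (Ioo 0 D.L)),
    ∀ᵐ t ∂(volume.restrict (Ioc 0 T)), D.pos t m = D.path t m := by
  have h1 : ∀ᵐ t ∂(volume.restrict (Ioc 0 T)), ∀ᵐ m ∂(volume.restrict (Ioo 0 D.L)),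
      D.pos t m = D.pos 0 m + ∫ s in Ioc 0 t, D.vel s m := by
    filter_upwards [ae_restrict_mem measurableSet_Ioc] with t ht
    filter_upwards [ae_pos_eq_path (D := D) ht.1.le] with m hm
    rw [hm, path, intervalIntegral.integral_of_le ht.1.le]
  rw [Measure.ae_ae_comm (p := fun t m => D.pos t m = D.pos 0 m + ∫ s in Ioc 0 t, D.vel s m)
    (measurableSet_eq_fun D.measurable_pos measurable_path)] at h1
  filter_upwards [h1] with m hm
  filter_upwards [hm, ae_restrict_mem measurableSet_Ioc] with t ht htI
  rw [ht, path, intervalIntegral.integral_of_le htI.1.le]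

theorem ae_intervalIntegrable_vel {T : ℝ} (hT : 0 ≤ T) : ∀ᵐ m ∂(volume.restrict (Ioo 0 D.L)),
    IntervalIntegrable (fun t => D.vel t m) volume 0 T := by
  filter_upwards [(D.integrable_vel_prod T).prod_left_ae] with m hm
  rw [intervalIntegrable_iff_integrableOn_Ioc_of_le hT]
  exact hm

/-- Adding `theta_sub_le` for (t, t') and (t', t) bounds the growth of `mom` by that of the
interpolated force, while `freeMom` grows at the rate κ∫₀ᵐ e. By `abs_sqInterp_sub_le` the mismatch
is a drift that is small for m near 0 or L. -/
theorem monotone_defect {m : ℝ} (hm : m ∈ Ioo 0 D.L) :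
    Monotone fun t => D.defect t m + |D.κ| * (D.L * min m (D.L - m)) * t := by
  intro t t' htt'
  rcases htt'.eq_or_lt with rfl | hlt
  · exact le_rfl
  have h1 := theta_sub_le hm t t'
  have h2 := theta_sub_le hm t' t
  have hb1 := abs_sqInterp_sub_le hm t
  have hb2 := abs_sqInterp_sub_le hm t'
  have h3 : 0 ≤ (t' - t) * (D.mom t m - D.mom t' m
      + D.κ / 4 * (t' - t) * (D.sqInterp t m + D.sqInterp t' m)) := by nlinarith
  have h4 := nonneg_of_mul_nonneg_right h3 (sub_pos.2 hlt)
  simp only [defect, freeMom_eq]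
  set ε := ∫ s in 0..m, D.e s
  set C := D.L * min m (D.L - m)
  have h5 : ∀ y, |y| ≤ C → D.κ * y ≤ |D.κ| * C := by
    intro y hy
    calc D.κ * y ≤ |D.κ * y| := le_abs_self _
      _ = |D.κ| * |y| := abs_mul _ _
      _ ≤ _ := by gcongr
  have h6 := h5 _ hb1
  have h7 := h5 _ hb2
  have h8 := mul_le_mul_of_nonneg_left h6 (sub_pos.2 hlt).le
  have h9 := mul_le_mul_of_nonneg_left h7 (sub_pos.2 hlt).le
  nlinarith

theorem continuousOn_defect (t : ℝ) : ContinuousOn (D.defect t) (Icc 0 D.L) := by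
  have h1 : Continuous (D.freeMom t) :=
    intervalIntegral.continuous_primitive (D.intervalIntegrable_freeVel t) 0
  have h2 : ContinuousOn (D.mom t) (Icc 0 D.L) := by
    have := intervalIntegral.continuousOn_primitive_interval (f := D.vel t) (μ := volume)
      (a := 0) (b := D.L) (by
        rw [uIcc_of_le D.L_pos.le]
        exact (integrableOn_Icc_iff_integrableOn_Ioo).2 (integrableOn_vel t))
    rwa [uIcc_of_le D.L_pos.le] at this
  exact h1.continuousOn.sub h2

theorem tendsto_defect {m : ℕ → ℝ} {c : ℝ} (hm : ∀ n, m n ∈ Ioo 0 D.L) (hc : c = 0 ∨ c = D.L)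
    (hlim : Tendsto m atTop (𝓝 c)) (t : ℝ) :
    Tendsto (fun n => D.defect t (m n)) atTop (𝓝 0) := by
  have hcI : c ∈ Icc 0 D.L := by
    rcases hc with rfl | rfl
    exacts [left_mem_Icc.2 D.L_pos.le, right_mem_Icc.2 D.L_pos.le]
  have h0 : D.defect t c = 0 := by
    rcases hc with rfl | rfl
    exacts [defect_zero t, defect_L t]
  have := (continuousOn_defect (D := D) t c hcI).tendsto
  rw [h0] at this
  exact this.comp (tendsto_nhdsWithin_iff.2
    ⟨hlim, Eventually.of_forall fun n => mem_Icc_of_mem_Ioo (hm n)⟩)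

end MassFlow

/-! ### Test functions, the mass balance and the momentum balance along particles. -/

/-- The time derivative of a function of `(x, t)`. -/
def dt (φ : ℝ × ℝ → ℝ) (p : ℝ × ℝ) : ℝ := fderiv ℝ φ p (0, 1)

/-- The space derivative of a function of `(x, t)`. -/
def dx (φ : ℝ × ℝ → ℝ) (p : ℝ × ℝ) : ℝ := fderiv ℝ φ p (1, 0)

/-- `C¹` functions that are bounded by `K` together with their first derivatives. -/
structure BoundedTest (φ : ℝ × ℝ → ℝ) (K : ℝ) : Prop where
  contDiff : ContDiff ℝ 1 φ
  abs_le : ∀ p, |φ p| ≤ K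
  abs_dt_le : ∀ p, |dt φ p| ≤ K
  abs_dx_le : ∀ p, |dx φ p| ≤ K

namespace BoundedTest

variable {φ : ℝ × ℝ → ℝ} {K : ℝ}

theorem continuous_dt (h : BoundedTest φ K) : Continuous (dt φ) :=
  (h.contDiff.continuous_fderiv one_ne_zero).clm_apply continuous_const

theorem continuous_dx (h : BoundedTest φ K) : Continuous (dx φ) :=
  (h.contDiff.continuous_fderiv one_ne_zero).clm_apply continuous_const

theorem nonneg (h : BoundedTest φ K) : 0 ≤ K := (abs_nonneg _).trans (h.abs_le 0)

end BoundedTest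

namespace MassFlow

variable {D : MassFlow} {φ : ℝ × ℝ → ℝ} {K T : ℝ}

variable (D) in
/-- The derivative of `φ` along the trajectory of the particle `m`. -/
def transport (φ : ℝ × ℝ → ℝ) (t m : ℝ) : ℝ :=
  dt φ (D.pos t m, t) + dx φ (D.pos t m, t) * D.vel t m

variable (D) in
theorem measurable_pos_prod : Measurable fun p : ℝ × ℝ => (D.pos p.1 p.2, p.1) :=
  D.measurable_pos.prodMk measurable_fst

theorem measurable_comp_pos {f : ℝ × ℝ → ℝ} (hf : Measurable f) :
    Measurable fun p : ℝ × ℝ => f (D.pos p.1 p.2, p.1) :=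
  hf.comp D.measurable_pos_prod

theorem measurable_transport (hφ : BoundedTest φ K) :
    Measurable fun p : ℝ × ℝ => D.transport φ p.1 p.2 :=
  (measurable_comp_pos hφ.continuous_dt.measurable).add
    ((measurable_comp_pos hφ.continuous_dx.measurable).mul D.measurable_vel)

theorem measurable_transport_right (hφ : BoundedTest φ K) (t : ℝ) :
    Measurable (D.transport φ t) := by
  have h := (measurable_transport (D := D) hφ).comp (measurable_prodMk_left (x := t))
  exact h

theorem abs_transport_le (hφ : BoundedTest φ K) (t m : ℝ) :
    |D.transport φ t m| ≤ K * (1 + |D.vel t m|) := by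
  have h1 := hφ.abs_dt_le (D.pos t m, t)
  have h2 := hφ.abs_dx_le (D.pos t m, t)
  calc _ ≤ |dt φ (D.pos t m, t)| + |dx φ (D.pos t m, t) * D.vel t m| := abs_add_le _ _
    _ ≤ K + K * |D.vel t m| := by rw [abs_mul]; gcongr
    _ = _ := by ring

variable (D) in
/-- Particles that follow their trajectory at almost all times up to `T`. -/
def Regular (T m : ℝ) : Prop :=
  m ∈ Ioo 0 D.L ∧ IntervalIntegrable (fun t => D.vel t m) volume 0 T ∧
    (∀ᵐ t ∂(volume.restrict (Ioc 0 T)), D.pos t m = D.path t m) ∧ D.pos T m = D.path T m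

theorem ae_regular (hT : 0 ≤ T) : ∀ᵐ m ∂(volume.restrict (Ioo 0 D.L)), D.Regular T m := by
  filter_upwards [ae_restrict_mem measurableSet_Ioo, ae_intervalIntegrable_vel hT,
    ae_ae_pos_eq_path T, ae_pos_eq_path hT] with m h1 h2 h3 h4
  exact ⟨h1, h2, h3, h4⟩

theorem Regular.integral_transport_path {m : ℝ} (hm : D.Regular T m) (hφ : ContDiff ℝ 1 φ)
    {s : ℝ} (hs : s ∈ Icc 0 T) :
    ∫ t in 0..s, D.transport φ t m = φ (D.path s m, s) - φ (D.pos 0 m, 0) := by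
  have hint : IntervalIntegrable (fun t => D.vel t m) volume 0 s :=
    hm.2.1.mono_set (by rw [uIcc_of_le hs.1, uIcc_of_le (hs.1.trans hs.2)]; exact
      Icc_subset_Icc_right hs.2)
  have := integral_fderiv_along_primitive hφ (c := D.pos 0 m) hs.1 hint
  unfold path
  rw [← this]
  refine intervalIntegral.integral_congr_ae ?_
  have h := hm.2.2.1
  rw [ae_restrict_iff' measurableSet_Ioc] at h
  filter_upwards [h] with t ht htI
  rw [uIoc_of_le hs.1] at htI
  rw [transport, ht ⟨htI.1, htI.2.trans hs.2⟩]
  rfl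

theorem Regular.integral_transport {m : ℝ} (hm : D.Regular T m) (hφ : ContDiff ℝ 1 φ)
    (hT : 0 ≤ T) :
    ∫ t in 0..T, D.transport φ t m = φ (D.pos T m, T) - φ (D.pos 0 m, 0) := by
  rw [hm.integral_transport_path hφ (right_mem_Icc.2 hT), hm.2.2.2]

theorem Regular.intervalIntegrable_transport {m : ℝ} (hm : D.Regular T m)
    (hφ : BoundedTest φ K) : IntervalIntegrable (fun t => D.transport φ t m) volume 0 T := by
  have h1 : IntervalIntegrable (fun t => K * (1 + |D.vel t m|)) volume 0 T :=
    ((intervalIntegrable_const (c := (1 : ℝ))).add hm.2.1.abs).const_mul K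
  have hmeas : Measurable fun t => D.transport φ t m := by
    have h := (measurable_transport (D := D) hφ).comp (measurable_prodMk_right (y := m))
    exact h
  refine h1.mono_fun hmeas.aestronglyMeasurable (Eventually.of_forall fun t => ?_)
  exact (abs_transport_le hφ t m).trans (le_abs_self _)

/-- The balance of the momentum of a single particle. -/
theorem Regular.integral_transport_mul {m : ℝ} (hm : D.Regular T m) (hφ : ContDiff ℝ 1 φ)
    (hT : 0 ≤ T) :
    ∫ t in 0..T, (D.transport φ t m * D.freeVel t m + D.κ * D.e m * φ (D.pos t m, t)) =
      φ (D.pos T m, T) * D.freeVel T m - φ (D.pos 0 m, 0) * D.freeVel 0 m := by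
  set a := D.v m
  set b := D.κ * D.e m
  -- For fixed m the free velocity is affine in time, so the chain rule applies to φ times it as a
  -- single smooth function.
  have hl : ContDiff ℝ 1 (fun p : ℝ × ℝ => a + b * p.2) := by fun_prop
  have h := hm.integral_transport (hφ.mul hl) hT
  have hf : ∀ t, D.freeVel t m = a + b * t := by intro t; simp only [freeVel, a, b]; ring
  simp only [hf]
  rw [← h]
  congr 1
  ext t
  have hd : ∀ p q : ℝ × ℝ, fderiv ℝ (fun p : ℝ × ℝ => φ p * (a + b * p.2)) p q =
      fderiv ℝ φ p q * (a + b * p.2) + φ p * (b * q.2) := by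
    intro p q
    have e1 : HasFDerivAt φ (fderiv ℝ φ p) p := (hφ.differentiable one_ne_zero p).hasFDerivAt
    have e2 : HasFDerivAt (fun p : ℝ × ℝ => a + b * p.2) (b • ContinuousLinearMap.snd ℝ ℝ ℝ) p :=
      ((ContinuousLinearMap.snd ℝ ℝ ℝ).hasFDerivAt.const_mul b).const_add a
    have e3 : HasFDerivAt (fun p : ℝ × ℝ => φ p * (a + b * p.2)) _ p := e1.mul e2
    rw [e3.fderiv]
    simp
    ring
  unfold transport dt dx
  rw [hd, hd]
  simp only [mul_one, mul_zero, add_zero]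
  ring

variable (D) in
/-- Space-time in the mass coordinate, up to time `T`. -/
abbrev spaceTime (T : ℝ) : Measure (ℝ × ℝ) :=
  (volume.restrict (Ioc 0 T)).prod (volume.restrict (Ioo 0 D.L))

theorem integrable_transport (hφ : BoundedTest φ K) (T : ℝ) :
    Integrable (fun p : ℝ × ℝ => D.transport φ p.1 p.2) (D.spaceTime T) := by
  have h1 : Integrable (fun p : ℝ × ℝ => K * (1 + |D.vel p.1 p.2|)) (D.spaceTime T) :=
    ((integrable_const 1).add (D.integrable_vel_prod T).abs).const_mul K
  refine h1.mono (measurable_transport hφ).aestronglyMeasurable (Eventually.of_forall fun p => ?_)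
  exact (abs_transport_le hφ p.1 p.2).trans (le_abs_self _)

/-- Conservation of mass. -/
theorem integral_mass (hφ : BoundedTest φ K) (hT : 0 ≤ T) :
    ∫ t in 0..T, ∫ m in Ioo 0 D.L, D.transport φ t m =
      (∫ m in Ioo 0 D.L, φ (D.pos T m, T)) - ∫ m in Ioo 0 D.L, φ (D.pos 0 m, 0) := by
  have hi : ∀ s, IntegrableOn (fun m => φ (D.pos s m, s)) (Ioo 0 D.L) := by
    intro s
    refine Integrable.of_bound (C := K) ?_ (Eventually.of_forall fun m => hφ.abs_le _)
    exact ((measurable_comp_pos hφ.contDiff.continuous.measurable).comp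
      (measurable_prodMk_left (x := s))).aestronglyMeasurable
  rw [← integral_sub (hi T) (hi 0), intervalIntegral.integral_of_le hT]
  have hsw := integral_integral_swap (f := fun t m => D.transport φ t m) (integrable_transport hφ T)
  rw [hsw]
  refine integral_congr_ae ?_
  filter_upwards [ae_regular hT] with m hm
  rw [← hm.integral_transport hφ.contDiff hT, intervalIntegral.integral_of_le hT]

/-! ### Truncation to a range of particles -/

theorem exists_abs_freeVel_le {a b : ℝ} (ha : a ∈ Ioo 0 D.L) (hb : b ∈ Ioo 0 D.L) (T : ℝ) :
    ∃ B, 0 ≤ B ∧ ∀ t, |t| ≤ T → ∀ m ∈ Icc a b, |D.freeVel t m| ≤ B := by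
  obtain ⟨B, hB⟩ := D.bdd_v a ha b hb
  refine ⟨|B| + |D.κ| * |T| * D.L, by have := D.L_pos; positivity, fun t ht m hm => ?_⟩
  have h1 := (hB m hm).trans (le_abs_self B)
  refine (abs_add_le _ _).trans (add_le_add h1 ?_)
  rw [abs_mul, abs_mul, abs_of_nonneg (D.e_nonneg m)]
  exact mul_le_mul (mul_le_mul_of_nonneg_left (ht.trans (le_abs_self T)) (abs_nonneg _)) (D.e_le m)
    (D.e_nonneg m) (by positivity)

/-- A cluster reaching below a or above b moves with the velocity of a or of b. Otherwise the
velocity is an average of free velocities over [a, b], or a single one. -/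
theorem exists_abs_vel_le {a b : ℝ} (ha : a ∈ Ioo 0 D.L) (hb : b ∈ Ioo 0 D.L) (t : ℝ) :
    ∃ B, ∀ m ∈ Icc a b, |D.vel t m| ≤ B := by
  obtain ⟨B, hB0, hB⟩ := exists_abs_freeVel_le ha hb |t|
  refine ⟨max B (max |D.vel t a| |D.vel t b|), fun m hm => ?_⟩
  have hmI : m ∈ Ioo 0 D.L := ⟨ha.1.trans_le hm.1, hm.2.trans_lt hb.2⟩
  by_cases hla : D.lower (D.pos t m) t < a
  · have : D.pos t a = D.pos t m := by
      refine le_antisymm (pos_mono ha hmI hm.1) (le_pos_of_lower_lt ha hla)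
    have : D.vel t m = D.vel t a := by simp only [vel, this]
    rw [this]; exact (le_max_left _ _).trans (le_max_right _ _)
  by_cases hub : b < D.upper (D.pos t m) t
  · have : D.pos t b = D.pos t m := by
      refine le_antisymm ((pos_le_iff hb _).2 hub.le) (pos_mono hmI hb hm.2)
    have : D.vel t m = D.vel t b := by simp only [vel, this]
    rw [this]; exact (le_max_right _ _).trans (le_max_right _ _)
  refine le_max_of_le_left ?_
  rw [not_lt] at hla hub
  rcases (D.lower_le_upper (D.pos t m) t).eq_or_lt with heq | hlt
  · rw [vel_eq_freeVel hmI heq]; exact hB t le_rfl m hm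
  · have h1 : |D.vel t m| * (D.upper (D.pos t m) t - D.lower (D.pos t m) t) ≤
        B * (D.upper (D.pos t m) t - D.lower (D.pos t m) t) := by
      have h2 := velocity_mul hlt
      rw [← abs_of_pos (sub_pos.2 hlt), ← abs_mul, vel, h2]
      refine intervalIntegral.norm_integral_le_of_norm_le_const (f := D.freeVel t) fun s hs => ?_
      rw [uIoc_of_le hlt.le] at hs
      exact hB t le_rfl s ⟨hla.trans hs.1.le, hs.2.trans hub⟩
    exact le_of_mul_le_mul_right h1 (sub_pos.2 hlt)

variable (D) in
/-- A bound for the momentum exchanged across the particle `m` up to time `T`. -/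
def exchange (T m : ℝ) : ℝ :=
  2 * |D.defect 0 m| + |D.defect T m + |D.κ| * (D.L * min m (D.L - m)) * T| +
    |(|D.κ| * (D.L * min m (D.L - m)) * T)|

theorem intervalIntegrable_transport_mul_defect {m : ℝ} (hm : D.Regular T m)
    (hφ : BoundedTest φ K) (hT : 0 ≤ T) :
    IntervalIntegrable (fun t => D.transport φ t m * D.defect t m) volume 0 T := by
  set c := |D.κ| * (D.L * min m (D.L - m)) with hc
  have hmon := monotone_defect hm.1
  have hg : Measurable fun t => D.defect t m := by
    have : Measurable fun t => (D.defect t m + c * t) - c * t :=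
      hmon.measurable.sub (by fun_prop)
    simpa using this
  have h := hm.intervalIntegrable_transport hφ
  rw [intervalIntegrable_iff_integrableOn_Ioc_of_le hT] at h ⊢
  refine Integrable.mul_bdd
    (c := |D.defect 0 m + c * 0| + |D.defect T m + c * T| + |c| * T) h hg.aestronglyMeasurable ?_
  filter_upwards [ae_restrict_mem measurableSet_Ioc] with t ht
  have e1 := hmon ht.1.le
  have e2 := hmon ht.2
  simp only at e1 e2
  have e3 : |c * t| ≤ |c| * T := by rw [abs_mul, abs_of_pos ht.1]; gcongr; exact ht.2
  rw [abs_le] at e3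
  rw [Real.norm_eq_abs, abs_le]
  constructor <;> linarith [neg_abs_le (D.defect 0 m + c * 0), le_abs_self (D.defect T m + c * T),
    abs_nonneg (D.defect 0 m + c * 0), abs_nonneg (D.defect T m + c * T)]

/-- The transport term has no pointwise bound, but its time integrals are increments of φ, at most
2K. Writing the defect as a difference of two monotone functions of time, defect + ct and ct, makes
`abs_integral_mul_le_of_monotoneOn` applicable to each. -/
theorem abs_integral_transport_mul_defect_le {m : ℝ} (hm : D.Regular T m)
    (hφ : BoundedTest φ K) (hT : 0 ≤ T) :
    |∫ t in 0..T, D.transport φ t m * D.defect t m| ≤ 2 * K * D.exchange T m := by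
  set c := |D.κ| * (D.L * min m (D.L - m)) with hc
  have hmon := monotone_defect hm.1
  have hc0 : 0 ≤ c := by
    have := D.L_pos
    have := hm.1.1
    have := sub_pos.2 hm.1.2
    positivity
  have h := hm.intervalIntegrable_transport hφ
  have hK : ∀ s ∈ Icc 0 T, |∫ t in s..T, D.transport φ t m| ≤ 2 * K := by
    intro s hs
    have h1 := hm.integral_transport_path hφ.contDiff hs
    have h2 := hm.integral_transport_path hφ.contDiff (right_mem_Icc.2 hT)
    have h3 : IntervalIntegrable (fun t => D.transport φ t m) volume 0 s :=
      h.mono_set (by rw [uIcc_of_le hs.1, uIcc_of_le hT]; exact Icc_subset_Icc_right hs.2)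
    rw [← intervalIntegral.integral_interval_sub_left h h3, h1, h2]
    have e1 := hφ.abs_le (D.path s m, s)
    have e2 := hφ.abs_le (D.path T m, T)
    rw [abs_le] at e1 e2 ⊢
    constructor <;> linarith
  have h1 := abs_integral_mul_le_of_monotoneOn hT h hK (hmon.monotoneOn _)
  have h2 := abs_integral_mul_le_of_monotoneOn (g := fun t => c * t) hT h hK
    (fun a _ b _ hab => mul_le_mul_of_nonneg_left hab hc0)
  have hl : IntervalIntegrable (fun t => D.transport φ t m * (c * t)) volume 0 T :=
    h.mul_continuousOn (by fun_prop)
  have hs : ∫ t in 0..T, D.transport φ t m * D.defect t m =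
      (∫ t in 0..T, D.transport φ t m * (D.defect t m + c * t)) -
        ∫ t in 0..T, D.transport φ t m * (c * t) := by
    rw [← intervalIntegral.integral_sub _ hl]
    · congr 1; ext t; ring
    · simp only [mul_add]
      exact (intervalIntegrable_transport_mul_defect hm hφ hT).add hl
  rw [hs]
  refine (abs_sub _ _).trans ((add_le_add h1 h2).trans (le_of_eq ?_))
  unfold exchange
  rw [← hc]
  simp
  ring

/-- The defect at the fixed times 0 and T is continuous in m and zero at both ends, and the drift
carries the factor min(m, L − m). -/
theorem tendsto_exchange {m : ℕ → ℝ} {c : ℝ} (hm : ∀ n, m n ∈ Ioo 0 D.L) (hc : c = 0 ∨ c = D.L)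
    (hlim : Tendsto m atTop (𝓝 c)) (T : ℝ) :
    Tendsto (fun n => D.exchange T (m n)) atTop (𝓝 0) := by
  have h0 := tendsto_defect hm hc hlim 0
  have hT := tendsto_defect hm hc hlim T
  have hmin : Tendsto (fun n => |D.κ| * (D.L * min (m n) (D.L - m n)) * T) atTop (𝓝 0) := by
    have hcont : Continuous fun x : ℝ => |D.κ| * (D.L * min x (D.L - x)) * T := by fun_prop
    have := (hcont.tendsto c).comp hlim
    have hz : |D.κ| * (D.L * min c (D.L - c)) * T = 0 := by
      rcases hc with rfl | rfl
      · rw [sub_zero, min_eq_left D.L_pos.le]; ring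
      · rw [sub_self, min_eq_right D.L_pos.le]; ring
    rwa [hz] at this
  have := ((h0.abs.const_mul 2).add (hT.add hmin).abs).add hmin.abs
  simpa [exchange] using this

theorem intervalIntegrable_mul_vel {t m₁ m₂ : ℝ} (hφ : BoundedTest φ K) (h1 : m₁ ∈ Ioo 0 D.L)
    (h2 : m₂ ∈ Ioo 0 D.L) (h12 : m₁ ≤ m₂) {f : ℝ → ℝ} (hf : IntegrableOn f (Ioo 0 D.L)) :
    IntervalIntegrable (fun m => D.transport φ t m * f m) volume m₁ m₂ := by
  obtain ⟨B, hB⟩ := exists_abs_vel_le h1 h2 t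
  have hfi := intervalIntegrable_of_Ioo hf (mem_Icc_of_mem_Ioo h1) (mem_Icc_of_mem_Ioo h2)
  rw [intervalIntegrable_iff_integrableOn_Ioc_of_le h12] at hfi ⊢
  refine Integrable.bdd_mul (c := K * (1 + B)) hfi
    (measurable_transport_right hφ t).aestronglyMeasurable ?_
  filter_upwards [ae_restrict_mem measurableSet_Ioc] with m hm
  refine (abs_transport_le hφ t m).trans ?_
  have := hφ.nonneg
  gcongr
  exact hB m (Ioc_subset_Icc_self hm)

/-- Exchange of momentum across the ends of a range of particles, at a fixed time. -/
theorem integral_transport_mul_freeVel {t m₁ m₂ : ℝ} (hφ : BoundedTest φ K)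
    (h1 : m₁ ∈ Ioo 0 D.L) (h2 : m₂ ∈ Ioo 0 D.L) (h12 : m₁ ≤ m₂) :
    ∫ m in m₁..m₂, D.transport φ t m * D.freeVel t m =
      (∫ m in m₁..m₂, D.transport φ t m * D.vel t m) +
        (D.transport φ t m₂ * D.defect t m₂ - D.transport φ t m₁ * D.defect t m₁) := by
  have i1 := intervalIntegrable_mul_vel (t := t) hφ h1 h2 h12 (integrableOn_freeVel t)
  have i2 := intervalIntegrable_mul_vel (t := t) hφ h1 h2 h12 (integrableOn_vel t)
  have i3 : IntervalIntegrable (fun m => (fun x => dt φ (x, t) + dx φ (x, t) * D.velocity x t)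
      (D.pos t m) * (D.freeVel t m - D.vel t m)) volume m₁ m₂ := by
    refine (i1.sub i2).congr fun m _ => ?_
    simp only [transport, vel]; ring
  -- At a fixed time `transport` depends on m only through the position, so it is an admissible
  -- weight.
  have h := integral_mul_sub_eq_defect (k := fun x => dt φ (x, t) + dx φ (x, t) * D.velocity x t)
    h1 h2 h12 i3
  have h' : ∫ m in m₁..m₂, (fun x => dt φ (x, t) + dx φ (x, t) * D.velocity x t)
      (D.pos t m) * (D.freeVel t m - D.vel t m) =
      (∫ m in m₁..m₂, D.transport φ t m * D.freeVel t m) -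
        ∫ m in m₁..m₂, D.transport φ t m * D.vel t m := by
    rw [← intervalIntegral.integral_sub i1 i2]
    congr 1; ext m
    simp only [transport, vel]; ring
  rw [h'] at h
  have : ∀ m, D.transport φ t m = dt φ (D.pos t m, t) + dx φ (D.pos t m, t) * D.velocity (D.pos t m) t :=
    fun m => rfl
  rw [this m₁, this m₂]
  linarith

theorem integrable_mul_freeVel_Ioc {m₁ m₂ : ℝ} (hφ : BoundedTest φ K)
    (h1 : m₁ ∈ Ioo 0 D.L) (h2 : m₂ ∈ Ioo 0 D.L) (T : ℝ) :
    Integrable (fun p : ℝ × ℝ => D.transport φ p.1 p.2 * D.freeVel p.1 p.2)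
      ((volume.restrict (Ioc 0 T)).prod (volume.restrict (Ioc m₁ m₂))) := by
  obtain ⟨B, -, hB⟩ := exists_abs_freeVel_le h1 h2 T
  have hi : Integrable (fun p : ℝ × ℝ => D.transport φ p.1 p.2)
      ((volume.restrict (Ioc 0 T)).prod (volume.restrict (Ioc m₁ m₂))) := by
    have h1' : Integrable (fun p : ℝ × ℝ => K * (1 + |D.vel p.1 p.2|))
        ((volume.restrict (Ioc 0 T)).prod (volume.restrict (Ioc m₁ m₂))) :=
      ((integrable_const 1).add (integrable_vel_prod_Ioc (mem_Icc_of_mem_Ioo h1)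
        (mem_Icc_of_mem_Ioo h2) T).abs).const_mul K
    refine h1'.mono (measurable_transport hφ).aestronglyMeasurable
      (Eventually.of_forall fun p => ?_)
    exact (abs_transport_le hφ p.1 p.2).trans (le_abs_self _)
  refine hi.mul_bdd (c := B) D.measurable_freeVel.aestronglyMeasurable ?_
  rw [Measure.prod_restrict]
  filter_upwards [ae_restrict_mem (measurableSet_Ioc.prod measurableSet_Ioc)] with p hp
  exact hB p.1 (by rw [abs_of_pos hp.1.1]; exact hp.1.2) p.2 (Ioc_subset_Icc_self hp.2)

theorem integrable_force (hφ : BoundedTest φ K) (μ : Measure (ℝ × ℝ)) [IsFiniteMeasure μ] :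
    Integrable (fun p : ℝ × ℝ => D.κ * D.e p.2 * φ (D.pos p.1 p.2, p.1)) μ := by
  refine Integrable.of_bound (C := |D.κ| * D.L * K) ?_ (Eventually.of_forall fun p => ?_)
  · exact (((D.measurable_e.comp measurable_snd).const_mul _).mul
      (measurable_comp_pos hφ.contDiff.continuous.measurable)).aestronglyMeasurable
  · rw [Real.norm_eq_abs, abs_mul, abs_mul, abs_of_nonneg (D.e_nonneg p.2)]
    have := D.L_pos
    gcongr
    · exact D.e_le _
    · exact hφ.abs_le _

/-- The momentum balance for a range of particles, up to the exchange at its ends. -/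
theorem momentum_balance_truncated {m₁ m₂ : ℝ} (hφ : BoundedTest φ K) (hT : 0 ≤ T)
    (h1 : D.Regular T m₁) (h2 : D.Regular T m₂) (h12 : m₁ ≤ m₂) :
    IntervalIntegrable (fun t => ∫ m in m₁..m₂, D.transport φ t m * D.vel t m) volume 0 T ∧
    |(∫ t in 0..T, ∫ m in m₁..m₂, D.transport φ t m * D.vel t m) +
      (∫ t in 0..T, ∫ m in m₁..m₂, D.κ * D.e m * φ (D.pos t m, t)) -
      ∫ m in m₁..m₂, (φ (D.pos T m, T) * D.freeVel T m - φ (D.pos 0 m, 0) * D.freeVel 0 m)| ≤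
      2 * K * (D.exchange T m₁ + D.exchange T m₂) := by
  have i1 := integrable_mul_freeVel_Ioc hφ h1.1 h2.1 T
  have i2 := integrable_force (D := D) hφ ((volume.restrict (Ioc 0 T)).prod
    (volume.restrict (Ioc m₁ m₂)))
  have j1 : IntervalIntegrable (fun t => ∫ m in m₁..m₂, D.transport φ t m * D.freeVel t m)
      volume 0 T := by
    rw [intervalIntegrable_iff_integrableOn_Ioc_of_le hT]
    simp only [intervalIntegral.integral_of_le h12]
    exact i1.integral_prod_left
  have j2 : IntervalIntegrable (fun t => ∫ m in m₁..m₂, D.κ * D.e m * φ (D.pos t m, t))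
      volume 0 T := by
    rw [intervalIntegrable_iff_integrableOn_Ioc_of_le hT]
    simp only [intervalIntegral.integral_of_le h12]
    exact i2.integral_prod_left
  have d1 := intervalIntegrable_transport_mul_defect h1 hφ hT
  have d2 := intervalIntegrable_transport_mul_defect h2 hφ hT
  have heq : ∀ t, ∫ m in m₁..m₂, D.transport φ t m * D.vel t m =
      (∫ m in m₁..m₂, D.transport φ t m * D.freeVel t m) -
        (D.transport φ t m₂ * D.defect t m₂ - D.transport φ t m₁ * D.defect t m₁) := fun t => by
    rw [integral_transport_mul_freeVel hφ h1.1 h2.1 h12]; ring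
  simp only [heq]
  refine ⟨j1.sub (d2.sub d1), ?_⟩
  rw [intervalIntegral.integral_sub j1 (d2.sub d1), intervalIntegral.integral_sub d2 d1]
  -- With the free velocity in place of the actual one the balance is exact: Fubini and the
  -- single-particle identity.
  have hmain : (∫ t in 0..T, ∫ m in m₁..m₂, D.transport φ t m * D.freeVel t m) +
      (∫ t in 0..T, ∫ m in m₁..m₂, D.κ * D.e m * φ (D.pos t m, t)) =
      ∫ m in m₁..m₂, (φ (D.pos T m, T) * D.freeVel T m - φ (D.pos 0 m, 0) * D.freeVel 0 m) := by
    simp only [intervalIntegral.integral_of_le h12, intervalIntegral.integral_of_le hT]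
    rw [integral_integral_swap (f := fun t m => D.transport φ t m * D.freeVel t m) i1,
      integral_integral_swap (f := fun t m => D.κ * D.e m * φ (D.pos t m, t)) i2,
      ← integral_add i1.integral_prod_right i2.integral_prod_right]
    refine integral_congr_ae ?_
    have hreg : ∀ᵐ m ∂(volume.restrict (Ioc m₁ m₂)), D.Regular T m := by
      refine ae_restrict_of_ae_restrict_of_subset ?_ (ae_regular hT)
      exact fun m hm => ⟨h1.1.1.trans hm.1, hm.2.trans_lt h2.1.2⟩
    filter_upwards [hreg, i1.prod_left_ae, i2.prod_left_ae] with m hm k1 k2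
    rw [← hm.integral_transport_mul hφ.contDiff hT, ← integral_add k1 k2,
      intervalIntegral.integral_of_le hT]
  have e1 := abs_integral_transport_mul_defect_le h1 hφ hT
  have e2 := abs_integral_transport_mul_defect_le h2 hφ hT
  rw [show ∀ a b c d e : ℝ, a - (b - c) + d - e = (a + d) - e + (c - b) by intros; ring, hmain,
    sub_self, zero_add]
  refine (abs_sub _ _).trans ?_
  linarith

end MassFlow

/-! ### Exhaustion by ranges of particles, the local energy bound and the full momentum balance. -/

theorem dt_arctan (p : ℝ × ℝ) : dt (fun p : ℝ × ℝ => Real.arctan p.1) p = 0 := by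
  have h : HasFDerivAt (fun p : ℝ × ℝ => Real.arctan p.1) _ p :=
    (ContinuousLinearMap.fst ℝ ℝ ℝ).hasFDerivAt.arctan
  rw [dt, h.fderiv]
  simp

theorem dx_arctan (p : ℝ × ℝ) :
    dx (fun p : ℝ × ℝ => Real.arctan p.1) p = 1 / (1 + p.1 ^ 2) := by
  have h : HasFDerivAt (fun p : ℝ × ℝ => Real.arctan p.1) _ p :=
    (ContinuousLinearMap.fst ℝ ℝ ℝ).hasFDerivAt.arctan
  rw [dx, h.fderiv]
  simp

/-- A bounded test function, increasing in x and independent of t: its transport times `vel` is the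
nonnegative quantity vel²/(1 + pos²). -/
theorem boundedTest_arctan : BoundedTest (fun p : ℝ × ℝ => Real.arctan p.1) 2 where
  contDiff := Real.contDiff_arctan.comp contDiff_fst
  abs_le p := by
    rw [abs_le]
    constructor <;> linarith [Real.neg_pi_div_two_lt_arctan p.1, Real.arctan_lt_pi_div_two p.1,
      Real.pi_le_four]
  abs_dt_le p := by rw [dt_arctan]; simp
  abs_dx_le p := by
    rw [dx_arctan, abs_of_nonneg (by positivity), div_le_iff₀ (by positivity)]
    nlinarith [sq_nonneg p.1]

namespace MassFlow

variable {D : MassFlow} {φ : ℝ × ℝ → ℝ} {K T : ℝ}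

theorem exists_regular (hT : 0 ≤ T) {c d : ℝ} (hc : 0 ≤ c) (hcd : c < d) (hd : d ≤ D.L) :
    ∃ m ∈ Ioo c d, D.Regular T m := by
  have h : ∀ᵐ m ∂(volume.restrict (Ioo c d)), m ∈ Ioo c d ∧ D.Regular T m := by
    filter_upwards [ae_restrict_mem measurableSet_Ioo, ae_restrict_of_ae_restrict_of_subset
      (Ioo_subset_Ioo hc hd) (ae_regular hT)] with m h1 h2 using ⟨h1, h2⟩
  have hne : (ae (volume.restrict (Ioo c d))).NeBot := by
    rw [ae_neBot, Ne, Measure.restrict_eq_zero, Real.volume_Ioo]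
    simpa using hcd
  obtain ⟨m, h1, h2⟩ := h.exists
  exact ⟨m, h1, h2⟩

variable (D) in
theorem exists_regular_seq (hT : 0 ≤ T) : ∃ a b : ℕ → ℝ, (∀ n, D.Regular T (a n)) ∧
    (∀ n, D.Regular T (b n)) ∧ (∀ n, a n ≤ b n) ∧ Tendsto a atTop (𝓝 0) ∧
    Tendsto b atTop (𝓝 D.L) := by
  have hL := D.L_pos
  have hpos : ∀ n : ℕ, 0 < D.L / ((n : ℝ) + 2) := fun n => by positivity
  have hle : ∀ n : ℕ, D.L / ((n : ℝ) + 2) ≤ D.L / 2 := fun n => by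
    gcongr; linarith [(Nat.cast_nonneg n : (0 : ℝ) ≤ n)]
  have h1 : ∀ n : ℕ, ∃ m ∈ Ioo 0 (D.L / ((n : ℝ) + 2)), D.Regular T m := fun n =>
    exists_regular hT le_rfl (hpos n) (by linarith [hle n])
  have h2 : ∀ n : ℕ, ∃ m ∈ Ioo (D.L - D.L / ((n : ℝ) + 2)) D.L, D.Regular T m := fun n =>
    exists_regular hT (by linarith [hle n]) (by linarith [hpos n]) le_rfl
  choose a ha ha' using h1
  choose b hb hb' using h2
  have hlim : Tendsto (fun n : ℕ => D.L / ((n : ℝ) + 2)) atTop (𝓝 0) :=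
    tendsto_const_nhds.div_atTop
      (tendsto_atTop_add_const_right _ _ tendsto_natCast_atTop_atTop)
  refine ⟨a, b, ha', hb', fun n => ?_, ?_, ?_⟩
  · linarith [(ha n).2, (hb n).1, hle n]
  · exact squeeze_zero (fun n => (ha n).1.le) (fun n => (ha n).2.le) hlim
  · refine tendsto_of_tendsto_of_tendsto_of_le_of_le (g := fun n : ℕ => D.L - D.L / ((n : ℝ) + 2))
      (by simpa using hlim.const_sub D.L) tendsto_const_nhds (fun n => (hb n).1.le)
      fun n => (hb n).2.le

theorem spaceTime_restrict {a b : ℝ} (ha : 0 < a) (hb : b < D.L) (T : ℝ) :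
    (D.spaceTime T).restrict (univ ×ˢ Ioc a b) =
      (volume.restrict (Ioc 0 T)).prod (volume.restrict (Ioc a b)) := by
  rw [spaceTime, ← Measure.prod_restrict, Measure.restrict_univ,
    Measure.restrict_restrict measurableSet_Ioc, inter_eq_self_of_subset_left]
  exact fun m hm => ⟨ha.trans hm.1, hm.2.trans_lt hb⟩

theorem aecover_spaceTime {a b : ℕ → ℝ} (ha : Tendsto a atTop (𝓝 0))
    (hb : Tendsto b atTop (𝓝 D.L)) (T : ℝ) :
    AECover (D.spaceTime T) atTop fun n => (univ : Set ℝ) ×ˢ Ioc (a n) (b n) where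
  ae_eventually_mem := by
    have h := (aecover_Ioo_of_Ioc (μ := (volume : Measure ℝ)) ha hb).ae_eventually_mem
    have h' := (Measure.quasiMeasurePreserving_snd (μ := volume.restrict (Ioc 0 T))
      (ν := volume.restrict (Ioo 0 D.L))).ae h
    filter_upwards [h'] with p hp
    filter_upwards [hp] with n hn using ⟨mem_univ _, hn⟩
  measurableSet n := MeasurableSet.univ.prod measurableSet_Ioc

variable (D) in
/-- The momentum given to the test function between the times `0` and `T`. -/
def momChange (φ : ℝ × ℝ → ℝ) (T m : ℝ) : ℝ :=
  φ (D.pos T m, T) * D.freeVel T m - φ (D.pos 0 m, 0) * D.freeVel 0 m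

theorem integrableOn_mul_freeVel (hφ : BoundedTest φ K) (t : ℝ) :
    IntegrableOn (fun m => φ (D.pos t m, t) * D.freeVel t m) (Ioo 0 D.L) := by
  refine Integrable.bdd_mul (c := K) (integrableOn_freeVel t) ?_
    (Eventually.of_forall fun m => hφ.abs_le _)
  have h := (measurable_comp_pos (D := D) hφ.contDiff.continuous.measurable).comp
    (measurable_prodMk_left (x := t))
  exact h.aestronglyMeasurable

theorem integrableOn_momChange (hφ : BoundedTest φ K) (T : ℝ) :
    IntegrableOn (D.momChange φ T) (Ioo 0 D.L) :=
  (integrableOn_mul_freeVel hφ T).sub (integrableOn_mul_freeVel hφ 0)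

/-- The momentum balance on an exhausting sequence of ranges of particles. -/
theorem tendsto_momentum_balance (hφ : BoundedTest φ K) (hT : 0 ≤ T) {a b : ℕ → ℝ}
    (ha : ∀ n, D.Regular T (a n)) (hb : ∀ n, D.Regular T (b n)) (hab : ∀ n, a n ≤ b n)
    (ha0 : Tendsto a atTop (𝓝 0)) (hbL : Tendsto b atTop (𝓝 D.L)) :
    Tendsto (fun n => ∫ t in 0..T, ∫ m in a n..b n, D.transport φ t m * D.vel t m) atTop
      (𝓝 ((∫ m in Ioo 0 D.L, D.momChange φ T m) -
        ∫ p, D.κ * D.e p.2 * φ (D.pos p.1 p.2, p.1) ∂(D.spaceTime T))) := by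
  have hcov := aecover_spaceTime (D := D) ha0 hbL T
  have l1 := hcov.integral_tendsto_of_countably_generated
    (integrable_force (D := D) hφ (D.spaceTime T))
  have hforce : ∀ n, ∫ p in univ ×ˢ Ioc (a n) (b n), D.κ * D.e p.2 * φ (D.pos p.1 p.2, p.1)
      ∂(D.spaceTime T) = ∫ t in 0..T, ∫ m in a n..b n, D.κ * D.e m * φ (D.pos t m, t) := by
    intro n
    rw [spaceTime_restrict (ha n).1.1 (hb n).1.2, integral_prod _ (integrable_force hφ _)]
    simp only [intervalIntegral.integral_of_le hT, intervalIntegral.integral_of_le (hab n)]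
  simp only [hforce] at l1
  have l2 := (aecover_Ioo_of_Ioc (μ := (volume : Measure ℝ)) ha0
    hbL).integral_tendsto_of_countably_generated (integrableOn_momChange (D := D) hφ T)
  have hch : ∀ n, ∫ m in Ioc (a n) (b n), D.momChange φ T m ∂(volume.restrict (Ioo 0 D.L)) =
      ∫ m in a n..b n, (φ (D.pos T m, T) * D.freeVel T m - φ (D.pos 0 m, 0) * D.freeVel 0 m) := by
    intro n
    rw [Measure.restrict_restrict measurableSet_Ioc, inter_eq_self_of_subset_left,
      intervalIntegral.integral_of_le (hab n)]
    · rfl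
    · exact fun m hm => ⟨(ha n).1.1.trans hm.1, hm.2.trans_lt (hb n).1.2⟩
  simp only [hch] at l2
  have l3 : Tendsto (fun n => 2 * K * (D.exchange T (a n) + D.exchange T (b n))) atTop (𝓝 0) := by
    have := ((tendsto_exchange (fun n => (ha n).1) (Or.inl rfl) ha0 T).add
      (tendsto_exchange (fun n => (hb n).1) (Or.inr rfl) hbL T)).const_mul (2 * K)
    simpa using this
  have l4 := (tendsto_zero_iff_abs_tendsto_zero _).2 <| squeeze_zero (fun n => abs_nonneg _)
    (fun n => (momentum_balance_truncated hφ hT (ha n) (hb n) (hab n)).2) l3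
  have := (l4.add l2).sub l1
  rw [zero_add] at this
  refine this.congr fun n => ?_
  ring

/-- For the test function arctan x the truncated balances have nonnegative integrand and convergent
right sides, so the integrals over an exhausting sequence stay bounded. -/
theorem integrable_energy (hT : 0 ≤ T) :
    Integrable (fun p : ℝ × ℝ => D.vel p.1 p.2 ^ 2 / (1 + D.pos p.1 p.2 ^ 2)) (D.spaceTime T) := by
  have hφ := boundedTest_arctan
  obtain ⟨a, b, ha, hb, hab, ha0, hbL⟩ := D.exists_regular_seq hT
  have hF : ∀ t m, D.transport (fun p : ℝ × ℝ => Real.arctan p.1) t m * D.vel t m =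
      D.vel t m ^ 2 / (1 + D.pos t m ^ 2) := by
    intro t m
    rw [transport, dt_arctan, dx_arctan]
    ring
  have hlim := tendsto_momentum_balance hφ hT ha hb hab ha0 hbL
  simp only [hF] at hlim
  have hmeas : Measurable fun p : ℝ × ℝ => D.vel p.1 p.2 ^ 2 / (1 + D.pos p.1 p.2 ^ 2) :=
    (D.measurable_vel.pow_const 2).div ((D.measurable_pos.pow_const 2).const_add 1)
  have hint : ∀ n, Integrable (fun p : ℝ × ℝ => D.vel p.1 p.2 ^ 2 / (1 + D.pos p.1 p.2 ^ 2))
      ((volume.restrict (Ioc 0 T)).prod (volume.restrict (Ioc (a n) (b n)))) := by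
    intro n
    rw [integrable_prod_iff hmeas.aestronglyMeasurable]
    constructor
    · refine Eventually.of_forall fun t => ?_
      have := intervalIntegrable_mul_vel (t := t) hφ (ha n).1 (hb n).1 (hab n) (integrableOn_vel t)
      rw [intervalIntegrable_iff_integrableOn_Ioc_of_le (hab n)] at this
      simp only [hF] at this
      exact this
    · have := (momentum_balance_truncated hφ hT (ha n) (hb n) (hab n)).1
      rw [intervalIntegrable_iff_integrableOn_Ioc_of_le hT] at this
      simp only [hF, intervalIntegral.integral_of_le (hab n)] at this
      refine this.congr (Eventually.of_forall fun t => ?_)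
      refine integral_congr_ae (Eventually.of_forall fun m => ?_)
      exact (abs_of_nonneg (by positivity)).symm
  -- The bound is the limit of the truncated integrals plus 1, valid from some n on.
  refine (aecover_spaceTime (D := D) ha0 hbL T).integrable_of_integral_bounded_of_nonneg_ae
    (((∫ m in Ioo 0 D.L, D.momChange (fun p : ℝ × ℝ => Real.arctan p.1) T m) -
        ∫ p, D.κ * D.e p.2 * Real.arctan (D.pos p.1 p.2) ∂(D.spaceTime T)) + 1) (fun n => ?_)
    (Eventually.of_forall fun p => by positivity) ?_
  · rw [IntegrableOn, spaceTime_restrict (ha n).1.1 (hb n).1.2]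
    exact hint n
  · filter_upwards [hlim.eventually (gt_mem_nhds (lt_add_one _))] with n hn
    rw [spaceTime_restrict (ha n).1.1 (hb n).1.2, integral_prod _ (hint n)]
    simp only [intervalIntegral.integral_of_le hT, intervalIntegral.integral_of_le (hab n)] at hn
    exact hn.le

/-- The time derivative meets only |vel|, which is integrable, and the space derivative meets vel²
with the weight of `integrable_energy`. -/
theorem integrable_transport_mul_vel (hφ : BoundedTest φ K) {K' : ℝ}
    (hK' : ∀ p, |dx φ p| ≤ K' / (1 + p.1 ^ 2)) (hT : 0 ≤ T) :
    Integrable (fun p : ℝ × ℝ => D.transport φ p.1 p.2 * D.vel p.1 p.2) (D.spaceTime T) := by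
  have h1 : Integrable (fun p : ℝ × ℝ => K * |D.vel p.1 p.2| +
      K' * (D.vel p.1 p.2 ^ 2 / (1 + D.pos p.1 p.2 ^ 2))) (D.spaceTime T) :=
    ((D.integrable_vel_prod T).abs.const_mul K).add ((integrable_energy hT).const_mul K')
  refine h1.mono ((measurable_transport hφ).mul D.measurable_vel).aestronglyMeasurable
    (Eventually.of_forall fun p => ?_)
  refine le_trans ?_ (le_abs_self _)
  have e1 := hφ.abs_dt_le (D.pos p.1 p.2, p.1)
  have e2 := hK' (D.pos p.1 p.2, p.1)
  rw [Real.norm_eq_abs, abs_mul, transport]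
  calc _ ≤ (|dt φ (D.pos p.1 p.2, p.1)| + |dx φ (D.pos p.1 p.2, p.1)| * |D.vel p.1 p.2|) *
        |D.vel p.1 p.2| := by
        gcongr; rw [← abs_mul]; exact abs_add_le _ _
    _ ≤ (K + K' / (1 + D.pos p.1 p.2 ^ 2) * |D.vel p.1 p.2|) * |D.vel p.1 p.2| := by gcongr
    _ = _ := by
      rw [← sq_abs (D.vel p.1 p.2)]; ring

/-- Balance of momentum. -/
theorem integral_momentum (hφ : BoundedTest φ K) {K' : ℝ}
    (hK' : ∀ p, |dx φ p| ≤ K' / (1 + p.1 ^ 2)) (hT : 0 ≤ T) :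
    (∫ p, D.transport φ p.1 p.2 * D.vel p.1 p.2 ∂(D.spaceTime T)) +
      ∫ p, D.κ * D.e p.2 * φ (D.pos p.1 p.2, p.1) ∂(D.spaceTime T) =
      ∫ m in Ioo 0 D.L, D.momChange φ T m := by
  obtain ⟨a, b, ha, hb, hab, ha0, hbL⟩ := D.exists_regular_seq hT
  have hlim := tendsto_momentum_balance hφ hT ha hb hab ha0 hbL
  have hint := integrable_transport_mul_vel (D := D) hφ hK' hT
  have hlim' := (aecover_spaceTime (D := D) ha0 hbL T).integral_tendsto_of_countably_generated hint
  have heq : ∀ n, ∫ p in univ ×ˢ Ioc (a n) (b n), D.transport φ p.1 p.2 * D.vel p.1 p.2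
      ∂(D.spaceTime T) = ∫ t in 0..T, ∫ m in a n..b n, D.transport φ t m * D.vel t m := by
    intro n
    have h := hint.integrableOn (s := univ ×ˢ Ioc (a n) (b n))
    rw [IntegrableOn, spaceTime_restrict (ha n).1.1 (hb n).1.2] at h
    rw [spaceTime_restrict (ha n).1.1 (hb n).1.2, integral_prod _ h]
    simp only [intervalIntegral.integral_of_le hT, intervalIntegral.integral_of_le (hab n)]
  simp only [heq] at hlim'
  have := tendsto_nhds_unique hlim hlim'
  linarith

/-! ### Averages over the clusters -/

theorem integral_mul_freeVel_eq {t : ℝ} {h : ℝ → ℝ} (hh : Measurable h) {C : ℝ}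
    (hC : ∀ x, |h x| ≤ C) :
    ∫ m in Ioo 0 D.L, h (D.pos t m) * D.freeVel t m =
      ∫ m in Ioo 0 D.L, h (D.pos t m) * D.vel t m := by
  have hm : AEStronglyMeasurable (fun m => h (D.pos t m)) (volume.restrict (Ioo 0 D.L)) :=
    (hh.comp (measurable_pos_right t)).aestronglyMeasurable
  have i1 := Integrable.bdd_mul (c := C) (integrableOn_freeVel (D := D) t) hm
    (Eventually.of_forall fun m => hC _)
  have i2 := Integrable.bdd_mul (c := C) (integrableOn_vel (D := D) t) hm
    (Eventually.of_forall fun m => hC _)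
  have hz := setIntegral_mul_sub_eq_zero (D := D) (t := t) (k := h) MeasurableSet.univ (by
    simp only [preimage_univ, inter_univ, mul_sub]
    exact i1.sub i2)
  simp only [preimage_univ, inter_univ, mul_sub] at hz
  rw [integral_sub i1 i2] at hz
  linarith

variable (D) in
/-- The field at `x`, by the average rule in the mass coordinate. -/
def midMass (x t : ℝ) : ℝ := (D.lower x t + D.upper x t) / 2

theorem abs_midMass_le (x t : ℝ) : |D.midMass x t| ≤ D.L := by
  have h1 := D.lower_nonneg x t
  have h2 := D.lower_le_upper x t
  have h3 := D.upper_le x t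
  rw [midMass, abs_le]
  constructor <;> linarith

theorem integrableOn_of_bound {f : ℝ → ℝ} {L C : ℝ} (hf : Measurable f)
    (hC : ∀ m ∈ Ioo 0 L, |f m| ≤ C) : IntegrableOn f (Ioo 0 L) := by
  refine Integrable.of_bound (C := C) hf.aestronglyMeasurable ?_
  filter_upwards [ae_restrict_mem measurableSet_Ioo] with m hm using hC m hm

theorem measurable_midMass_pos (t : ℝ) : Measurable fun m => D.midMass (D.pos t m) t := by
  have h : Measurable fun m => (D.pos t m, t) := (measurable_pos_right t).prodMk measurable_const
  have h1 := D.measurable_lower.comp h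
  have h2 := D.measurable_upper.comp h
  exact (h1.add h2).div_const 2

/-- The mean of the mass coordinate over a cluster is the midpoint of its mass interval. -/
theorem integral_mul_id_eq {t : ℝ} {h : ℝ → ℝ} (hh : Measurable h) {C : ℝ}
    (hC : ∀ x, |h x| ≤ C) :
    ∫ m in Ioo 0 D.L, h (D.pos t m) * m = ∫ m in Ioo 0 D.L, h (D.pos t m) * D.midMass (D.pos t m) t := by
  have hm : AEStronglyMeasurable (fun m => h (D.pos t m)) (volume.restrict (Ioo 0 D.L)) :=
    (hh.comp (measurable_pos_right t)).aestronglyMeasurable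
  have i1 := Integrable.bdd_mul (c := C) (integrableOn_of_bound (L := D.L) measurable_id
    (C := D.L) fun m hm => by rw [id, abs_of_pos hm.1]; exact hm.2.le) hm
    (Eventually.of_forall fun m => hC _)
  have i2 := Integrable.bdd_mul (c := C) (integrableOn_of_bound (L := D.L)
    (measurable_midMass_pos (D := D) t) fun m _ => abs_midMass_le _ t) hm
    (Eventually.of_forall fun m => hC _)
  simp only [id] at i1
  have hz := setIntegral_mul_eq_zero_of_clusters (D := D) (t := t) (k := h)
    (d := fun m => m - D.midMass (D.pos t m) t) MeasurableSet.univ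
    (fun m hm heq => by
      have e1 := lower_pos_le (t := t) hm
      have e2 := le_upper_pos (t := t) hm
      rw [midMass]; linarith)
    (fun x hx => by
      have := integral_vel_of_subset (D := D) (t := t) (x := x) hx.le le_rfl le_rfl
        (fun x m => m - D.midMass x t)
      rw [this, intervalIntegral.integral_sub intervalIntegral.intervalIntegrable_id
        intervalIntegrable_const, integral_id, intervalIntegral.integral_const, midMass,
        smul_eq_mul]
      ring)
    (by
      simp only [preimage_univ, inter_univ, mul_sub]
      exact i1.sub i2)
  simp only [preimage_univ, inter_univ, mul_sub] at hz
  rw [integral_sub i1 i2] at hz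
  linarith

/-- The measures e dm and m dm have the same image under the position, since both images give (−∞,
x] the mass upper²/2; for e this is the middle condition of `contactSet`. The latter image is then
averaged. -/
theorem integral_mul_e_eq {t : ℝ} {h : ℝ → ℝ} (hh : Measurable h) {C : ℝ}
    (hC : ∀ x, |h x| ≤ C) :
    ∫ m in Ioo 0 D.L, h (D.pos t m) * D.e m =
      ∫ m in Ioo 0 D.L, h (D.pos t m) * D.midMass (D.pos t m) t := by
  rw [← integral_mul_id_eq hh hC]
  set μ : Measure ℝ := volume.restrict (Ioo 0 D.L) with hμ
  have hpm := measurable_pos_right (D := D) t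
  have key : ∀ f : ℝ → ℝ, Measurable f → (∀ m ∈ Ioo 0 D.L, 0 ≤ f m ∧ f m ≤ D.L) →
      IsFiniteMeasure (μ.withDensity fun m => ENNReal.ofReal (f m)) ∧
      (∀ x, (μ.withDensity fun m => ENNReal.ofReal (f m)).map (D.pos t) (Iic x) =
        ENNReal.ofReal (∫ m in 0..D.upper x t, f m)) ∧
      ∫ m, h (D.pos t m) * f m ∂μ =
        ∫ x, h x ∂((μ.withDensity fun m => ENNReal.ofReal (f m)).map (D.pos t)) := by
    intro f hf hfb
    have hfi : IntegrableOn f (Ioo 0 D.L) := integrableOn_of_bound (C := D.L) hf fun m hm => by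
      rw [abs_of_nonneg (hfb m hm).1]; exact (hfb m hm).2
    refine ⟨?_, fun x => ?_, ?_⟩
    · exact isFiniteMeasure_withDensity_ofReal hfi.2
    · have hms : MeasurableSet (D.pos t ⁻¹' Iic x) := hpm measurableSet_Iic
      rw [Measure.map_apply hpm measurableSet_Iic, withDensity_apply _ hms, hμ,
        Measure.restrict_restrict hms, inter_comm,
        ← ofReal_integral_eq_lintegral_ofReal (hfi.mono_set inter_subset_left),
        setIntegral_congr_set (D.preimage_Iic_ae_eq x t),
        ← intervalIntegral.integral_of_le (upper_mem_Icc x t).1]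
      filter_upwards [ae_restrict_mem (measurableSet_Ioo.inter hms)] with m hm
        using (hfb m hm.1).1
    · rw [integral_map hpm.aemeasurable hh.aestronglyMeasurable,
        integral_withDensity_eq_integral_toReal_smul (by fun_prop)
          (Eventually.of_forall fun m => ENNReal.ofReal_lt_top)]
      refine integral_congr_ae ?_
      filter_upwards [ae_restrict_mem measurableSet_Ioo] with m hm
      rw [ENNReal.toReal_ofReal (hfb m hm).1, smul_eq_mul, mul_comm]
  obtain ⟨f1, x1, e1⟩ := key D.e D.measurable_e fun m _ => ⟨D.e_nonneg m, D.e_le m⟩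
  obtain ⟨f2, x2, e2⟩ := key (fun m => m) measurable_id fun m hm => ⟨hm.1.le, hm.2.le⟩
  rw [e1, e2]
  congr 1
  refine Measure.ext_of_Iic _ _ fun x => ?_
  rw [x1, x2, (D.upper_mem x t).2.1, integral_id]
  simp

end MassFlow

/-! ### Compactly supported smooth test functions. -/

theorem exists_abs_le_of_hasCompactSupport {f : ℝ × ℝ → ℝ} (hf : Continuous f)
    (hs : HasCompactSupport f) : ∃ C, ∀ p, |f p| ≤ C :=
  hs.exists_bound_of_continuous hf

theorem hasCompactSupport_dt {φ : ℝ × ℝ → ℝ} (hs : HasCompactSupport φ) :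
    HasCompactSupport (dt φ) :=
  (hs.fderiv ℝ).comp_left (g := fun A : ℝ × ℝ →L[ℝ] ℝ => A (0, 1)) rfl

theorem hasCompactSupport_dx {φ : ℝ × ℝ → ℝ} (hs : HasCompactSupport φ) :
    HasCompactSupport (dx φ) :=
  (hs.fderiv ℝ).comp_left (g := fun A : ℝ × ℝ →L[ℝ] ℝ => A (1, 0)) rfl

theorem exists_boundedTest {φ : ℝ × ℝ → ℝ} (hφ : ContDiff ℝ ∞ φ) (hs : HasCompactSupport φ) :
    ∃ K, BoundedTest φ K := by
  have h1 : ContDiff ℝ 1 φ := hφ.of_le (by exact_mod_cast le_top)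
  have hc := h1.continuous_fderiv one_ne_zero
  have ht : Continuous (dt φ) := hc.clm_apply continuous_const
  have hx : Continuous (dx φ) := hc.clm_apply continuous_const
  obtain ⟨A, hA⟩ := exists_abs_le_of_hasCompactSupport h1.continuous hs
  obtain ⟨B, hB⟩ := exists_abs_le_of_hasCompactSupport ht (hasCompactSupport_dt hs)
  obtain ⟨C, hC⟩ := exists_abs_le_of_hasCompactSupport hx (hasCompactSupport_dx hs)
  exact ⟨max A (max B C), h1, fun p => (hA p).trans (le_max_left _ _),
    fun p => (hB p).trans ((le_max_left _ _).trans (le_max_right _ _)),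
    fun p => (hC p).trans ((le_max_right _ _).trans (le_max_right _ _))⟩

/-- The decay is matched to the weight in `integrable_energy`. -/
theorem BoundedTest.exists_decay {φ : ℝ × ℝ → ℝ} {K : ℝ} (hφ : BoundedTest φ K)
    (hs : HasCompactSupport φ) : ∃ K', ∀ p, |dx φ p| ≤ K' / (1 + p.1 ^ 2) := by
  have hc : Continuous fun p : ℝ × ℝ => (1 + p.1 ^ 2) * dx φ p :=
    (by fun_prop : Continuous fun p : ℝ × ℝ => 1 + p.1 ^ 2).mul hφ.continuous_dx
  obtain ⟨C, hC⟩ := exists_abs_le_of_hasCompactSupport hc (hasCompactSupport_dx hs).mul_left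
  refine ⟨C, fun p => ?_⟩
  have := hC p
  rw [abs_mul, abs_of_pos (show 0 < 1 + p.1 ^ 2 by positivity)] at this
  rw [le_div_iff₀ (by positivity), mul_comm]
  exact this

theorem deriv_time {φ : ℝ × ℝ → ℝ} (hφ : ContDiff ℝ 1 φ) (x t : ℝ) :
    deriv (fun τ => φ (x, τ)) t = dt φ (x, t) := by
  have h1 : HasDerivAt (fun τ : ℝ => (x, τ)) (0, 1) t :=
    (hasDerivAt_const t x).prodMk (hasDerivAt_id t)
  have h2 := HasFDerivAt.comp_hasDerivAt (f := fun τ : ℝ => (x, τ)) t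
    (hφ.differentiable one_ne_zero (x, t)).hasFDerivAt h1
  exact h2.deriv

theorem deriv_space {φ : ℝ × ℝ → ℝ} (hφ : ContDiff ℝ 1 φ) (x t : ℝ) :
    deriv (fun ξ => φ (ξ, t)) x = dx φ (x, t) := by
  have h1 : HasDerivAt (fun ξ : ℝ => (ξ, t)) (1, 0) x :=
    (hasDerivAt_id x).prodMk (hasDerivAt_const x t)
  have h2 := HasFDerivAt.comp_hasDerivAt (f := fun ξ : ℝ => (ξ, t)) x
    (hφ.differentiable one_ne_zero (x, t)).hasFDerivAt h1
  exact h2.deriv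

theorem exists_time_bound {φ : ℝ × ℝ → ℝ} (hs : HasCompactSupport φ) :
    ∃ T, 0 ≤ T ∧ ∀ p : ℝ × ℝ, T ≤ p.2 → φ p = 0 ∧ dt φ p = 0 ∧ dx φ p = 0 := by
  obtain ⟨R, hR⟩ := hs.isBounded.subset_closedBall 0
  refine ⟨|R| + 1, by positivity, fun p hp => ?_⟩
  have hn : p ∉ tsupport φ := by
    intro h
    have h1 := hR h
    rw [mem_closedBall_zero_iff] at h1
    have h2 : |p.2| ≤ ‖p‖ := norm_snd_le p
    linarith [le_abs_self p.2, le_abs_self R]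
  have hf : fderiv ℝ φ p = 0 := fderiv_of_notMem_tsupport ℝ hn
  exact ⟨image_eq_zero_of_notMem_tsupport hn, by simp [dt, hf], by simp [dx, hf]⟩

/-! ### The density as an image measure, distributional derivatives and the weak formulation. -/

namespace MassFlow

variable (D : MassFlow)

/-- The density: the image of the mass under the position. -/
def density : Kernel ℝ ℝ where
  toFun t := (volume.restrict (Ioo 0 D.L)).map (D.pos t)
  measurable' := by
    refine Measure.measurable_of_measurable_coe _ fun s hs => ?_
    have h : ∀ t, (volume.restrict (Ioo 0 D.L)).map (D.pos t) s =
        volume.restrict (Ioo 0 D.L) (Prod.mk t ⁻¹' ((fun p : ℝ × ℝ => D.pos p.1 p.2) ⁻¹' s)) :=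
      fun t => Measure.map_apply (measurable_pos_right t) hs
    simp only [h]
    exact measurable_measure_prodMk_left (D.measurable_pos hs)

theorem density_apply (t : ℝ) : D.density t = (volume.restrict (Ioo 0 D.L)).map (D.pos t) := rfl

variable {D}

instance (t : ℝ) : IsFiniteMeasure (D.density t) := by
  rw [density_apply]; infer_instance

theorem integral_density {f : ℝ → ℝ} (hf : Measurable f) (t : ℝ) :
    ∫ x, f x ∂(D.density t) = ∫ m in Ioo 0 D.L, f (D.pos t m) :=
  integral_map (measurable_pos_right t).aemeasurable hf.aestronglyMeasurable

/-- The half-lines (−∞, x) and (−∞, x] have masses `lower` and `upper`, so the average rule picks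
the midpoint of the cluster. -/
theorem field_density (x t : ℝ) : field (D.density t) x = D.midMass x t := by
  have h1 : (D.density t).real (Iio x) = D.lower x t := by
    have hm := measurable_pos_right (D := D) t (measurableSet_Iio (a := x))
    rw [Measure.real, density_apply, Measure.map_apply (measurable_pos_right t) measurableSet_Iio,
      Measure.restrict_apply hm, inter_comm, measure_congr (D.preimage_Iio_ae_eq x t),
      Real.volume_Ioc, sub_zero, ENNReal.toReal_ofReal (D.lower_nonneg x t)]
  have h2 : (D.density t).real (Iic x) = D.upper x t := by
    have hm := measurable_pos_right (D := D) t (measurableSet_Iic (a := x))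
    rw [Measure.real, density_apply, Measure.map_apply (measurable_pos_right t) measurableSet_Iic,
      Measure.restrict_apply hm, inter_comm, measure_congr (D.preimage_Iic_ae_eq x t),
      Real.volume_Ioc, sub_zero, ENNReal.toReal_ofReal (upper_mem_Icc x t).1]
  rw [field, h1, h2, midMass]

theorem ae_lower_eq_upper (t : ℝ) : ∀ᵐ x, D.lower x t = D.upper x t := by
  have h : ∀ᵐ x, x ∉ {x | D.lower x t < D.upper x t} := (D.countable_clusters t).ae_notMem volume
  filter_upwards [h] with x hx
  exact (D.lower_le_upper x t).antisymm (not_lt.1 hx)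

/-- Almost everywhere f + c is the integral of q over the particles at or to the left of x. Fubini
and ∫ φ' over (pos, ∞) = −φ(pos) turn the pairing with φ' into −∫ φ(pos) q, and `hqg` replaces q by
a function of the position. -/
theorem hasDistribDeriv_of_ae {f g q : ℝ → ℝ} {t c : ℝ} (hq : Measurable q)
    (hqi : IntegrableOn q (Ioo 0 D.L))
    (hf : ∀ᵐ x, f x = (∫ m in 0..D.upper x t, q m) - c) (hg : Measurable g)
    (hgi : IntegrableOn (fun m => g (D.pos t m)) (Ioo 0 D.L))
    (hqg : ∀ h : ℝ → ℝ, Measurable h → ∀ C, (∀ x, |h x| ≤ C) →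
      ∫ m in Ioo 0 D.L, h (D.pos t m) * q m = ∫ m in Ioo 0 D.L, h (D.pos t m) * g (D.pos t m)) :
    HasDistribDeriv f (D.density t) g := by
  have hpm := measurable_pos_right (D := D) t
  have hset : MeasurableSet {p : ℝ × ℝ | D.pos t p.2 ≤ p.1} :=
    measurableSet_le (hpm.comp measurable_snd) measurable_fst
  have hind : Measurable fun p : ℝ × ℝ =>
      {p : ℝ × ℝ | D.pos t p.2 ≤ p.1}.indicator (fun p => q p.2) p :=
    (hq.comp measurable_snd).indicator hset
  set G : ℝ → ℝ := fun x => ∫ m in Ioo 0 D.L,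
    {p : ℝ × ℝ | D.pos t p.2 ≤ p.1}.indicator (fun p => q p.2) (x, m) with hG
  have hGeq : ∀ x, G x = ∫ m in 0..D.upper x t, q m := by
    intro x
    have h1 : ∀ m, {p : ℝ × ℝ | D.pos t p.2 ≤ p.1}.indicator (fun p => q p.2) (x, m) =
        (D.pos t ⁻¹' Iic x).indicator q m := by
      intro m
      by_cases h : D.pos t m ≤ x <;> simp [indicator, h]
    have hms := hpm (measurableSet_Iic (a := x))
    simp only [hG, h1]
    rw [integral_indicator hms, Measure.restrict_restrict hms, inter_comm,
      setIntegral_congr_set (D.preimage_Iic_ae_eq x t),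
      ← intervalIntegral.integral_of_le (upper_mem_Icc x t).1]
  have hGm : Measurable G := (hind.stronglyMeasurable.integral_prod_right').measurable
  have hGb : ∀ x, |G x| ≤ ∫ m in Ioo 0 D.L, |q m| := by
    intro x
    exact norm_integral_le_of_norm_le (μ := volume.restrict (Ioo 0 D.L))
      (f := fun m => {p : ℝ × ℝ | D.pos t p.2 ≤ p.1}.indicator (fun p => q p.2) (x, m)) hqi.norm
      (Eventually.of_forall fun m => norm_indicator_le_norm_self (fun p : ℝ × ℝ => q p.2) (x, m))
  have hfG : f =ᵐ[volume] fun x => G x - c := by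
    filter_upwards [hf] with x hx
    rw [hx, hGeq]
  have hGl : LocallyIntegrable (fun x => G x - c) volume := by
    refine (locallyIntegrable_const (((∫ m in Ioo 0 D.L, |q m|) + |c|))).mono
      (hGm.sub_const c).aestronglyMeasurable (Eventually.of_forall fun x => ?_)
    refine (abs_sub _ _).trans ((add_le_add (hGb x) le_rfl).trans (le_abs_self _))
  refine ⟨hGl.congr hfG.symm, ?_, fun φ hφ hs => ?_⟩
  · refine Integrable.locallyIntegrable ?_
    rw [density_apply]
    exact (integrable_map_measure hg.aestronglyMeasurable hpm.aemeasurable).2 hgi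
  · have hφ1 : ContDiff ℝ 1 φ := hφ.of_le (by exact_mod_cast le_top)
    have hd : Continuous (deriv φ) := hφ1.continuous_deriv_one
    have hdi : Integrable (deriv φ) volume := hd.integrable_of_hasCompactSupport hs.deriv
    have hint0 : ∫ x, deriv φ x = 0 := by
      have h1 := hs.integral_Iic_deriv_eq hφ1 0
      have h2 := hs.integral_Ioi_deriv_eq hφ1 0
      rw [← integral_add_compl (measurableSet_Iic (a := (0 : ℝ))) hdi, compl_Iic, h1, h2]
      ring
    have hprod : Integrable (fun p : ℝ × ℝ => {p : ℝ × ℝ | D.pos t p.2 ≤ p.1}.indicator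
        (fun p => q p.2) p * deriv φ p.1) (volume.prod (volume.restrict (Ioo 0 D.L))) := by
      refine (hdi.mul_prod hqi).mono (hind.mul (hd.measurable.comp
        measurable_fst)).aestronglyMeasurable (Eventually.of_forall fun p => ?_)
      rw [norm_mul, norm_mul, mul_comm]
      gcongr
      exact norm_indicator_le_norm_self _ _
    have hGd : Integrable (fun x => G x * deriv φ x) volume :=
      hdi.bdd_mul hGm.aestronglyMeasurable (Eventually.of_forall hGb)
    have h1 : ∫ x, f x * deriv φ x = ∫ x, G x * deriv φ x := by
      have : ∫ x, f x * deriv φ x = ∫ x, (G x * deriv φ x - c * deriv φ x) := by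
        refine integral_congr_ae ?_
        filter_upwards [hfG] with x hx
        rw [hx]; ring
      rw [this, integral_sub hGd (hdi.const_mul c), integral_const_mul, hint0]
      ring
    have h2 : ∫ x, G x * deriv φ x = ∫ m in Ioo 0 D.L, -(φ (D.pos t m) * q m) := by
      have e1 : ∀ x, G x * deriv φ x = ∫ m in Ioo 0 D.L, {p : ℝ × ℝ | D.pos t p.2 ≤ p.1}.indicator
          (fun p => q p.2) (x, m) * deriv φ x := fun x => (integral_mul_const _ _).symm
      simp only [e1]
      rw [integral_integral_swap (f := fun x m => {p : ℝ × ℝ | D.pos t p.2 ≤ p.1}.indicator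
          (fun p => q p.2) (x, m) * deriv φ x) hprod]
      refine integral_congr_ae (Eventually.of_forall fun m => ?_)
      have e2 : ∀ x, {p : ℝ × ℝ | D.pos t p.2 ≤ p.1}.indicator (fun p => q p.2) (x, m) * deriv φ x =
          (Ici (D.pos t m)).indicator (fun x => q m * deriv φ x) x := by
        intro x
        by_cases h : D.pos t m ≤ x <;> simp [indicator, h]
      simp only [e2]
      rw [integral_indicator measurableSet_Ici, integral_Ici_eq_integral_Ioi, integral_const_mul,
        hs.integral_Ioi_deriv_eq hφ1]
      ring
    obtain ⟨C, hC⟩ := hs.exists_bound_of_continuous hφ1.continuous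
    rw [h1, h2, integral_neg, hqg φ hφ1.continuous.measurable C hC,
      integral_density (f := fun x => φ x * g x) (hφ1.continuous.measurable.mul hg)]

theorem measurable_velocity_right (t : ℝ) : Measurable fun x => D.velocity x t := by
  have h := D.measurable_velocity.comp (measurable_prodMk_right (y := t))
  exact h

/-- The derivative of the mass up to a contact slope is the density. -/
theorem hasDistribDeriv_mass {f : ℝ → ℝ} {t c : ℝ} (hf : ∀ x, ∃ m ∈ D.contact x t, f x = m - c) :
    HasDistribDeriv f (D.density t) (fun _ => 1) := by
  refine hasDistribDeriv_of_ae (q := fun _ => 1) (c := c) measurable_const (by simp) ?_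
    measurable_const (by simp) (fun h _ C _ => rfl)
  -- Off the countable set of clusters the contact slope is unique, so any choice of it equals
  -- `upper`.
  filter_upwards [ae_lower_eq_upper t] with x hx
  obtain ⟨m, hm, hfx⟩ := hf x
  have e1 := le_upper hm
  have e2 := lower_le hm
  rw [hfx, intervalIntegral.integral_const, smul_eq_mul, mul_one, sub_zero]
  linarith

/-- The derivative of the momentum up to a contact slope is the momentum density. -/
theorem hasDistribDeriv_momentum {f : ℝ → ℝ} {t c : ℝ}
    (hf : ∀ x, ∃ m ∈ D.contact x t, f x = D.freeMom t m - c) :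
    HasDistribDeriv f (D.density t) (fun x => D.velocity x t) := by
  have hm1 : Measurable (D.freeVel t) := by
    have h := D.measurable_freeVel.comp (measurable_prodMk_left (x := t))
    exact h
  refine hasDistribDeriv_of_ae (q := D.freeVel t) (c := c) hm1 (integrableOn_freeVel t) ?_
    (measurable_velocity_right t) (integrableOn_vel t)
    (fun h hh C hC => integral_mul_freeVel_eq hh hC)
  filter_upwards [ae_lower_eq_upper t] with x hx
  obtain ⟨m, hm, hfx⟩ := hf x
  have e1 := le_upper hm
  have e2 := lower_le hm
  have : m = D.upper x t := by linarith
  rw [hfx, this, freeMom]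

/-- On [−R, R] the weight 1/(1 + x²) is at least 1/(1 + R²), so `integrable_energy` suffices. -/
theorem energy_lt_top (T R : ℝ) :
    ∫⁻ t in Icc 0 T, ∫⁻ x in Icc (-R) R, ENNReal.ofReal (D.velocity x t ^ 2) ∂(D.density t) < ⊤ := by
  rcases lt_or_ge T 0 with hT | hT
  · simp [Icc_eq_empty (not_le.2 hT)]
  have hE := (integrable_energy (D := D) hT).const_mul (1 + R ^ 2)
  have hEm : Measurable fun p : ℝ × ℝ => ENNReal.ofReal ((1 + R ^ 2) *
      (D.vel p.1 p.2 ^ 2 / (1 + D.pos p.1 p.2 ^ 2))) :=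
    (((D.measurable_vel.pow_const 2).div
      ((D.measurable_pos.pow_const 2).const_add 1)).const_mul _).ennreal_ofReal
  rw [← Measure.restrict_congr_set Ioc_ae_eq_Icc]
  refine lt_of_le_of_lt (lintegral_mono fun t => ?_) ((lintegral_prod _ hEm.aemeasurable).symm.trans_lt
    (hE.lintegral_lt_top))
  have hu : Measurable fun x => ENNReal.ofReal (D.velocity x t ^ 2) :=
    ((measurable_velocity_right t).pow_const 2).ennreal_ofReal
  have hpm := measurable_pos_right (D := D) t
  rw [density_apply, setLIntegral_map measurableSet_Icc hu hpm]
  calc _ ≤ ∫⁻ m in D.pos t ⁻¹' Icc (-R) R, ENNReal.ofReal ((1 + R ^ 2) *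
        (D.vel t m ^ 2 / (1 + D.pos t m ^ 2))) ∂(volume.restrict (Ioo 0 D.L)) := by
        refine setLIntegral_mono' (hpm measurableSet_Icc) fun m hm => ?_
        refine ENNReal.ofReal_le_ofReal ?_
        have h1 : D.pos t m ^ 2 ≤ R ^ 2 := by
          have := hm.1
          have := hm.2
          nlinarith
        change D.vel t m ^ 2 ≤ _
        rw [mul_div_assoc', le_div_iff₀ (by positivity), mul_comm (1 + R ^ 2)]
        gcongr
    _ ≤ _ := setLIntegral_le_lintegral _ _

theorem integral_Ioi_eq {F : ℝ → ℝ} {T : ℝ} (hF : ∀ t, T < t → F t = 0) :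
    ∫ t in Ioi (0 : ℝ), F t = ∫ t in Ioc 0 T, F t := by
  refine setIntegral_eq_of_subset_of_forall_sdiff_eq_zero measurableSet_Ioi
    (fun t ht => ht.1) fun t ht => hF t ?_
  by_contra! h
  exact ht.2 ⟨ht.1, h⟩

theorem weak_mass {φ : ℝ × ℝ → ℝ} (hφ : ContDiff ℝ ∞ φ) (hs : HasCompactSupport φ) :
    (∫ t in Ioi (0 : ℝ), ∫ x, (deriv (fun τ => φ (x, τ)) t +
        D.velocity x t * deriv (fun ξ => φ (ξ, t)) x) ∂(D.density t)) +
      ∫ m in Ioo 0 D.L, φ (D.pos 0 m, 0) = 0 := by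
  obtain ⟨K, hK⟩ := exists_boundedTest hφ hs
  obtain ⟨T, hT, hTz⟩ := exists_time_bound hs
  simp only [deriv_time hK.contDiff, deriv_space hK.contDiff]
  have h1 : ∀ t, ∫ x, (dt φ (x, t) + D.velocity x t * dx φ (x, t)) ∂(D.density t) =
      ∫ m in Ioo 0 D.L, D.transport φ t m := by
    intro t
    rw [integral_density (f := fun x => dt φ (x, t) + D.velocity x t * dx φ (x, t))
      ((hK.continuous_dt.measurable.comp measurable_prodMk_right).add
      ((measurable_velocity_right t).mul (hK.continuous_dx.measurable.comp
        measurable_prodMk_right)))]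
    refine integral_congr_ae (Eventually.of_forall fun m => ?_)
    simp only [transport, vel]
    ring
  simp only [h1]
  -- T lies beyond the support of φ in time, so the final term of the balance is zero and only the
  -- initial one survives.
  rw [integral_Ioi_eq (T := T), ← intervalIntegral.integral_of_le hT, integral_mass hK hT]
  · have : ∀ m, φ (D.pos T m, T) = 0 := fun m => (hTz (D.pos T m, T) le_rfl).1
    simp [this]
  · intro t ht
    have : ∀ m, D.transport φ t m = 0 := fun m => by
      have := hTz (D.pos t m, t) ht.le
      rw [transport, this.2.1, this.2.2]; ring
    simp [this]

theorem weak_momentum {φ : ℝ × ℝ → ℝ} (hφ : ContDiff ℝ ∞ φ) (hs : HasCompactSupport φ) :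
    (∫ t in Ioi (0 : ℝ), ∫ x, (D.velocity x t * deriv (fun τ => φ (x, τ)) t +
        D.velocity x t ^ 2 * deriv (fun ξ => φ (ξ, t)) x +
          D.κ * field (D.density t) x * φ (x, t)) ∂(D.density t)) +
      ∫ m in Ioo 0 D.L, φ (D.pos 0 m, 0) * D.v m = 0 := by
  obtain ⟨K, hK⟩ := exists_boundedTest hφ hs
  obtain ⟨T, hT, hTz⟩ := exists_time_bound hs
  obtain ⟨K', hK'⟩ := hK.exists_decay hs
  simp only [deriv_time hK.contDiff, deriv_space hK.contDiff, field_density]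
  have hmid : ∀ t, Measurable fun x => D.midMass x t := by
    intro t
    have h1 := D.measurable_lower.comp (measurable_prodMk_right (y := t))
    have h2 := D.measurable_upper.comp (measurable_prodMk_right (y := t))
    exact (h1.add h2).div_const 2
  have hφt : ∀ t, Measurable fun x => φ (x, t) := fun t =>
    hK.contDiff.continuous.measurable.comp measurable_prodMk_right
  have h1 : ∀ t, ∫ x, (D.velocity x t * dt φ (x, t) + D.velocity x t ^ 2 * dx φ (x, t) +
      D.κ * D.midMass x t * φ (x, t)) ∂(D.density t) =
      ∫ m in Ioo 0 D.L, (D.transport φ t m * D.vel t m +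
        D.κ * (φ (D.pos t m, t) * D.midMass (D.pos t m) t)) := by
    intro t
    have hv := measurable_velocity_right (D := D) t
    rw [integral_density (f := fun x => D.velocity x t * dt φ (x, t) +
      D.velocity x t ^ 2 * dx φ (x, t) + D.κ * D.midMass x t * φ (x, t)) (((hv.mul (hK.continuous_dt.measurable.comp measurable_prodMk_right)).add
      ((hv.pow_const 2).mul (hK.continuous_dx.measurable.comp measurable_prodMk_right))).add
      (((hmid t).const_mul _).mul (hφt t)))]
    refine integral_congr_ae (Eventually.of_forall fun m => ?_)
    simp only [transport, vel]
    ring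
  simp only [h1]
  have i1 := integrable_transport_mul_vel (D := D) hK hK' hT
  have i2 := integrable_force (D := D) hK (D.spaceTime T)
  have hbal := integral_momentum (D := D) hK hK' hT
  rw [integral_prod _ i1, integral_prod _ i2, ← integral_add i1.integral_prod_left
    i2.integral_prod_left] at hbal
  rw [integral_Ioi_eq (T := T)]
  · have h2 : ∫ t in Ioc 0 T, ∫ m in Ioo 0 D.L, (D.transport φ t m * D.vel t m +
        D.κ * (φ (D.pos t m, t) * D.midMass (D.pos t m) t)) =
        ∫ t in Ioc 0 T, ((∫ m in Ioo 0 D.L, D.transport φ t m * D.vel t m) +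
          ∫ m in Ioo 0 D.L, D.κ * D.e m * φ (D.pos t m, t)) := by
      refine integral_congr_ae ?_
      filter_upwards [i1.prod_right_ae] with t ht
      have i3 : IntegrableOn (fun m => φ (D.pos t m, t) * D.midMass (D.pos t m) t) (Ioo 0 D.L) := by
        refine integrableOn_of_bound (C := K * D.L)
          (((hφt t).comp (measurable_pos_right t)).mul (measurable_midMass_pos t)) fun m _ => ?_
        rw [abs_mul]
        have := hK.nonneg
        gcongr
        · exact hK.abs_le _
        · exact abs_midMass_le _ _
      -- The field of the density is exchanged for e, the force carried by the particle, at almost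
      -- every time.
      rw [integral_add ht (i3.const_mul _), integral_const_mul,
        ← integral_mul_e_eq (hφt t) (fun x => hK.abs_le (x, t)), ← integral_const_mul]
      congr 2
      ext m
      ring
    rw [h2, hbal]
    have : ∀ m, D.momChange φ T m = -(φ (D.pos 0 m, 0) * D.v m) := fun m => by
      rw [momChange, (hTz (D.pos T m, T) le_rfl).1, freeVel, freeVel]
      ring
    simp only [this, integral_neg]
    ring
  · intro t ht
    have h0 : ∀ m, D.transport φ t m * D.vel t m +
        D.κ * (φ (D.pos t m, t) * D.midMass (D.pos t m) t) = 0 := fun m => by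
      have := hTz (D.pos t m, t) ht.le
      rw [transport, this.1, this.2.1, this.2.2]; ring
    simp [h0]

theorem isWeakSolution {ρ₀ : Measure ℝ} {u₀ : ℝ → ℝ} (hu₀ : Measurable u₀)
    (hρ₀ : D.density 0 = ρ₀) (hv : ∀ m ∈ Ioo 0 D.L, D.v m = u₀ (D.pos 0 m)) :
    IsWeakSolution D.κ ρ₀ u₀ D.density D.velocity where
  finite _ _ := inferInstance
  measurable := D.measurable_velocity
  mass_lt_top T := by
    have h : ∀ t, D.density t univ = ENNReal.ofReal D.L := fun t => by
      rw [density_apply, Measure.map_apply (measurable_pos_right t) MeasurableSet.univ]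
      simp
    simp only [h, lintegral_const, Measure.restrict_apply_univ, Real.volume_Icc]
    exact ENNReal.mul_lt_top ENNReal.ofReal_lt_top ENNReal.ofReal_lt_top
  energy_lt_top T R := energy_lt_top T R
  mass_eq φ hφ hs := by
    rw [← hρ₀, integral_density (f := fun x => φ (x, 0))
      (hφ.continuous.measurable.comp measurable_prodMk_right)]
    exact weak_mass hφ hs
  momentum_eq φ hφ hs := by
    rw [← hρ₀, integral_density (f := fun x => φ (x, 0) * u₀ x)
      ((hφ.continuous.measurable.comp measurable_prodMk_right).mul hu₀)]
    have : ∫ m in Ioo 0 D.L, φ (D.pos 0 m, 0) * u₀ (D.pos 0 m) =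
        ∫ m in Ioo 0 D.L, φ (D.pos 0 m, 0) * D.v m :=
      setIntegral_congr_fun measurableSet_Ioo fun m hm => by simp only [hv m hm]
    rw [this]
    exact weak_momentum hφ hs

end MassFlow

/-! ### Oriented integrals: one-sided limits and additivity. -/

section Primitive

variable {μ : Measure ℝ} {f : ℝ → ℝ}

theorem tendsto_setIntegral_Iic_left (hf : Integrable f μ) (y : ℝ) :
    Tendsto (fun z => ∫ s in Iic z, f s ∂μ) (𝓝[<] y) (𝓝 (∫ s in Iio y, f s ∂μ)) := by
  simp only [← integral_indicator measurableSet_Iic, ← integral_indicator measurableSet_Iio]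
  refine tendsto_integral_filter_of_dominated_convergence (fun s => ‖f s‖)
    (Eventually.of_forall fun z => hf.aestronglyMeasurable.indicator measurableSet_Iic)
    (Eventually.of_forall fun z => Eventually.of_forall fun s => norm_indicator_le_norm_self _ _)
    hf.norm (Eventually.of_forall fun s => tendsto_const_nhds.congr' ?_)
  rcases lt_or_ge s y with h | h
  · filter_upwards [Ioo_mem_nhdsLT h] with z hz
    rw [indicator_of_mem (mem_Iio.2 h), indicator_of_mem (mem_Iic.2 hz.1.le)]
  · filter_upwards [self_mem_nhdsWithin] with z hz
    rw [indicator_of_notMem (notMem_Iio.2 h), indicator_of_notMem (notMem_Iic.2 (lt_of_lt_of_le hz h))]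

theorem tendsto_setIntegral_Iic_right (hf : Integrable f μ) (y : ℝ) :
    Tendsto (fun z => ∫ s in Iic z, f s ∂μ) (𝓝[≥] y) (𝓝 (∫ s in Iic y, f s ∂μ)) := by
  simp only [← integral_indicator measurableSet_Iic]
  refine tendsto_integral_filter_of_dominated_convergence (fun s => ‖f s‖)
    (Eventually.of_forall fun z => hf.aestronglyMeasurable.indicator measurableSet_Iic)
    (Eventually.of_forall fun z => Eventually.of_forall fun s => norm_indicator_le_norm_self _ _)
    hf.norm (Eventually.of_forall fun s => tendsto_const_nhds.congr' ?_)
  rcases lt_or_ge y s with h | h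
  · filter_upwards [Ico_mem_nhdsGE h] with z hz
    rw [indicator_of_notMem (notMem_Iic.2 h), indicator_of_notMem (notMem_Iic.2 hz.2)]
  · filter_upwards [self_mem_nhdsWithin] with z hz
    rw [indicator_of_mem (mem_Iic.2 h), indicator_of_mem (mem_Iic.2 (h.trans hz))]

theorem tendsto_setIntegral_Iic_atTop (hf : Integrable f μ) :
    Tendsto (fun z => ∫ s in Iic z, f s ∂μ) atTop (𝓝 (∫ s, f s ∂μ)) := by
  simp only [← integral_indicator measurableSet_Iic]
  refine tendsto_integral_filter_of_dominated_convergence (fun s => ‖f s‖)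
    (Eventually.of_forall fun z => hf.aestronglyMeasurable.indicator measurableSet_Iic)
    (Eventually.of_forall fun z => Eventually.of_forall fun s => norm_indicator_le_norm_self _ _)
    hf.norm (Eventually.of_forall fun s => tendsto_const_nhds.congr' ?_)
  filter_upwards [eventually_ge_atTop s] with z hz
  rw [indicator_of_mem (mem_Iic.2 hz)]

theorem tendsto_setIntegral_Iic_atBot (hf : Integrable f μ) :
    Tendsto (fun z => ∫ s in Iic z, f s ∂μ) atBot (𝓝 0) := by
  rw [← integral_zero ℝ ℝ (μ := μ)]
  simp only [← integral_indicator measurableSet_Iic]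
  refine tendsto_integral_filter_of_dominated_convergence (fun s => ‖f s‖)
    (Eventually.of_forall fun z => hf.aestronglyMeasurable.indicator measurableSet_Iic)
    (Eventually.of_forall fun z => Eventually.of_forall fun s => norm_indicator_le_norm_self _ _)
    hf.norm (Eventually.of_forall fun s => tendsto_const_nhds.congr' ?_)
  filter_upwards [eventually_lt_atBot s] with z hz
  rw [indicator_of_notMem (notMem_Iic.2 hz)]

theorem setIntegral_diff_sub {A B : Set ℝ} (hA : MeasurableSet A) (hB : MeasurableSet B)
    (hf : Integrable f μ) :
    (∫ s in A \ B, f s ∂μ) - ∫ s in B \ A, f s ∂μ = (∫ s in A, f s ∂μ) - ∫ s in B, f s ∂μ := by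
  have h1 := integral_inter_add_sdiff (μ := μ) hB (hf.integrableOn (s := A))
  have h2 := integral_inter_add_sdiff (μ := μ) hA (hf.integrableOn (s := B))
  rw [inter_comm] at h2
  linarith

theorem measurableSet_coe_le (y : EReal) : MeasurableSet {s : ℝ | (s : EReal) ≤ y} :=
  measurable_coe_real_ereal measurableSet_Iic

theorem measurableSet_coe_lt (y : EReal) : MeasurableSet {s : ℝ | (s : EReal) < y} :=
  measurable_coe_real_ereal measurableSet_Iio

theorem integralRight_eq (hf : Integrable f μ) (y : EReal) :
    integralRight μ f y = (∫ s in {s : ℝ | (s : EReal) ≤ y}, f s ∂μ) - ∫ s in Iic 0, f s ∂μ := by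
  rw [← setIntegral_diff_sub (measurableSet_coe_le y) measurableSet_Iic hf, integralRight]
  congr 3 <;> ext s <;> simp [and_comm]

theorem integralLeft_eq (hf : Integrable f μ) (y : EReal) :
    integralLeft μ f y = (∫ s in {s : ℝ | (s : EReal) < y}, f s ∂μ) - ∫ s in Iic 0, f s ∂μ := by
  rw [← setIntegral_diff_sub (measurableSet_coe_lt y) measurableSet_Iic hf, integralLeft]
  congr 3 <;> ext s <;> simp [and_comm]

/-- The identity need not be integrable for ρ₀. For a bounded end point only a bounded window
matters, and there the formulas for integrable functions hold. -/
theorem integralRight_restrict {R y : ℝ} (hy : |y| ≤ R) :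
    integralRight (μ.restrict (Icc (-R) R)) f y = integralRight μ f y := by
  have h := abs_le.1 hy
  rw [integralRight, integralRight,
    Measure.restrict_restrict (by
      simp only [EReal.coe_le_coe_iff]; exact measurableSet_Ioc),
    Measure.restrict_restrict (by
      simp only [EReal.coe_lt_coe_iff]; exact measurableSet_Ioc)]
  congr 3 <;> refine inter_eq_left.2 fun s hs => ?_
  · have h1 := EReal.coe_le_coe_iff.1 hs.2
    have h2 := hs.1
    constructor <;> linarith
  · have h1 := EReal.coe_lt_coe_iff.1 hs.1
    have h2 := hs.2
    have := abs_nonneg y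
    constructor <;> linarith

theorem integralRight_eq_of_abs_le {R y : ℝ} (hf : IntegrableOn f (Icc (-R) R) μ) (hy : |y| ≤ R) :
    integralRight μ f y = (∫ s in Iic y, f s ∂(μ.restrict (Icc (-R) R))) -
      ∫ s in Iic 0, f s ∂(μ.restrict (Icc (-R) R)) := by
  rw [← integralRight_restrict hy, integralRight_eq hf]
  simp only [EReal.coe_le_coe_iff]
  rfl

theorem integralRight_sub_integralRight (hf : ∀ R, IntegrableOn f (Icc (-R) R) μ) {y z : ℝ}
    (hyz : y ≤ z) : integralRight μ f z - integralRight μ f y = ∫ s in Ioc y z, f s ∂μ := by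
  have hy : |y| ≤ max |y| |z| := le_max_left _ _
  have hz : |z| ≤ max |y| |z| := le_max_right _ _
  rw [integralRight_eq_of_abs_le (hf _) hy, integralRight_eq_of_abs_le (hf _) hz,
    sub_sub_sub_cancel_right, ← setIntegral_diff_sub measurableSet_Iic measurableSet_Iic (hf _),
    Iic_sdiff_Iic, Iic_sdiff_Iic, Ioc_eq_empty (not_lt.2 hyz), setIntegral_empty, sub_zero,
    Measure.restrict_restrict measurableSet_Ioc, inter_eq_left.2]
  intro s hs
  have h1 := abs_le.1 hy
  have h2 := abs_le.1 hz
  have := hs.1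
  have := hs.2
  constructor <;> linarith

theorem tendsto_integralRight_right (hf : ∀ R, IntegrableOn f (Icc (-R) R) μ) (y : ℝ) :
    Tendsto (fun z : ℝ => integralRight μ f z) (𝓝[≥] y) (𝓝 (integralRight μ f y)) := by
  rw [integralRight_eq_of_abs_le (hf (|y| + 1)) (by linarith)]
  refine ((tendsto_setIntegral_Iic_right (hf (|y| + 1)) y).sub_const _).congr' ?_
  have h : ∀ᶠ z in 𝓝 y, |z| < |y| + 1 := continuous_abs.continuousAt.eventually_lt_const (by linarith)
  filter_upwards [nhdsWithin_le_nhds h] with z hz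
  rw [integralRight_eq_of_abs_le (hf _) hz.le]

theorem tendsto_integralRight_left (hf : ∀ R, IntegrableOn f (Icc (-R) R) μ) (y : ℝ) :
    Tendsto (fun z : ℝ => integralRight μ f z) (𝓝[<] y)
      (𝓝 (integralRight μ f y - μ.real {y} * f y)) := by
  have hR : |y| < |y| + 1 := by linarith
  have hs : ∫ s in Iic y, f s ∂(μ.restrict (Icc (-(|y| + 1)) (|y| + 1))) =
      (∫ s in Iio y, f s ∂(μ.restrict (Icc (-(|y| + 1)) (|y| + 1)))) + μ.real {y} * f y := by
    have hi := hf (|y| + 1)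
    rw [← Iio_union_right, setIntegral_union (by simp) (measurableSet_singleton y)
      hi.integrableOn hi.integrableOn, integral_singleton]
    congr 2
    rw [Measure.real, Measure.restrict_apply (measurableSet_singleton y), inter_eq_left.2]
    · rfl
    · rintro _ rfl
      exact abs_le.1 hR.le
  rw [integralRight_eq_of_abs_le (hf (|y| + 1)) hR.le, hs, add_sub_right_comm, add_sub_cancel_right]
  refine ((tendsto_setIntegral_Iic_left (hf (|y| + 1)) y).sub_const _).congr' ?_
  have h : ∀ᶠ z in 𝓝 y, |z| < |y| + 1 := continuous_abs.continuousAt.eventually_lt_const hR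
  filter_upwards [nhdsWithin_le_nhds h] with z hz
  rw [integralRight_eq_of_abs_le (hf _) hz.le]

theorem integralRight_add {g : ℝ → ℝ} (hf : ∀ R, IntegrableOn f (Icc (-R) R) μ)
    (hg : ∀ R, IntegrableOn g (Icc (-R) R) μ) (y : ℝ) :
    integralRight μ (fun s => f s + g s) y = integralRight μ f y + integralRight μ g y := by
  simp only [integralRight_eq_of_abs_le (hf |y|) le_rfl, integralRight_eq_of_abs_le (hg |y|) le_rfl]
  rw [integralRight_eq_of_abs_le (f := fun s => f s + g s) ((hf |y|).add (hg |y|)) le_rfl,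
    integral_add (hf _).integrableOn (hg _).integrableOn,
    integral_add (hf _).integrableOn (hg _).integrableOn]
  ring

/-- The orientation at 0 matches the sign of s on both sides. No integrability is needed, as a
divergent Bochner integral has the value 0. -/
theorem integralRight_id_nonneg (μ : Measure ℝ) (y : EReal) : 0 ≤ integralRight μ (fun s => s) y := by
  have h1 : 0 ≤ ∫ s in {s : ℝ | 0 < s ∧ (s : EReal) ≤ y}, s ∂μ :=
    setIntegral_nonneg (measurableSet_Ioi.inter (measurableSet_coe_le y)) fun s hs => hs.1.le
  have h2 : ∫ s in {s : ℝ | y < (s : EReal) ∧ s ≤ 0}, s ∂μ ≤ 0 :=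
    setIntegral_nonpos ((measurable_coe_real_ereal measurableSet_Ioi).inter measurableSet_Iic)
      fun s hs => hs.2
  rw [integralRight]
  linarith

end Primitive

/-! ### The field of a finite measure and its primitive. -/

section Field

theorem field_nonneg (μ : Measure ℝ) (s : ℝ) : 0 ≤ field μ s :=
  div_nonneg (add_nonneg measureReal_nonneg measureReal_nonneg) zero_le_two

variable (μ : Measure ℝ) [IsFiniteMeasure μ]

theorem monotone_field : Monotone (field μ) := fun s s' h => by
  have h1 : μ.real (Iio s) ≤ μ.real (Iio s') := measureReal_mono (Iio_subset_Iio h)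
  have h2 : μ.real (Iic s) ≤ μ.real (Iic s') := measureReal_mono (Iic_subset_Iic.2 h)
  unfold field
  linarith

theorem field_le (s : ℝ) : field μ s ≤ μ.real univ := by
  have h1 : μ.real (Iio s) ≤ μ.real univ := measureReal_mono (subset_univ _)
  have h2 : μ.real (Iic s) ≤ μ.real univ := measureReal_mono (subset_univ _)
  unfold field
  linarith

theorem integrable_field (ν : Measure ℝ) [IsFiniteMeasure ν] : Integrable (field μ) ν :=
  Integrable.of_bound (monotone_field μ).measurable.aestronglyMeasurable (μ.real univ)
    (Eventually.of_forall fun s => by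
      rw [Real.norm_eq_abs, abs_of_nonneg (field_nonneg μ s)]; exact field_le μ s)

/-- The integrals of μ(−∞, s) and μ(−∞, s] are the product measures of {r < s} and of its complement
with the coordinates exchanged, and add up to μ(ℝ)². The average rule is what makes this exact in
the presence of atoms. -/
theorem integral_field : ∫ s, field μ s ∂μ = μ.real univ ^ 2 / 2 := by
  have hA : MeasurableSet {p : ℝ × ℝ | p.2 < p.1} := measurableSet_lt measurable_snd measurable_fst
  have h1 : (μ.prod μ) {p : ℝ × ℝ | p.2 < p.1} = ∫⁻ s, μ (Iio s) ∂μ := Measure.prod_apply hA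
  have h2 : (μ.prod μ) {p : ℝ × ℝ | p.2 < p.1}ᶜ = ∫⁻ s, μ (Iic s) ∂μ := by
    rw [Measure.prod_apply_symm hA.compl]
    congr! with s
    ext r
    simp
  have m1 : Measurable fun s => μ (Iio s) :=
    Monotone.measurable fun s s' h => measure_mono (Iio_subset_Iio h)
  have m2 : Measurable fun s => μ (Iic s) :=
    Monotone.measurable fun s s' h => measure_mono (Iic_subset_Iic.2 h)
  have i1 : Integrable (fun s => μ.real (Iio s)) μ :=
    Integrable.of_bound m1.ennreal_toReal.aestronglyMeasurable (μ.real univ)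
      (Eventually.of_forall fun s => by
        rw [Real.norm_eq_abs, abs_of_nonneg measureReal_nonneg]
        exact measureReal_mono (subset_univ _))
  have i2 : Integrable (fun s => μ.real (Iic s)) μ :=
    Integrable.of_bound m2.ennreal_toReal.aestronglyMeasurable (μ.real univ)
      (Eventually.of_forall fun s => by
        rw [Real.norm_eq_abs, abs_of_nonneg measureReal_nonneg]
        exact measureReal_mono (subset_univ _))
  have e1 : ∫ s, μ.real (Iio s) ∂μ = (μ.prod μ).real {p : ℝ × ℝ | p.2 < p.1} := by
    rw [Measure.real, h1]
    exact integral_toReal m1.aemeasurable (Eventually.of_forall fun s => measure_lt_top _ _)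
  have e2 : ∫ s, μ.real (Iic s) ∂μ = (μ.prod μ).real {p : ℝ × ℝ | p.2 < p.1}ᶜ := by
    rw [Measure.real, h2]
    exact integral_toReal m2.aemeasurable (Eventually.of_forall fun s => measure_lt_top _ _)
  unfold field
  rw [integral_div, integral_add i1 i2, e1, e2, measureReal_add_measureReal_compl hA,
    ← univ_prod_univ, measureReal_prod_prod, sq]

/-- For s ≤ y the field sees only the mass in (−∞, y], so this is `integral_field` for the
restricted measure. -/
theorem setIntegral_Iic_field (y : ℝ) :
    ∫ s in Iic y, field μ s ∂μ = μ.real (Iic y) ^ 2 / 2 := by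
  have h : ∀ s ∈ Iic y, field μ s = field (μ.restrict (Iic y)) s := by
    intro s hs
    have h1 : Iio s ∩ Iic y = Iio s := inter_eq_left.2 fun r hr =>
      mem_Iic.2 ((mem_Iio.1 hr).le.trans hs)
    have h2 : Iic s ∩ Iic y = Iic s := inter_eq_left.2 fun r hr =>
      mem_Iic.2 ((mem_Iic.1 hr).trans hs)
    simp only [field, Measure.real, Measure.restrict_apply measurableSet_Iio,
      Measure.restrict_apply measurableSet_Iic, h1, h2]
  rw [setIntegral_congr_fun measurableSet_Iic h, integral_field]
  simp

end Field

/-! ### Quantiles and functions in the mass coordinate. -/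

section Quantile

theorem setIntegral_one (μ : Measure ℝ) (s : Set ℝ) : ∫ _ in s, (1 : ℝ) ∂μ = μ.real s := by simp

variable (μ : Measure ℝ) [IsFiniteMeasure μ]

theorem monotone_real_Iic : Monotone fun y => μ.real (Iic y) :=
  fun _ _ h => measureReal_mono (Iic_subset_Iic.2 h)

theorem tendsto_real_Iic_left (y : ℝ) :
    Tendsto (fun z => μ.real (Iic z)) (𝓝[<] y) (𝓝 (μ.real (Iio y))) := by
  simpa only [setIntegral_one] using tendsto_setIntegral_Iic_left (μ := μ) (integrable_const (1 : ℝ)) y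

theorem tendsto_real_Iic_right (y : ℝ) :
    Tendsto (fun z => μ.real (Iic z)) (𝓝[≥] y) (𝓝 (μ.real (Iic y))) := by
  simpa only [setIntegral_one] using tendsto_setIntegral_Iic_right (μ := μ) (integrable_const (1 : ℝ)) y

theorem tendsto_real_Iic_atTop : Tendsto (fun z => μ.real (Iic z)) atTop (𝓝 (μ.real univ)) := by
  have := tendsto_setIntegral_Iic_atTop (μ := μ) (integrable_const (1 : ℝ))
  rw [← setIntegral_univ] at this
  simpa only [setIntegral_one] using this

theorem tendsto_real_Iic_atBot : Tendsto (fun z => μ.real (Iic z)) atBot (𝓝 0) := by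
  simpa only [setIntegral_one] using
    tendsto_setIntegral_Iic_atBot (μ := μ) (integrable_const (1 : ℝ))

open Classical in
/-- The quantile function of a finite measure on the line. -/
def quantile (m : ℝ) : ℝ := if m ∈ Ioo 0 (μ.real univ) then sInf {y | m ≤ μ.real (Iic y)} else 0

variable {μ}

theorem quantile_le_iff {m : ℝ} (hm : m ∈ Ioo 0 (μ.real univ)) (y : ℝ) :
    quantile μ m ≤ y ↔ m ≤ μ.real (Iic y) := by
  rw [quantile, if_pos hm]
  obtain ⟨a, ha⟩ := ((tendsto_real_Iic_atBot μ).eventually_lt_const hm.1).exists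
  obtain ⟨b, hb⟩ := ((tendsto_real_Iic_atTop μ).eventually_const_lt hm.2).exists
  have hbdd : BddBelow {y | m ≤ μ.real (Iic y)} := by
    refine ⟨a, fun y hy => ?_⟩
    by_contra! h
    exact absurd (le_trans hy (monotone_real_Iic μ h.le)) (not_le.2 ha)
  have hne : {y | m ≤ μ.real (Iic y)}.Nonempty := ⟨b, hb.le⟩
  refine ⟨fun h => ?_, fun h => csInf_le hbdd h⟩
  refine (tendsto_real_Iic_right μ y).mono_left (nhdsWithin_mono y Ioi_subset_Ici_self)
    |> ge_of_tendsto <| ?_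
  filter_upwards [self_mem_nhdsWithin] with z hz
  obtain ⟨r, hr, hrz⟩ := exists_lt_of_csInf_lt hne (lt_of_le_of_lt h hz)
  exact le_trans hr (monotone_real_Iic μ hrz.le)

theorem quantile_mono {m m' : ℝ} (hm : m ∈ Ioo 0 (μ.real univ)) (hm' : m' ∈ Ioo 0 (μ.real univ))
    (h : m ≤ m') : quantile μ m ≤ quantile μ m' :=
  (quantile_le_iff hm _).2 (h.trans ((quantile_le_iff hm' _).1 le_rfl))

theorem preimage_quantile (y : ℝ) :
    Ioo 0 (μ.real univ) ∩ quantile μ ⁻¹' Iic y = Ioo 0 (μ.real univ) ∩ Iic (μ.real (Iic y)) := by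
  ext m
  simp only [mem_inter_iff, mem_preimage, mem_Iic]
  exact and_congr_right fun hm => quantile_le_iff hm y

variable (μ) in
theorem measurable_quantile : Measurable (quantile μ) := by
  refine measurable_of_Iic fun y => ?_
  have h : quantile μ ⁻¹' Iic y = (Ioo 0 (μ.real univ) ∩ Iic (μ.real (Iic y))) ∪
      ((Ioo 0 (μ.real univ))ᶜ ∩ {_m | 0 ≤ y}) := by
    rw [← preimage_quantile]
    ext m
    by_cases hm : m ∈ Ioo 0 (μ.real univ)
    · simp [hm]
    · have : quantile μ m = 0 := if_neg hm
      simp [hm, this]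
  rw [h]
  exact (measurableSet_Ioo.inter measurableSet_Iic).union
    (measurableSet_Ioo.compl.inter (MeasurableSet.const _))

theorem Ioo_inter_Iic_ae_eq {a b c : ℝ} (h : c ≤ b) :
    (Ioo a b ∩ Iic c : Set ℝ) =ᵐ[volume] Ioc a c := by
  have e : Ioc a c = Ioc a b ∩ Iic c := by rw [Ioc_inter_Iic, min_eq_right h]
  rw [e]
  exact Ioo_ae_eq_Ioc.inter (ae_eq_refl (Iic c))

variable (μ) in
theorem map_quantile : (volume.restrict (Ioo 0 (μ.real univ))).map (quantile μ) = μ := by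
  refine Measure.ext_of_Iic _ _ fun y => ?_
  have h0 : (0 : ℝ) ≤ μ.real (Iic y) := measureReal_nonneg
  have h1 : μ.real (Iic y) ≤ μ.real univ := measureReal_mono (subset_univ _)
  rw [Measure.map_apply (measurable_quantile μ) measurableSet_Iic,
    Measure.restrict_apply (measurable_quantile μ measurableSet_Iic), inter_comm, preimage_quantile,
    measure_congr (Ioo_inter_Iic_ae_eq h1),
    Real.volume_Ioc, sub_zero, ofReal_measureReal]

variable (μ) in
/-- A function on the line, in the mass coordinate of `μ`. -/
def inMass (f : ℝ → ℝ) : ℝ → ℝ := (Ioo 0 (μ.real univ)).indicator (f ∘ quantile μ)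

variable {f : ℝ → ℝ}

theorem measurable_inMass (hf : Measurable f) : Measurable (inMass μ f) :=
  (hf.comp (measurable_quantile μ)).indicator measurableSet_Ioo

theorem integrable_inMass (hf : Integrable f μ) : Integrable (inMass μ f) := by
  refine (integrable_indicator_iff measurableSet_Ioo).2 ?_
  refine (integrable_map_measure ?_ (measurable_quantile μ).aemeasurable).1 ?_ <;>
    rw [map_quantile]
  exacts [hf.aestronglyMeasurable, hf]

/-- Masses of half-lines are exactly where the mass coordinate and the line correspond; across an
atom `inMass` is constant. -/
theorem integral_inMass_Iic (hf : Measurable f) (y : ℝ) :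
    ∫ m in 0..μ.real (Iic y), inMass μ f m = ∫ s in Iic y, f s ∂μ := by
  have h0 : (0 : ℝ) ≤ μ.real (Iic y) := measureReal_nonneg
  have h1 : μ.real (Iic y) ≤ μ.real univ := measureReal_mono (subset_univ _)
  conv_rhs => rw [← map_quantile μ]
  rw [setIntegral_map measurableSet_Iic (by rw [map_quantile]; exact hf.aestronglyMeasurable)
    (measurable_quantile μ).aemeasurable,
    Measure.restrict_restrict (measurable_quantile μ measurableSet_Iic), inter_comm,
    preimage_quantile, intervalIntegral.integral_of_le h0, inMass,
    setIntegral_indicator measurableSet_Ioo]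
  refine setIntegral_congr_set ?_
  have h2 := (ae_eq_refl (μ := volume) (Ioo 0 (μ.real univ))).inter
    (Ioo_inter_Iic_ae_eq (a := 0) h1).symm
  rw [← inter_assoc, inter_self] at h2
  rwa [inter_comm]

/-- The primitive of `inMass` is continuous, so `integral_inMass_Iic` passes to limits of masses,
such as those of open half-lines and of the line. -/
theorem tendsto_integral_inMass (hf : Measurable f) (hfi : Integrable f μ) {l : Filter ℝ} [l.NeBot]
    {m c : ℝ} (hm : Tendsto (fun z => μ.real (Iic z)) l (𝓝 m))
    (hc : Tendsto (fun z => ∫ s in Iic z, f s ∂μ) l (𝓝 c)) : ∫ r in 0..m, inMass μ f r = c := by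
  refine tendsto_nhds_unique ?_ hc
  have hcont : Continuous fun m => ∫ r in 0..m, inMass μ f r :=
    intervalIntegral.continuous_primitive
      (fun _ _ => (integrable_inMass hfi).intervalIntegrable) 0
  exact ((hcont.tendsto m).comp hm).congr fun z => integral_inMass_Iic hf z

theorem integral_inMass_Iio (hf : Measurable f) (hfi : Integrable f μ) (y : ℝ) :
    ∫ m in 0..μ.real (Iio y), inMass μ f m = ∫ s in Iio y, f s ∂μ :=
  tendsto_integral_inMass hf hfi (tendsto_real_Iic_left μ y) (tendsto_setIntegral_Iic_left hfi y)

theorem integral_inMass_univ (hf : Measurable f) (hfi : Integrable f μ) :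
    ∫ m in 0..μ.real univ, inMass μ f m = ∫ s, f s ∂μ :=
  tendsto_integral_inMass hf hfi (tendsto_real_Iic_atTop μ) (tendsto_setIntegral_Iic_atTop hfi)

end Quantile

/-! ### Measurability and local boundedness of piecewise continuous functions. -/

section PiecewiseContinuous

variable {f : ℝ → ℝ}

theorem PiecewiseContinuous.measurable (hf : PiecewiseContinuous f) : Measurable f := by
  have hD : {x | ¬ ContinuousAt f x}.Countable := by
    have h : {x | ¬ ContinuousAt f x} ⊆ ⋃ n : ℕ, {x | x ∈ Icc (-n : ℝ) n ∧ ¬ ContinuousAt f x} := by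
      intro x hx
      obtain ⟨n, hn⟩ := exists_nat_ge |x|
      exact mem_iUnion.2 ⟨n, abs_le.1 hn, hx⟩
    exact (countable_iUnion fun n : ℕ => (hf.1 (-n) n).countable).mono h
  classical
  have hc : ContinuousOn f {x | ¬ ContinuousAt f x}ᶜ := fun x hx =>
    (not_not.1 hx : ContinuousAt f x).continuousWithinAt
  have hm : Measurable (({x | ¬ ContinuousAt f x}ᶜ).piecewise f (fun _ => 0)) :=
    hc.measurable_piecewise continuousOn_const hD.measurableSet.compl
  refine hm.measurable_of_countable_ne (hD.mono fun x hx => ?_)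
  by_contra h
  exact hx (piecewise_eq_of_mem _ _ _ h)

theorem PiecewiseContinuous.bounded_Icc (hf : PiecewiseContinuous f) (a b : ℝ) :
    ∃ K, ∀ x ∈ Icc a b, |f x| ≤ K := by
  refine isCompact_Icc.induction_on (p := fun s => ∃ K, ∀ x ∈ s, |f x| ≤ K) ⟨0, by simp⟩
    (fun s t hst ⟨K, hK⟩ => ⟨K, fun x hx => hK x (hst hx)⟩) ?_ ?_
  · rintro s t ⟨K, hK⟩ ⟨K', hK'⟩
    refine ⟨max K K', fun x hx => ?_⟩
    rcases hx with hx | hx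
    exacts [(hK x hx).trans (le_max_left _ _), (hK' x hx).trans (le_max_right _ _)]
  · intro x _
    obtain ⟨⟨l, hl⟩, r, hr⟩ := hf.2 x
    refine ⟨{z | |f z| ≤ max (|l| + 1) (max (|r| + 1) |f x|)}, nhdsWithin_le_nhds ?_, _,
      fun z hz => hz⟩
    rw [← nhdsLT_sup_nhdsGE, ← nhdsGT_sup_nhdsWithin_singleton]
    have h1 : ∀ᶠ z in 𝓝[<] x, |f z| < |l| + 1 := hl.abs.eventually_lt_const (lt_add_one _)
    have h2 : ∀ᶠ z in 𝓝[>] x, |f z| < |r| + 1 := hr.abs.eventually_lt_const (lt_add_one _)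
    refine mem_sup.2 ⟨?_, mem_sup.2 ⟨?_, ?_⟩⟩
    · filter_upwards [h1] with z hz
      exact hz.le.trans (le_max_left _ _)
    · filter_upwards [h2] with z hz
      exact hz.le.trans ((le_max_left _ _).trans (le_max_right _ _))
    · filter_upwards [self_mem_nhdsWithin] with z hz
      rw [mem_singleton_iff.1 hz]
      exact (le_max_right _ _).trans (le_max_right _ _)

end PiecewiseContinuous

/-! ### The space-time potential of the initial data and its relation to F. -/

section Flow

variable (κ : ℝ) (ρ₀ : Measure ℝ) (u₀ : ℝ → ℝ)

/-- The primitive of the displacement up to time `t`, without the quadratic term, in the mass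
coordinate. -/
def displacement (t m : ℝ) : ℝ :=
  t * (∫ s in 0..m, inMass ρ₀ u₀ s) + κ / 2 * t ^ 2 * ∫ s in 0..m, inMass ρ₀ (field ρ₀) s

/-- The potential with the sign reversed, normalized at `-∞` up to the first moment of `ρ₀`. -/
def affineForm (x t y : ℝ) : ℝ :=
  x * ρ₀.real (Iic y) - displacement κ ρ₀ u₀ t (ρ₀.real (Iic y)) -
    integralRight ρ₀ (fun s => s) y

/-- The space-time potential of the flow: the supremum of the affine forms. -/
def spaceTimePotential (x t : ℝ) : ℝ := ⨆ y : ℝ, affineForm κ ρ₀ u₀ x t y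

variable {κ ρ₀ u₀} [IsFiniteMeasure ρ₀]

theorem continuous_displacement (hm₀ : Integrable u₀ ρ₀) (t : ℝ) :
    Continuous fun m => displacement κ ρ₀ u₀ t m := by
  have h1 : Continuous fun m => ∫ s in 0..m, inMass ρ₀ u₀ s :=
    intervalIntegral.continuous_primitive
      (fun _ _ => (integrable_inMass hm₀).intervalIntegrable) 0
  have h2 : Continuous fun m => ∫ s in 0..m, inMass ρ₀ (field ρ₀) s :=
    intervalIntegral.continuous_primitive
      (fun _ _ => (integrable_inMass (integrable_field ρ₀ ρ₀)).intervalIntegrable) 0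
  unfold displacement
  fun_prop

theorem continuous_integral_inMass_field :
    Continuous fun m => ∫ s in 0..m, inMass ρ₀ (field ρ₀) s :=
  intervalIntegral.continuous_primitive
    (fun _ _ => (integrable_inMass (integrable_field ρ₀ ρ₀)).intervalIntegrable) 0

theorem real_Iic_mem_Icc (y : ℝ) : ρ₀.real (Iic y) ∈ Icc 0 (ρ₀.real univ) :=
  ⟨measureReal_nonneg, measureReal_mono (subset_univ _)⟩

/-- The first moment term only lowers the form, and the rest is a continuous function of the mass on
a compact interval. -/
theorem bddAbove_affineForm (hm₀ : Integrable u₀ ρ₀) (x t : ℝ) :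
    BddAbove (range fun y => affineForm κ ρ₀ u₀ x t y) := by
  have hc : Continuous fun m => x * m - displacement κ ρ₀ u₀ t m :=
    (continuous_const_mul x).sub (continuous_displacement hm₀ t)
  obtain ⟨C, hC⟩ := isCompact_Icc.bddAbove_image (K := Icc 0 (ρ₀.real univ)) hc.continuousOn
  refine ⟨C, ?_⟩
  rintro _ ⟨y, rfl⟩
  have h1 := hC ⟨_, real_Iic_mem_Icc y, rfl⟩
  have h2 := integralRight_id_nonneg ρ₀ y
  simp only [affineForm]
  linarith

theorem affineForm_le (hm₀ : Integrable u₀ ρ₀) (x t y : ℝ) :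
    affineForm κ ρ₀ u₀ x t y ≤ spaceTimePotential κ ρ₀ u₀ x t :=
  le_ciSup (bddAbove_affineForm hm₀ x t) y

theorem integral_inMass_field_Iic (y : ℝ) :
    ∫ s in 0..ρ₀.real (Iic y), inMass ρ₀ (field ρ₀) s = ρ₀.real (Iic y) ^ 2 / 2 := by
  rw [integral_inMass_Iic (monotone_field ρ₀).measurable, setIntegral_Iic_field]

/-- Limits of masses along maximizing sequences are contact slopes. -/
theorem mem_contactSet_of_tendsto (hm₀ : Integrable u₀ ρ₀) {x t m : ℝ} {z : ℕ → ℝ}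
    (hz : Tendsto (fun n => affineForm κ ρ₀ u₀ x t (z n)) atTop
      (𝓝 (spaceTimePotential κ ρ₀ u₀ x t)))
    (hm : Tendsto (fun n => ρ₀.real (Iic (z n))) atTop (𝓝 m)) :
    m ∈ contactSet κ (ρ₀.real univ) (inMass ρ₀ u₀) (inMass ρ₀ (field ρ₀))
      (spaceTimePotential κ ρ₀ u₀) x t := by
  -- True for masses of half-lines by `setIntegral_Iic_field`, and preserved in the limit.
  have he : ∫ s in 0..m, inMass ρ₀ (field ρ₀) s = m ^ 2 / 2 := by
    refine tendsto_nhds_unique ((continuous_integral_inMass_field.tendsto m).comp hm) ?_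
    exact ((hm.pow 2).div_const 2).congr fun n => (integral_inMass_field_Iic _).symm
  refine ⟨isClosed_Icc.mem_of_tendsto hm (Eventually.of_forall fun n => real_Iic_mem_Icc _), he,
    fun x' t' => ?_⟩
  have hlim : Tendsto (fun n => affineForm κ ρ₀ u₀ x t (z n) + ρ₀.real (Iic (z n)) * (x' - x) -
      (displacement κ ρ₀ u₀ t' (ρ₀.real (Iic (z n))) -
        displacement κ ρ₀ u₀ t (ρ₀.real (Iic (z n))))) atTop
      (𝓝 (spaceTimePotential κ ρ₀ u₀ x t + m * (x' - x) -
        (displacement κ ρ₀ u₀ t' m - displacement κ ρ₀ u₀ t m))) :=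
    (hz.add (hm.mul_const _)).sub ((((continuous_displacement hm₀ t').tendsto m).comp hm).sub
      (((continuous_displacement hm₀ t).tendsto m).comp hm))
  refine le_trans (le_of_eq ?_) (le_of_tendsto' hlim fun n => ?_)
  · simp only [displacement, he]
    ring
  -- The same point z n competes in the supremum at (x', t'); the first moments cancel in the
  -- comparison.
  · refine le_trans (le_of_eq ?_) (affineForm_le (κ := κ) hm₀ x' t' (z n))
    simp only [affineForm]
    ring

theorem exists_maximizing_seq (hm₀ : Integrable u₀ ρ₀) (x t : ℝ) :
    ∃ z : ℕ → ℝ, Tendsto (fun n => affineForm κ ρ₀ u₀ x t (z n)) atTop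
      (𝓝 (spaceTimePotential κ ρ₀ u₀ x t)) := by
  obtain ⟨w, -, hw, hwm⟩ := exists_seq_tendsto_sSup (range_nonempty _)
    (bddAbove_affineForm (κ := κ) hm₀ x t)
  choose z hz using hwm
  exact ⟨z, hw.congr fun n => (hz n).symm⟩

theorem integrableOn_Q (hm₀ : Integrable u₀ ρ₀) (x t R : ℝ) :
    IntegrableOn (Q κ ρ₀ u₀ x t) (Icc (-R) R) ρ₀ :=
  (((continuous_id.continuousOn.integrableOn_compact isCompact_Icc).add
    (hm₀.const_mul t).integrableOn).add
    (((integrable_field ρ₀ ρ₀).const_mul (1 / 2 * κ)).mul_const (t ^ 2)).integrableOn).sub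
    (integrable_const x).integrableOn

/-- Splitting Q into s and an integrable rest moves the lower end of the rest from 0 to −∞, at the
cost of a term free of y. Minimizing F is thus maximizing the form. -/
theorem potential_eq (hu₀ : Measurable u₀) (hm₀ : Integrable u₀ ρ₀) (x t y : ℝ) :
    potential κ ρ₀ u₀ x t y = x * ρ₀.real (Iic 0) - displacement κ ρ₀ u₀ t (ρ₀.real (Iic 0)) -
      affineForm κ ρ₀ u₀ x t y := by
  have h1 : Integrable (fun s => t * u₀ s) ρ₀ := hm₀.const_mul t
  have h2 : Integrable (fun s => 1 / 2 * κ * field ρ₀ s * t ^ 2) ρ₀ :=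
    ((integrable_field ρ₀ ρ₀).const_mul (1 / 2 * κ)).mul_const (t ^ 2)
  have hg : Integrable (fun s => t * u₀ s + 1 / 2 * κ * field ρ₀ s * t ^ 2 - x) ρ₀ :=
    (h1.add h2).sub (integrable_const x)
  have hQ : Q κ ρ₀ u₀ x t = fun s => s + (t * u₀ s + 1 / 2 * κ * field ρ₀ s * t ^ 2 - x) := by
    ext s
    simp only [Q]
    ring
  have hgi : ∀ z, ∫ s in Iic z, (t * u₀ s + 1 / 2 * κ * field ρ₀ s * t ^ 2 - x) ∂ρ₀ =
      displacement κ ρ₀ u₀ t (ρ₀.real (Iic z)) - x * ρ₀.real (Iic z) := by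
    intro z
    have h12 : Integrable (fun s => t * u₀ s + 1 / 2 * κ * field ρ₀ s * t ^ 2) ρ₀ := h1.add h2
    rw [integral_sub h12.integrableOn (integrable_const x),
      integral_add h1.integrableOn h2.integrableOn, integral_const_mul, integral_mul_const,
      integral_const_mul, displacement, integral_inMass_Iic hu₀,
      integral_inMass_Iic (monotone_field ρ₀).measurable, setIntegral_const, smul_eq_mul]
    ring
  have hset : {s : ℝ | (s : EReal) ≤ (y : EReal)} = Iic y := by ext s; simp
  rw [potential, hQ, integralRight_add (f := fun s => s)
    (fun R => continuous_id.continuousOn.integrableOn_compact isCompact_Icc)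
    (fun R => hg.integrableOn), integralRight_eq hg, hset, hgi, hgi, affineForm]
  ring

theorem bddBelow_potential (hu₀ : Measurable u₀) (hm₀ : Integrable u₀ ρ₀) (x t : ℝ) :
    BddBelow (range (potential κ ρ₀ u₀ x t)) := by
  obtain ⟨C, hC⟩ := bddAbove_affineForm (κ := κ) hm₀ x t
  refine ⟨x * ρ₀.real (Iic 0) - displacement κ ρ₀ u₀ t (ρ₀.real (Iic 0)) - C, ?_⟩
  rintro _ ⟨y, rfl⟩
  rw [potential_eq hu₀ hm₀]
  have := hC ⟨y, rfl⟩
  simp only at this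
  linarith

theorem iInf_potential (hu₀ : Measurable u₀) (hm₀ : Integrable u₀ ρ₀) (x t : ℝ) :
    ⨅ y, potential κ ρ₀ u₀ x t y = x * ρ₀.real (Iic 0) -
      displacement κ ρ₀ u₀ t (ρ₀.real (Iic 0)) - spaceTimePotential κ ρ₀ u₀ x t := by
  refine le_antisymm ?_ (le_ciInf fun y => ?_)
  · rw [le_sub_comm]
    refine ciSup_le fun y => ?_
    have := ciInf_le (bddBelow_potential (κ := κ) hu₀ hm₀ x t) y
    rw [potential_eq hu₀ hm₀] at this
    linarith
  · rw [potential_eq hu₀ hm₀]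
    have := affineForm_le (κ := κ) hm₀ x t y
    linarith

theorem tendsto_affineForm_iff (hu₀ : Measurable u₀) (hm₀ : Integrable u₀ ρ₀) {x t : ℝ}
    {z : ℕ → ℝ} : Tendsto (fun n => affineForm κ ρ₀ u₀ x t (z n)) atTop
      (𝓝 (spaceTimePotential κ ρ₀ u₀ x t)) ↔
    Tendsto (fun n => potential κ ρ₀ u₀ x t (z n)) atTop (𝓝 (⨅ y, potential κ ρ₀ u₀ x t y)) := by
  rw [iInf_potential hu₀ hm₀]
  simp only [potential_eq hu₀ hm₀]
  refine ⟨fun h => h.const_sub _, fun h => ?_⟩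
  have := h.const_sub (x * ρ₀.real (Iic 0) - displacement κ ρ₀ u₀ t (ρ₀.real (Iic 0)))
  simpa using this

end Flow

/-! ### Minimizers in the extended line. -/

section ArgInf

variable {F : ℝ → ℝ}

theorem isArgInf_iff (hF : BddBelow (range F)) (y : EReal) :
    IsArgInf F y ↔ ∃ z : ℕ → ℝ, Tendsto (fun n => (z n : EReal)) atTop (𝓝 y) ∧
      Tendsto (fun n => F (z n)) atTop (𝓝 (⨅ s, F s)) := by
  have h : ((⨅ s, F s : ℝ) : EReal) = ⨅ s : ℝ, (F s : EReal) :=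
    EReal.coe_strictMono.monotone.map_ciInf_of_continuousAt
      continuous_coe_real_ereal.continuousAt hF
  simp only [IsArgInf, ← h, EReal.tendsto_coe]

/-- The minimizers are the slice at the infimum of the closure of the graph of F. -/
theorem isClosed_isArgInf (hF : BddBelow (range F)) : IsClosed {y | IsArgInf F y} := by
  have h : {y | IsArgInf F y} = (fun y : EReal => (y, ⨅ s, F s)) ⁻¹'
      closure (range fun z : ℝ => ((z : EReal), F z)) := by
    ext y
    simp only [mem_ofPred_eq, isArgInf_iff hF, mem_preimage, mem_closure_iff_seq_limit]
    constructor
    · rintro ⟨z, h1, h2⟩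
      exact ⟨fun n => ((z n : EReal), F (z n)), fun n => mem_range_self _, h1.prodMk_nhds h2⟩
    · rintro ⟨w, hw, hlim⟩
      choose z hz using hw
      obtain rfl : (fun n => ((z n : EReal), F (z n))) = w := funext hz
      exact ⟨z, (continuous_fst.tendsto _).comp hlim, (continuous_snd.tendsto _).comp hlim⟩
  rw [h]
  exact isClosed_closure.preimage (by fun_prop)

/-- The set of minimizers is closed, and nonempty by compactness of the extended line, so it
contains its supremum. -/
theorem isArgInf_sSup (hF : BddBelow (range F)) : IsArgInf F (sSup {y | IsArgInf F y}) := by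
  refine (isClosed_isArgInf hF).csSup_mem ?_ (OrderTop.bddAbove _)
  obtain ⟨w, -, hw, hwm⟩ := exists_seq_tendsto_sInf (range_nonempty F) hF
  choose z hz using hwm
  obtain ⟨y, φ, hφ, hy⟩ := CompactSpace.tendsto_subseq fun n => (z n : EReal)
  refine ⟨y, (isArgInf_iff hF y).2 ⟨z ∘ φ, hy, ?_⟩⟩
  exact (hw.comp hφ.tendsto_atTop).congr fun n => (hz _).symm

end ArgInf

/-! ### From the largest minimizer to a contact slope. -/

section Minimizer

variable {κ : ℝ} {ρ₀ : Measure ℝ} {u₀ : ℝ → ℝ} [IsFiniteMeasure ρ₀]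

theorem isArgInf_largestMinimizer (hu₀ : Measurable u₀) (hm₀ : Integrable u₀ ρ₀) (x t : ℝ) :
    ∃ z : ℕ → ℝ, Tendsto (fun n => (z n : EReal)) atTop (𝓝 (largestMinimizer κ ρ₀ u₀ x t)) ∧
      Tendsto (fun n => potential κ ρ₀ u₀ x t (z n)) atTop (𝓝 (⨅ y, potential κ ρ₀ u₀ x t y)) :=
  (isArgInf_iff (bddBelow_potential hu₀ hm₀ x t) _).1
    (isArgInf_sSup (bddBelow_potential hu₀ hm₀ x t))

/-- A limit of masses along a minimizing sequence is a contact slope. -/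
theorem mem_contactSet_of_minimizing (hu₀ : Measurable u₀) (hm₀ : Integrable u₀ ρ₀) {x t m : ℝ}
    {z : ℕ → ℝ} (hz : Tendsto (fun n => potential κ ρ₀ u₀ x t (z n)) atTop
      (𝓝 (⨅ y, potential κ ρ₀ u₀ x t y)))
    {l : Filter ℝ} (hm : Tendsto (fun y => ρ₀.real (Iic y)) l (𝓝 m)) (hl : Tendsto z atTop l) :
    m ∈ contactSet κ (ρ₀.real univ) (inMass ρ₀ u₀) (inMass ρ₀ (field ρ₀))
      (spaceTimePotential κ ρ₀ u₀) x t :=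
  mem_contactSet_of_tendsto hm₀ ((tendsto_affineForm_iff hu₀ hm₀).2 hz) (hm.comp hl)

theorem mem_contactSet_of_isLeast (hu₀ : Measurable u₀) (hm₀ : Integrable u₀ ρ₀) {x t y : ℝ}
    (hy : potential κ ρ₀ u₀ x t y = ⨅ y, potential κ ρ₀ u₀ x t y) :
    ρ₀.real (Iic y) ∈ contactSet κ (ρ₀.real univ) (inMass ρ₀ u₀) (inMass ρ₀ (field ρ₀))
      (spaceTimePotential κ ρ₀ u₀) x t :=
  mem_contactSet_of_minimizing hu₀ hm₀ (z := fun _ => y) (by rw [hy]; exact tendsto_const_nhds)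
    (tendsto_real_Iic_right ρ₀ y) (tendsto_const_nhdsWithin self_mem_Ici)

theorem tendsto_potential_left (hm₀ : Integrable u₀ ρ₀) (x t y : ℝ) :
    Tendsto (potential κ ρ₀ u₀ x t) (𝓝[<] y)
      (𝓝 (potential κ ρ₀ u₀ x t y - ρ₀.real {y} * Q κ ρ₀ u₀ x t y)) :=
  tendsto_integralRight_left (integrableOn_Q hm₀ x t) y

theorem tendsto_potential_right (hm₀ : Integrable u₀ ρ₀) (x t y : ℝ) :
    Tendsto (potential κ ρ₀ u₀ x t) (𝓝[≥] y) (𝓝 (potential κ ρ₀ u₀ x t y)) :=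
  tendsto_integralRight_right (integrableOn_Q hm₀ x t) y

theorem iInf_potential_le_left (hu₀ : Measurable u₀) (hm₀ : Integrable u₀ ρ₀) (x t y : ℝ) :
    ⨅ y, potential κ ρ₀ u₀ x t y ≤
      potential κ ρ₀ u₀ x t y - ρ₀.real {y} * Q κ ρ₀ u₀ x t y :=
  ge_of_tendsto (tendsto_potential_left hm₀ x t y)
    (Eventually.of_forall fun z => ciInf_le (bddBelow_potential hu₀ hm₀ x t) z)

theorem exists_subseq_nhdsWithin {z : ℕ → ℝ} {y : ℝ} (hz : Tendsto z atTop (𝓝 y)) :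
    ∃ φ : ℕ → ℕ, StrictMono φ ∧
      (Tendsto (z ∘ φ) atTop (𝓝[<] y) ∨ Tendsto (z ∘ φ) atTop (𝓝[≥] y)) := by
  by_cases h : ∃ᶠ n in atTop, z n < y
  · obtain ⟨φ, hφ, hlt⟩ := extraction_of_frequently_atTop h
    exact ⟨φ, hφ, Or.inl (tendsto_nhdsWithin_iff.2
      ⟨hz.comp hφ.tendsto_atTop, Eventually.of_forall hlt⟩)⟩
  · refine ⟨id, strictMono_id, Or.inr (tendsto_nhdsWithin_iff.2 ⟨hz, ?_⟩)⟩
    filter_upwards [not_frequently.1 h] with n hn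
    exact not_lt.1 hn

/-- A sequence approaching from the right gives the mass directly. From the left, the infimum is
F(y−) = F(y) − ρ₀{y} Q(y), which is at least F(y) if Q(y) ≤ 0; so F(y) is the infimum too. -/
theorem real_Iic_mem_contactSet (hu₀ : Measurable u₀) (hm₀ : Integrable u₀ ρ₀) {x t y : ℝ}
    {z : ℕ → ℝ} (hzy : Tendsto z atTop (𝓝 y))
    (hz : Tendsto (fun n => potential κ ρ₀ u₀ x t (z n)) atTop (𝓝 (⨅ y, potential κ ρ₀ u₀ x t y)))
    (hQ : Q κ ρ₀ u₀ x t y ≤ 0) :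
    ρ₀.real (Iic y) ∈ contactSet κ (ρ₀.real univ) (inMass ρ₀ u₀) (inMass ρ₀ (field ρ₀))
      (spaceTimePotential κ ρ₀ u₀) x t := by
  obtain ⟨φ, hφ, hl | hr⟩ := exists_subseq_nhdsWithin hzy
  · refine mem_contactSet_of_isLeast hu₀ hm₀ (le_antisymm ?_
      (ciInf_le (bddBelow_potential hu₀ hm₀ x t) y))
    have h := tendsto_nhds_unique ((tendsto_potential_left hm₀ x t y).comp hl)
      (hz.comp hφ.tendsto_atTop)
    have := mul_nonpos_of_nonneg_of_nonpos (measureReal_nonneg (μ := ρ₀) (s := {y})) hQ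
    linarith
  · exact mem_contactSet_of_minimizing hu₀ hm₀ (hz.comp hφ.tendsto_atTop)
      (tendsto_real_Iic_right ρ₀ y) hr

/-- If Q(y) > 0 then F(y−) ≤ F(y), so a sequence from the right can be exchanged for one from the
left. -/
theorem real_Iio_mem_contactSet (hu₀ : Measurable u₀) (hm₀ : Integrable u₀ ρ₀) {x t y : ℝ}
    {z : ℕ → ℝ} (hzy : Tendsto z atTop (𝓝 y))
    (hz : Tendsto (fun n => potential κ ρ₀ u₀ x t (z n)) atTop (𝓝 (⨅ y, potential κ ρ₀ u₀ x t y)))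
    (hQ : 0 < Q κ ρ₀ u₀ x t y) :
    ρ₀.real (Iio y) ∈ contactSet κ (ρ₀.real univ) (inMass ρ₀ u₀) (inMass ρ₀ (field ρ₀))
      (spaceTimePotential κ ρ₀ u₀) x t := by
  obtain ⟨φ, hφ, hl | hr⟩ := exists_subseq_nhdsWithin hzy
  · exact mem_contactSet_of_minimizing hu₀ hm₀ (hz.comp hφ.tendsto_atTop)
      (tendsto_real_Iic_left ρ₀ y) hl
  · have h := tendsto_nhds_unique ((tendsto_potential_right hm₀ x t y).comp hr)
      (hz.comp hφ.tendsto_atTop)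
    have h1 := iInf_potential_le_left (κ := κ) hu₀ hm₀ x t y
    have h2 := mul_nonneg (measureReal_nonneg (μ := ρ₀) (s := {y})) hQ.le
    have h3 : potential κ ρ₀ u₀ x t y - ρ₀.real {y} * Q κ ρ₀ u₀ x t y =
        ⨅ y, potential κ ρ₀ u₀ x t y := by linarith
    obtain ⟨w, -, hw, hwy⟩ := exists_seq_strictMono_tendsto y
    have hwl : Tendsto w atTop (𝓝[<] y) :=
      tendsto_nhdsWithin_iff.2 ⟨hwy, Eventually.of_forall hw⟩
    refine mem_contactSet_of_minimizing hu₀ hm₀ (z := w) ?_ (tendsto_real_Iic_left ρ₀ y) hwl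
    rw [← h3]
    exact (tendsto_potential_left hm₀ x t y).comp hwl

theorem integral_inMass_coe_le {f : ℝ → ℝ} (hf : Measurable f) (hfi : Integrable f ρ₀) (y : EReal) :
    ∫ m in 0..ρ₀.real {s : ℝ | (s : EReal) ≤ y}, inMass ρ₀ f m =
      ∫ s in {s : ℝ | (s : EReal) ≤ y}, f s ∂ρ₀ := by
  induction y with
  | bot => simp
  | coe y =>
    simp only [EReal.coe_le_coe_iff]
    exact integral_inMass_Iic hf y
  | top =>
    simp only [le_top, ofPred_true, setIntegral_univ]
    exact integral_inMass_univ hf hfi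

theorem integral_inMass_coe_lt {f : ℝ → ℝ} (hf : Measurable f) (hfi : Integrable f ρ₀) (y : EReal) :
    ∫ m in 0..ρ₀.real {s : ℝ | (s : EReal) < y}, inMass ρ₀ f m =
      ∫ s in {s : ℝ | (s : EReal) < y}, f s ∂ρ₀ := by
  induction y with
  | bot => simp
  | coe y =>
    simp only [EReal.coe_lt_coe_iff]
    exact integral_inMass_Iio hf hfi y
  | top =>
    simp only [EReal.coe_lt_top, ofPred_true, setIntegral_univ]
    exact integral_inMass_univ hf hfi

/-- The link between the variational formula and the flow. The sign rule selects the side on which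
the infimum is surely attained, and mass and momentum are read off at one and the same contact
slope. -/
theorem integralToMinimizer_eq (hu₀ : Measurable u₀) (hm₀ : Integrable u₀ ρ₀) (x t : ℝ) :
    ∃ m ∈ contactSet κ (ρ₀.real univ) (inMass ρ₀ u₀) (inMass ρ₀ (field ρ₀))
      (spaceTimePotential κ ρ₀ u₀) x t,
      mass κ ρ₀ u₀ x t = m - ρ₀.real (Iic 0) ∧
      momentum κ ρ₀ u₀ x t = (∫ r in 0..m, inMass ρ₀ (fun s => u₀ s + κ * field ρ₀ s * t) r) -
        ∫ r in 0..ρ₀.real (Iic 0), inMass ρ₀ (fun s => u₀ s + κ * field ρ₀ s * t) r := by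
  obtain ⟨z, hzy, hz⟩ := isArgInf_largestMinimizer (κ := κ) hu₀ hm₀ x t
  have hfm : Measurable fun s => u₀ s + κ * field ρ₀ s * t :=
    hu₀.add (((monotone_field ρ₀).measurable.const_mul κ).mul_const t)
  have hfi : Integrable (fun s => u₀ s + κ * field ρ₀ s * t) ρ₀ :=
    hm₀.add (((integrable_field ρ₀ ρ₀).const_mul κ).mul_const t)
  simp only [mass, momentum, integralToMinimizer]
  generalize largestMinimizer κ ρ₀ u₀ x t = y at hzy
  have hcontact : (Q κ ρ₀ u₀ x t y.toReal ≤ 0 → ρ₀.real {s : ℝ | (s : EReal) ≤ y} ∈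
      contactSet κ (ρ₀.real univ) (inMass ρ₀ u₀) (inMass ρ₀ (field ρ₀))
      (spaceTimePotential κ ρ₀ u₀) x t) ∧ (0 < Q κ ρ₀ u₀ x t y.toReal →
      ρ₀.real {s : ℝ | (s : EReal) < y} ∈ contactSet κ (ρ₀.real univ) (inMass ρ₀ u₀)
      (inMass ρ₀ (field ρ₀)) (spaceTimePotential κ ρ₀ u₀) x t) := by
    induction y with
    | bot =>
      have h := mem_contactSet_of_minimizing hu₀ hm₀ hz (tendsto_real_Iic_atBot ρ₀)
        (EReal.tendsto_coe_nhds_bot_iff.1 hzy)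
      simp [h]
    | coe y =>
      rw [EReal.tendsto_coe] at hzy
      simp only [EReal.coe_le_coe_iff, EReal.coe_lt_coe_iff, EReal.toReal_coe]
      exact ⟨real_Iic_mem_contactSet hu₀ hm₀ hzy hz, real_Iio_mem_contactSet hu₀ hm₀ hzy hz⟩
    | top =>
      have h := mem_contactSet_of_minimizing hu₀ hm₀ hz (tendsto_real_Iic_atTop ρ₀)
        (EReal.tendsto_coe_nhds_top_iff.1 hzy)
      simp [h]
  split_ifs with hQ
  · refine ⟨_, hcontact.1 hQ, ?_, ?_⟩
    · rw [integralRight_eq (integrable_const 1), setIntegral_one, setIntegral_one]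
    · rw [integralRight_eq hfi, integral_inMass_coe_le hfm hfi, integral_inMass_Iic hfm]
  · refine ⟨_, hcontact.2 (not_le.1 hQ), ?_, ?_⟩
    · rw [integralLeft_eq (integrable_const 1), setIntegral_one, setIntegral_one]
    · rw [integralLeft_eq hfi, integral_inMass_coe_lt hfm hfi, integral_inMass_Iic hfm]

end Minimizer

/-! ### The flow of the initial data and its state at time zero. -/

section Flow

/-- The mass flow of the initial data. -/
def massFlow (κ : ℝ) (ρ₀ : Measure ℝ) [IsFiniteMeasure ρ₀] [NeZero ρ₀] (u₀ : ℝ → ℝ)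
    (hu₀ : PiecewiseContinuous u₀) (hm₀ : Integrable u₀ ρ₀) : MassFlow where
  κ := κ
  L := ρ₀.real univ
  v := inMass ρ₀ u₀
  e := inMass ρ₀ (field ρ₀)
  ψ := spaceTimePotential κ ρ₀ u₀
  L_pos := measureReal_univ_pos
  measurable_v := measurable_inMass hu₀.measurable
  integrable_v := integrable_inMass hm₀
  bdd_v a ha b hb := by
    obtain ⟨K, hK⟩ := hu₀.bounded_Icc (quantile ρ₀ a) (quantile ρ₀ b)
    refine ⟨K, fun m hm => ?_⟩
    have hm' : m ∈ Ioo 0 (ρ₀.real univ) := ⟨ha.1.trans_le hm.1, hm.2.trans_lt hb.2⟩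
    rw [inMass, indicator_of_mem hm']
    exact hK _ ⟨quantile_mono ha hm' hm.1, quantile_mono hm' hb hm.2⟩
  measurable_e := measurable_inMass (monotone_field ρ₀).measurable
  e_nonneg m := indicator_nonneg (fun m _ => field_nonneg ρ₀ _) m
  e_le m := indicator_le' (fun m _ => field_le ρ₀ _) (fun _ _ => measureReal_nonneg) m
  nonempty_contactSet x t := by
    obtain ⟨z, hz⟩ := exists_maximizing_seq (κ := κ) hm₀ x t
    obtain ⟨m, -, φ, hφ, hm⟩ := isCompact_Icc.tendsto_subseq
      fun n => real_Iic_mem_Icc (ρ₀ := ρ₀) (z n)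
    exact ⟨m, mem_contactSet_of_tendsto hm₀ (hz.comp hφ.tendsto_atTop) hm⟩
  -- The form of a half-line of mass above m is affine in x with that mass as slope, and lies below
  -- the supremum.
  growth_right t m hm := by
    obtain ⟨y, hy⟩ := ((tendsto_real_Iic_atTop ρ₀).eventually_const_lt hm).exists
    refine ⟨_, hy, displacement κ ρ₀ u₀ t (ρ₀.real (Iic y)) + integralRight ρ₀ (fun s => s) y,
      fun x => ?_⟩
    have := affineForm_le (κ := κ) hm₀ x t y
    rw [affineForm] at this
    linarith
  growth_left t m hm := by
    obtain ⟨y, hy⟩ := ((tendsto_real_Iic_atBot ρ₀).eventually_lt_const hm).exists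
    refine ⟨_, hy, displacement κ ρ₀ u₀ t (ρ₀.real (Iic y)) + integralRight ρ₀ (fun s => s) y,
      fun x => ?_⟩
    have := affineForm_le (κ := κ) hm₀ x t y
    rw [affineForm] at this
    linarith

variable {κ : ℝ} {ρ₀ : Measure ℝ} [IsFiniteMeasure ρ₀] {u₀ : ℝ → ℝ}

/-- At time 0 the integrand is s − x, which changes sign from negative to positive at s = x. -/
theorem isLeast_potential_zero (hm₀ : Integrable u₀ ρ₀) (x : ℝ) :
    potential κ ρ₀ u₀ x 0 x = ⨅ y, potential κ ρ₀ u₀ x 0 y := by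
  have h : ∀ y, potential κ ρ₀ u₀ x 0 x ≤ potential κ ρ₀ u₀ x 0 y := by
    intro y
    have hQ : ∀ s, Q κ ρ₀ u₀ x 0 s = s - x := fun s => by simp [Q]
    rcases le_total x y with hxy | hxy
    · have e := integralRight_sub_integralRight (integrableOn_Q (κ := κ) hm₀ x 0) hxy
      have : 0 ≤ ∫ s in Ioc x y, Q κ ρ₀ u₀ x 0 s ∂ρ₀ :=
        setIntegral_nonneg measurableSet_Ioc fun s hs => by rw [hQ]; linarith [hs.1]
      unfold potential
      linarith
    · have e := integralRight_sub_integralRight (integrableOn_Q (κ := κ) hm₀ x 0) hxy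
      have : ∫ s in Ioc y x, Q κ ρ₀ u₀ x 0 s ∂ρ₀ ≤ 0 :=
        setIntegral_nonpos measurableSet_Ioc fun s hs => by rw [hQ]; linarith [hs.2]
      unfold potential
      linarith
  exact le_antisymm (le_ciInf h) (ciInf_le ⟨_, forall_mem_range.2 h⟩ x)

variable [NeZero ρ₀] {hu₀ : PiecewiseContinuous u₀} {hm₀ : Integrable u₀ ρ₀}

/-- The mass of (−∞, y] is a contact slope at every y. Those at y > x bound `upper` at x from above
and tend to the mass of (−∞, x] as y decreases to x. -/
theorem upper_massFlow_zero (x : ℝ) :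
    (massFlow κ ρ₀ u₀ hu₀ hm₀).upper x 0 = ρ₀.real (Iic x) := by
  have h : ∀ y, ρ₀.real (Iic y) ∈ (massFlow κ ρ₀ u₀ hu₀ hm₀).contact y 0 := fun y =>
    mem_contactSet_of_isLeast hu₀.measurable hm₀ (isLeast_potential_zero hm₀ y)
  refine le_antisymm ?_ (MassFlow.le_upper (h x))
  refine ge_of_tendsto ((tendsto_real_Iic_right ρ₀ x).mono_left
    (nhdsWithin_mono x Ioi_subset_Ici_self)) ?_
  filter_upwards [self_mem_nhdsWithin] with y hy
  exact (MassFlow.upper_le_lower 0 hy).trans (MassFlow.lower_le (h y))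

theorem pos_massFlow_zero {m : ℝ} (hm : m ∈ Ioo 0 (ρ₀.real univ)) :
    (massFlow κ ρ₀ u₀ hu₀ hm₀).pos 0 m = quantile ρ₀ m := by
  refine eq_of_forall_ge_iff fun x => ?_
  rw [quantile_le_iff hm, MassFlow.pos_le_iff (D := massFlow κ ρ₀ u₀ hu₀ hm₀) hm,
    upper_massFlow_zero]

theorem density_massFlow_zero : (massFlow κ ρ₀ u₀ hu₀ hm₀).density 0 = ρ₀ := by
  rw [MassFlow.density_apply]
  conv_rhs => rw [← map_quantile ρ₀]
  refine Measure.map_congr ?_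
  filter_upwards [ae_restrict_mem measurableSet_Ioo] with m hm
  exact pos_massFlow_zero hm

theorem freeVel_massFlow (t : ℝ) : (massFlow κ ρ₀ u₀ hu₀ hm₀).freeVel t =
    inMass ρ₀ fun s => u₀ s + κ * field ρ₀ s * t := by
  ext m
  by_cases hm : m ∈ Ioo 0 (ρ₀.real univ)
  · simp only [MassFlow.freeVel, massFlow, inMass, indicator_of_mem hm, Function.comp_apply]
    ring
  · simp only [MassFlow.freeVel, massFlow, inMass, indicator_of_notMem hm]
    ring

theorem isWeakSolution_massFlow : IsWeakSolution κ ρ₀ u₀ (massFlow κ ρ₀ u₀ hu₀ hm₀).density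
    (massFlow κ ρ₀ u₀ hu₀ hm₀).velocity := by
  refine MassFlow.isWeakSolution (D := massFlow κ ρ₀ u₀ hu₀ hm₀) hu₀.measurable
    density_massFlow_zero fun m hm => ?_
  rw [pos_massFlow_zero hm]
  exact indicator_of_mem hm _

end Flow

/-! ### The vacuum case. -/

section Zero

theorem integralToMinimizer_zero (κ : ℝ) (u₀ f : ℝ → ℝ) (x t : ℝ) :
    integralToMinimizer κ 0 u₀ f x t = 0 := by
  simp [integralToMinimizer, integralRight, integralLeft]

theorem hasDistribDeriv_zero (g : ℝ → ℝ) : HasDistribDeriv (fun _ => 0) 0 g :=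
  ⟨locallyIntegrable_zero, fun x => ⟨univ, univ_mem, by simp [IntegrableOn]⟩, fun φ _ _ => by simp⟩

theorem isWeakSolution_zero (κ : ℝ) (u₀ : ℝ → ℝ) :
    IsWeakSolution κ 0 u₀ 0 (fun _ _ => 0) where
  finite t _ := by rw [zero_apply]; infer_instance
  measurable := measurable_const
  mass_lt_top T := by simp
  energy_lt_top T R := by simp
  mass_eq φ _ _ := by simp
  momentum_eq φ _ _ := by simp

end Zero

end

end EulerPoisson

open EulerPoisson in
/-- The derivatives `ρ(·,t) = ∂ₓ M(·,t)` and `ρu(·,t) = ∂ₓ P(·,t)` given by the variational formula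
form a weak solution, for finite measure initial density and momentum. -/
theorem theorem1p2 (κ : ℝ) (ρ₀ : Measure ℝ) [IsFiniteMeasure ρ₀] (u₀ : ℝ → ℝ)
    (hu₀ : PiecewiseContinuous u₀) (hm₀ : Integrable u₀ ρ₀) :
    ∃ (ρ : Kernel ℝ ℝ) (u : ℝ → ℝ → ℝ),
      (∀ t : ℝ, 0 ≤ t →
        HasDistribDeriv (fun x => mass κ ρ₀ u₀ x t) (ρ t) (fun _ => 1) ∧
        HasDistribDeriv (fun x => momentum κ ρ₀ u₀ x t) (ρ t) (fun x => u x t)) ∧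
      IsWeakSolution κ ρ₀ u₀ ρ u := by
  -- The flow needs positive total mass, so the zero measure is treated apart.
  rcases eq_or_ne ρ₀ 0 with rfl | hρ₀
  · refine ⟨0, fun _ _ => 0, fun t _ => ?_, isWeakSolution_zero κ u₀⟩
    simp only [mass, momentum, integralToMinimizer_zero, zero_apply]
    exact ⟨hasDistribDeriv_zero _, hasDistribDeriv_zero _⟩
  · have : NeZero ρ₀ := ⟨hρ₀⟩
    refine ⟨_, _, fun t _ => ⟨?_, ?_⟩, isWeakSolution_massFlow (hu₀ := hu₀) (hm₀ := hm₀)⟩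
    · refine MassFlow.hasDistribDeriv_mass (c := ρ₀.real (Iic 0)) fun x => ?_
      obtain ⟨m, hm, h, -⟩ := integralToMinimizer_eq (κ := κ) hu₀.measurable hm₀ x t
      exact ⟨m, hm, h⟩
    · refine MassFlow.hasDistribDeriv_momentum
        (c := (massFlow κ ρ₀ u₀ hu₀ hm₀).freeMom t (ρ₀.real (Iic 0))) fun x => ?_
      obtain ⟨m, hm, -, h⟩ := integralToMinimizer_eq (κ := κ) hu₀.measurable hm₀ x t
      refine ⟨m, hm, ?_⟩
      rw [h, MassFlow.freeMom, MassFlow.freeMom, freeVel_massFlow]
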